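/- **Proposition 2.1 (Time decay).** Write $\langle y\rangle=(1+|y|^2)^{1/2}$, $\widehat g(\xi)=\int_{\mathbb R^2}e^{-ix\cdot\xi}g(x)\,dx$ and $m(D)g=\mathcal F^{-1}(m\,\widehat g\,)$. Fix $\lambda\in\mathbb R$, a real number $n\ge 1000$, and put $k=\frac n{100}$, $\delta_0=\frac1{100}$. For $T>0$ and $u:[0,T]\to L^2(\mathbb R^2;\mathbb C)$ let $$\|u\|_{\Sigma_T}=\sup_{t\in[0,T]}\Big[\langle t\rangle^{-\delta_0}\big(\|u(t)\|_{H^n}+\|x\,e^{it\langle D\rangle}u(t)\|_{H^2}\big)+\langle t\rangle^{-2\delta_0}\|x^2e^{it\langle D\rangle}u(t)\|_{H^2}+\|\langle\xi\rangle^k\widehat u(t)\|_{L^\infty_\xi}\Big],$$ where $x^2=x\otimes x$. For every $A>0$ there are $\overline\varepsilon>0$ and $C>0$, depending only on $n$, $\lambda$ and $A$, such that the following holds for all $0<\varepsilon_1\le\overline\varepsilon$ and all $T>0$. Let $u$ be a solution on $[0,T]$ of the semi-relativistic Hartree equation $$-i\partial_tu+\langle D\rangle u=\lambda\,(|x|^{-1}*|u|^2)\,u\qquad\text{in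 }\mathbb R^2$$ (all terms belonging to $L^2(\mathbb R^2)$ for each $t$, with $\partial_tu$ taken in $L^2(\mathbb R^2)$), and assume the a priori bound $\|u\|_{\Sigma_T}\le A\varepsilon_1$. Then $$\|u(t)\|_{W^{\ell,\infty}(\mathbb R^2)}\le C\langle t\rangle^{-1}\varepsilon_1\qquad\text{for all }0\le\ell\le k,\ 0\le t\le T.$$ Here, for integer $\ell$, $\|g\|_{W^{\ell,\infty}}$ is the maximum of the $L^\infty$ norms of the weak derivatives of $g$ of order at most $\ell$; moreover, for every real $\ell\in[0,k]$ the same bound holds with $\|g\|_{W^{\ell,\infty}}=\|\langle D\rangle^\ell g\|_{L^\infty}$. -/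

import Mathlib

open MeasureTheory Set
open scoped FourierTransform ENNReal ContDiff

namespace SemiRelHartree

/-- The plane `ℝ²` with its Euclidean norm. -/
abbrev Plane : Type := EuclideanSpace ℝ (Fin 2)

/-- The complex Hilbert space `L²(ℝ²; ℂ)`. -/
abbrev L2 : Type := Lp ℂ 2 (volume : Measure Plane)

/-- The Japanese bracket `⟨x⟩ = (1 + |x|²)^{1/2}`, used for points of the plane and for times. -/
noncomputable def jap {E : Type*} [NormedAddCommGroup E] (x : E) : ℝ :=
  Real.sqrt (1 + ‖x‖ ^ 2)

theorem continuous_jap {E : Type*} [NormedAddCommGroup E] : Continuous (jap : E → ℝ) := by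
  unfold jap
  fun_prop

/-- The Fourier transform `ĝ(ξ) = ∫ e^{-i x·ξ} g(x) dx` on `L²(ℝ²)`, as a function of `ξ`
(defined up to null sets). Mathlib's `𝓕` uses the kernel `e^{-2πi x·η}`, hence `η = ξ / 2π`. -/
noncomputable def hat (g : L2) : Plane → ℂ :=
  fun ξ => (𝓕 g : L2) ((2 * Real.pi)⁻¹ • ξ)

/-- `h = m(D) g`, that is `ĥ(ξ) = m(ξ) ĝ(ξ)` for almost every `ξ`. -/
def IsMultiplier (m : Plane → ℂ) (g h : L2) : Prop :=
  hat h =ᵐ[volume] fun ξ => m ξ * hat g ξ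

/-- The `H^s` norm `‖⟨D⟩^s g‖_{L²} = (2π)⁻¹ ‖⟨ξ⟩^s ĝ‖_{L²}`; it is `∞` when `g ∉ H^s`. -/
noncomputable def sobolevNorm (s : ℝ) (g : L2) : ℝ≥0∞ :=
  ENNReal.ofReal (2 * Real.pi)⁻¹ *
    eLpNorm (fun ξ : Plane => ((jap ξ ^ s : ℝ) : ℂ) * hat g ξ) 2 volume

theorem memLp_phase_mul (t : ℝ) (G : L2) :
    MemLp (fun η : Plane =>
      Complex.exp (((t * jap ((2 * Real.pi) • η) : ℝ) : ℂ) * Complex.I) * G η) 2 volume := by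
  have hc : Continuous fun η : Plane =>
      Complex.exp (((t * jap ((2 * Real.pi) • η) : ℝ) : ℂ) * Complex.I) := by
    have h := continuous_jap (E := Plane)
    fun_prop
  refine (Lp.memLp G).of_le (hc.aestronglyMeasurable.mul (Lp.memLp G).1) ?_
  refine Filter.Eventually.of_forall fun η => ?_
  rw [norm_mul, Complex.norm_exp_ofReal_mul_I, one_mul]

/-- The unitary operator `e^{it⟨D⟩}` on `L²(ℝ²)`: multiplication of `ĝ(ξ)` by `e^{it⟨ξ⟩}`. -/
noncomputable def expItD (t : ℝ) (g : L2) : L2 :=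
  𝓕⁻ ((memLp_phase_mul t (𝓕 g : L2)).toLp _)

/-- The norm `‖w g‖_{H^s}` of the product of `g` with a weight `w`;
it is `∞` when `w g` is not in `L²` or not in `H^s`. -/
noncomputable def weightedSobolevNorm (w : Plane → ℝ) (s : ℝ) (g : L2) : ℝ≥0∞ :=
  ⨅ (h : L2) (_ : (h : Plane → ℂ) =ᵐ[volume] fun x => (w x : ℂ) * g x), sobolevNorm s h

/-- `‖u(t)‖_{E₁} = ‖u(t)‖_{H^n} + ‖x e^{it⟨D⟩} u(t)‖_{H²}`. -/
noncomputable def normE1 (n t : ℝ) (g : L2) : ℝ≥0∞ :=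
  sobolevNorm n g + ∑ j : Fin 2, weightedSobolevNorm (fun x => x j) 2 (expItD t g)

/-- `‖u(t)‖_{E₂} = ‖x² e^{it⟨D⟩} u(t)‖_{H²}`, where `x² = x ⊗ x`. -/
noncomputable def normE2 (t : ℝ) (g : L2) : ℝ≥0∞ :=
  ∑ i : Fin 2, ∑ j : Fin 2, weightedSobolevNorm (fun x => x i * x j) 2 (expItD t g)

/-- The scattering norm `‖⟨ξ⟩^k ĝ‖_{L^∞}`. -/
noncomputable def normS (k : ℝ) (g : L2) : ℝ≥0∞ :=
  eLpNorm (fun ξ : Plane => ((jap ξ ^ k : ℝ) : ℂ) * hat g ξ) ⊤ volume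

/-- The a priori norm
`sup_{t ∈ [0,T]} (⟨t⟩^{-δ₀} ‖u(t)‖_{E₁} + ⟨t⟩^{-2δ₀} ‖u(t)‖_{E₂} + ‖u(t)‖_S)`. -/
noncomputable def normSigma (n k δ₀ T : ℝ) (u : ℝ → L2) : ℝ≥0∞ :=
  ⨆ t ∈ Icc (0 : ℝ) T,
    (ENNReal.ofReal (jap t ^ (-δ₀)) * normE1 n t (u t)
      + ENNReal.ofReal (jap t ^ (-(2 * δ₀))) * normE2 t (u t)
      + normS k (u t))

/-- The Hartree potential `(|x|⁻¹ ∗ |g|²)(x)`. -/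
noncomputable def hartreePotential (g : Plane → ℂ) (x : Plane) : ℝ :=
  ∫ y : Plane, ‖x - y‖⁻¹ * ‖g y‖ ^ 2

/-- `u` solves `-i ∂ₜu + ⟨D⟩u = λ (|x|⁻¹ ∗ |u|²) u` on `[0,T]`, with all terms of the equation in
`L²(ℝ²)` and with the time derivative taken in `L²(ℝ²)` (one-sided at the end points). -/
def IsSolution (lam T : ℝ) (u : ℝ → L2) : Prop :=
  ∀ t ∈ Icc (0 : ℝ) T, ∃ ut Du Nu : L2,
    HasDerivWithinAt u ut (Icc 0 T) t ∧
    IsMultiplier (fun ξ => (jap ξ : ℂ)) (u t) Du ∧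
    (Nu : Plane → ℂ) =ᵐ[volume] (fun x => (hartreePotential (u t) x : ℂ) * u t x) ∧
    -(Complex.I • ut) + Du = (lam : ℂ) • Nu

/-- `h` is the weak derivative `∂_{I(0)} ⋯ ∂_{I(m-1)} g`. -/
def IsWeakDeriv {m : ℕ} (I : Fin m → Fin 2) (g h : Plane → ℂ) : Prop :=
  LocallyIntegrable h volume ∧
  ∀ φ : Plane → ℝ, ContDiff ℝ ∞ φ → HasCompactSupport φ →
    ∫ x, (iteratedFDeriv ℝ m φ x fun i => EuclideanSpace.single (I i) (1 : ℝ)) • g x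
      = (-1 : ℝ) ^ m • ∫ x, φ x • h x

/-- The `W^{ℓ,∞}` norm for integer `ℓ`: the maximum of the `L^∞` norms of the weak derivatives of
order at most `ℓ`; it is `∞` when one of them is not a bounded function. -/
noncomputable def supSobolevNorm (l : ℕ) (g : Plane → ℂ) : ℝ≥0∞ :=
  ⨆ (m : ℕ) (_ : m ≤ l) (I : Fin m → Fin 2),
    ⨅ (h : Plane → ℂ) (_ : IsWeakDeriv I g h), eLpNorm h ⊤ volume

/-- The `W^{ℓ,∞}` norm for real `ℓ`, namely `‖⟨D⟩^ℓ g‖_{L^∞}` for `g ∈ H^ℓ`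
(and `∞` when `g ∉ H^ℓ`). -/
noncomputable def supBesselNorm (l : ℝ) (g : L2) : ℝ≥0∞ :=
  ⨅ (h : L2) (_ : IsMultiplier (fun ξ => ((jap ξ ^ l : ℝ) : ℂ)) g h), eLpNorm h ⊤ volume

end SemiRelHartree

namespace SemiRelHartree

/-! ### The Fourier transform on `L²` as an explicit integral, with kernel `e^{-i x·ξ}`. -/

open SchwartzMap

/-! Write `f(t) = e^{it⟨D⟩}u(t)` for the profile, so that `û = e^{-it⟨ξ⟩} f̂`. The a priori norm
bounds `‖⟨x⟩² f‖_{L²}` and `‖⟨ξ⟩ⁿ f̂‖_{L²}` by some `β` of size `ε₁⟨t⟩^{1/50}`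
(`profileBound_of_normSigma_le`).

Dispersion. The Jacobian of the group velocity `ξ ↦ ∇⟨ξ⟩ = ξ/⟨ξ⟩` is `⟨ξ⟩⁻⁴`, so in the plane
stationary phase yields the rate `t⁻¹` with leading amplitude `⟨ξ⟩⁴ f̂`. In quantitative form
(`exists_linear_decay`), for a symbol `p` of order `k`, `|e^{-it⟨D⟩}p(D)f| ≲ (S + β t^{-2/5})/t`
with `S = sup ⟨ξ⟩^{k+4}|f̂|`. The slow growth of `β` is absorbed by `t^{-2/5}`, and everything
reduces to a bound on `S` that is uniform in time. The scattering part of the norm carries only the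
weight `⟨ξ⟩^k`; the four missing powers are recovered from the equation.

Uniform bound. On the Fourier side the linear term only rotates `û`, hence `∂ₜ|û|²` is a multiple of
`Im(conj û(ξ) · ∫ |η|⁻¹ corr(η) û(ξ-η) dη)`, where `corr` is the autocorrelation of `û`, that is,
the transform of `|u|²` up to a constant (`hat_hartree`, `fourier_solution_eq`). For `|η| <
t^{-4/5}` one replaces `conj û(ξ) û(ξ-η)` by `|f̂(ξ)|² e^{itη·∇⟨ξ⟩}`, with error governed by the
Hölder regularity of `f̂` and the Taylor remainder of `⟨ξ⟩`. The resulting main term is real, by the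
symmetry `η ↦ -η` (`im_integral_eq_zero`). For `|η| ≥ t^{-4/5}` the autocorrelation is an
oscillatory integral with phase `t(⟨σ⟩ - ⟨σ+η⟩)`. Strict monotonicity of the velocity
(`le_djap_sub`) makes this phase nonstationary, and two integrations by parts give decay
(`exists_integral_corr_high_le`). Altogether the imaginary part is `O(β³ |f̂| t^{-28/25})`
(`exists_abs_im_hartreeHat_le`). Interpolating Hölder continuity with the `Hⁿ` bound gives
`⟨ξ⟩^{n/3}|f̂| ≲ β` (`exists_ft_decay`), so `⟨ξ⟩^{n/3}|û|²` grows at a rate `ε₁⁴(1+t)^{-26/25}`,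
which is integrable. Since `2(k+4) ≤ n/3`, this bounds `S` (`exists_uniform_bound`).

As `f̂` has two derivatives only in an `L²` sense, both oscillatory arguments run on a `C²`
compactly supported truncation whose error is integrable and `O(t^{-3/2})` (`exists_trunc`). -/

theorem integral_fourier_mul_eq_flip {f g : Plane → ℂ} (hf : Integrable f) (hg : Integrable g) :
    ∫ ξ, 𝓕 f ξ * g ξ = ∫ x, f x * 𝓕 g x := by
  have := VectorFourier.integral_fourierIntegral_smul_eq_flip (L := innerₗ Plane) (μ := volume)
    (ν := volume) Real.continuous_fourierChar continuous_inner hf hg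
  simpa [flip_innerₗ] using! this

theorem integral_fourierInv_mul_eq_flip {f g : Plane → ℂ} (hf : Integrable f)
    (hg : Integrable g) :
    ∫ ξ, 𝓕⁻ f ξ * g ξ = ∫ x, f x * 𝓕⁻ g x := by
  have h := integral_fourier_mul_eq_flip hf hg.comp_neg
  simp_rw [Real.fourierInv_eq_fourier_comp_neg g, Real.fourierInv_eq_fourier_neg f]
  rw [← h, ← integral_neg_eq_self]
  simp

/-- The Fourier transform on `L²` agrees with the Fourier integral on `L¹ ∩ L²`. -/
theorem fourier_L2_ae_eq {g : L2} (h1 : Integrable (g : Plane → ℂ)) :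
    ((𝓕 g : L2) : Plane → ℂ) =ᵐ[volume] 𝓕 (g : Plane → ℂ) := by
  have hloc : LocallyIntegrable ((𝓕 g : L2) : Plane → ℂ) volume :=
    (Lp.memLp _).locallyIntegrable (by norm_num)
  have hc : Continuous (𝓕 (g : Plane → ℂ)) :=
    VectorFourier.fourierIntegral_continuous Real.continuous_fourierChar
      (by exact continuous_inner) h1
  refine ae_eq_of_integral_contDiff_smul_eq hloc hc.locallyIntegrable fun φ hφ hφc => ?_
  let ψ : 𝓢(Plane, ℂ) := HasCompactSupport.toSchwartzMap (f := fun x => (φ x : ℂ))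
    (hφc.comp_left (g := ((↑) : ℝ → ℂ)) (by simp)) (Complex.ofRealCLM.contDiff.comp hφ)
  have hψ : ∀ x, ψ x = (φ x : ℂ) := fun x => rfl
  -- Pairing with `φ` is computed twice, by duality for tempered distributions and by Fubini for the
  -- integral; test functions separate locally integrable functions.
  have h := congrArg (fun T => T ψ) (Lp.fourier_toTemperedDistribution_eq g)
  simp only [TemperedDistribution.fourier_apply, Lp.toTemperedDistribution_apply,
    SchwartzMap.fourier_coe] at h
  have h2 := integral_fourier_mul_eq_flip h1 ψ.integrable
  simp only [smul_eq_mul, hψ, Complex.real_smul] at h h2 ⊢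
  rw [← h]
  trans ∫ ξ, 𝓕 (g : Plane → ℂ) ξ * (φ ξ : ℂ)
  · rw [h2]; exact integral_congr_ae (Filter.Eventually.of_forall fun x => mul_comm _ _)
  · exact integral_congr_ae (Filter.Eventually.of_forall fun x => mul_comm _ _)

theorem fourierInv_L2_ae_eq {g : L2} (h1 : Integrable (g : Plane → ℂ)) :
    ((𝓕⁻ g : L2) : Plane → ℂ) =ᵐ[volume] 𝓕⁻ (g : Plane → ℂ) := by
  have hloc : LocallyIntegrable ((𝓕⁻ g : L2) : Plane → ℂ) volume :=
    (Lp.memLp _).locallyIntegrable (by norm_num)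
  have hc : Continuous (𝓕⁻ (g : Plane → ℂ)) := by
    have : Continuous (𝓕 (g : Plane → ℂ)) :=
      VectorFourier.fourierIntegral_continuous Real.continuous_fourierChar
        (by exact continuous_inner) h1
    have h2 : 𝓕⁻ (g : Plane → ℂ) = fun w => 𝓕 (g : Plane → ℂ) (-w) := by
      ext w; exact Real.fourierInv_eq_fourier_neg _ w
    rw [h2]; exact this.comp continuous_neg
  refine ae_eq_of_integral_contDiff_smul_eq hloc hc.locallyIntegrable fun φ hφ hφc => ?_
  let ψ : 𝓢(Plane, ℂ) := HasCompactSupport.toSchwartzMap (f := fun x => (φ x : ℂ))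
    (hφc.comp_left (g := ((↑) : ℝ → ℂ)) (by simp)) (Complex.ofRealCLM.contDiff.comp hφ)
  have hψ : ∀ x, ψ x = (φ x : ℂ) := fun x => rfl
  have h := congrArg (fun T => T ψ) (Lp.fourierInv_toTemperedDistribution_eq g)
  simp only [TemperedDistribution.fourierInv_apply, Lp.toTemperedDistribution_apply,
    SchwartzMap.fourierInv_coe] at h
  have h2 := integral_fourierInv_mul_eq_flip h1 ψ.integrable
  simp only [smul_eq_mul, hψ, Complex.real_smul] at h h2 ⊢
  rw [← h]
  trans ∫ ξ, 𝓕⁻ (g : Plane → ℂ) ξ * (φ ξ : ℂ)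
  · rw [h2]; exact integral_congr_ae (Filter.Eventually.of_forall fun x => mul_comm _ _)
  · exact integral_congr_ae (Filter.Eventually.of_forall fun x => mul_comm _ _)

theorem finrank_plane : Module.finrank ℝ Plane = 2 := by simp

theorem ae_comp_smul {p : Plane → Prop} {c : ℝ} (hc : c ≠ 0) (h : ∀ᵐ x ∂(volume : Measure Plane), p x) :
    ∀ᵐ x ∂(volume : Measure Plane), p (c • x) := by
  have hq : Measure.QuasiMeasurePreserving (fun x : Plane => c • x) volume volume := by
    refine ⟨measurable_const_smul c, ?_⟩
    rw [Measure.map_addHaar_smul _ hc]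
    exact Measure.smul_absolutelyContinuous
  exact hq.ae h

theorem eLpNorm_two_comp_smul {c : ℝ} (hc : 0 < c) (g : Plane → ℂ)
    (hg : AEStronglyMeasurable g volume) :
    eLpNorm (fun x => g (c • x)) 2 volume = ENNReal.ofReal c⁻¹ * eLpNorm g 2 volume := by
  have hm := Measure.map_addHaar_smul (volume : Measure Plane) hc.ne'
  have hg' : AEStronglyMeasurable g (Measure.map (fun x : Plane => c • x) volume) := by
    rw [hm]; exact hg.smul_measure _
  have h1 := eLpNorm_map_measure (p := 2) hg' (measurable_const_smul c).aemeasurable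
  have h2 : eLpNorm (fun x => g (c • x)) 2 volume
      = eLpNorm (g ∘ fun x : Plane => c • x) 2 volume := rfl
  rw [h2, ← h1, hm, eLpNorm_smul_measure_of_ne_zero]
  · simp only [finrank_plane, smul_eq_mul]
    congr 1
    rw [abs_of_pos (by positivity), ENNReal.ofReal_rpow_of_pos (by positivity)]
    congr 1
    rw [← inv_pow, ← Real.rpow_natCast, ← Real.rpow_mul (by positivity)]
    norm_num
  · simp only [finrank_plane]
    have : 0 < |(c ^ 2)⁻¹| := by positivity
    simpa using this.ne'

/-- The Fourier integral `∫ e^{-i x·ξ} f(x) dx`. -/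
noncomputable def ft (f : Plane → ℂ) (ξ : Plane) : ℂ :=
  ∫ x, Complex.exp (-((inner ℝ x ξ : ℝ) * Complex.I)) * f x

/-- The inverse Fourier integral `(2π)⁻² ∫ e^{i x·ξ} U(ξ) dξ`. -/
noncomputable def ift (U : Plane → ℂ) (x : Plane) : ℂ :=
  ((2 * Real.pi) ^ 2 : ℝ)⁻¹ * ∫ ξ, Complex.exp ((inner ℝ x ξ : ℝ) * Complex.I) * U ξ

theorem ft_eq_fourier (f : Plane → ℂ) (ξ : Plane) : ft f ξ = 𝓕 f ((2 * Real.pi)⁻¹ • ξ) := by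
  rw [Real.fourier_eq', ft]
  refine integral_congr_ae (Filter.Eventually.of_forall fun x => ?_)
  simp only [smul_eq_mul, inner_smul_right]
  congr 2
  push_cast
  field_simp

theorem ift_eq_fourierInv (U : Plane → ℂ) (x : Plane) :
    ift U x = 𝓕⁻ (fun η => U ((2 * Real.pi) • η)) x := by
  rw [Real.fourierInv_eq', ift]
  have := Measure.integral_comp_smul (volume : Measure Plane)
    (fun ξ => Complex.exp ((inner ℝ x ξ : ℝ) * Complex.I) * U ξ) (2 * Real.pi)
  rw [finrank_plane, abs_of_pos (by positivity)] at this
  rw [Complex.real_smul] at this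
  rw [← this]
  refine integral_congr_ae (Filter.Eventually.of_forall fun y => ?_)
  simp only [smul_eq_mul, inner_smul_right, real_inner_comm]

theorem two_pi_smul_inv (ξ : Plane) : (2 * Real.pi) • ((2 * Real.pi)⁻¹ • ξ) = ξ := by
  rw [smul_smul, mul_inv_cancel₀ (by positivity), one_smul]

theorem two_pi_inv_smul (ξ : Plane) : (2 * Real.pi)⁻¹ • ((2 * Real.pi) • ξ) = ξ := by
  rw [smul_smul, inv_mul_cancel₀ (by positivity), one_smul]

theorem eLpNorm_hat (g : L2) :
    eLpNorm (hat g) 2 volume = ENNReal.ofReal (2 * Real.pi) * eLpNorm g 2 volume := by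
  have h := eLpNorm_two_comp_smul (c := (2 * Real.pi)⁻¹) (by positivity) ((𝓕 g : L2) : Plane → ℂ)
    (Lp.aestronglyMeasurable _)
  rw [inv_inv] at h
  have h2 : eLpNorm ((𝓕 g : L2) : Plane → ℂ) 2 volume = eLpNorm g 2 volume := by
    have := Lp.norm_fourier_eq g
    rw [Lp.norm_def, Lp.norm_def] at this
    exact (ENNReal.toReal_eq_toReal_iff' (Lp.eLpNorm_ne_top _) (Lp.eLpNorm_ne_top _)).1 this
  rw [← h2, ← h]; rfl

theorem hat_ae_eq_ft {g : L2} (h1 : Integrable (g : Plane → ℂ)) :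
    hat g =ᵐ[volume] ft (g : Plane → ℂ) := by
  have := ae_comp_smul (c := (2 * Real.pi)⁻¹) (by positivity) (fourier_L2_ae_eq h1)
  filter_upwards [this] with ξ hξ
  rw [ft_eq_fourier, ← hξ]; rfl

theorem fourier_ae_eq_hat_comp (g : L2) :
    ((𝓕 g : L2) : Plane → ℂ) = fun η => hat g ((2 * Real.pi) • η) := by
  ext η; simp only [hat, two_pi_inv_smul]

/-- Every pointwise bound on the solution passes through this: an `L²` class with integrable
transform has an explicit continuous representative. -/
theorem ae_eq_ift_hat {g : L2} (h1 : Integrable (hat g)) :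
    (g : Plane → ℂ) =ᵐ[volume] ift (hat g) := by
  have hi : Integrable ((𝓕 g : L2) : Plane → ℂ) := by
    rw [fourier_ae_eq_hat_comp]
    exact h1.comp_smul (by positivity)
  have h := fourierInv_L2_ae_eq hi
  rw [FourierTransform.fourierInv_fourier_eq] at h
  filter_upwards [h] with x hx
  rw [ift_eq_fourierInv, hx, fourier_ae_eq_hat_comp]

/-- Surjectivity of `hat`; it supplies the candidates for the nonlinearity and for `⟨D⟩^ℓ u`, which
are then identified through their transforms. -/
theorem exists_hat_ae_eq {U : Plane → ℂ} (hU : MemLp U 2 volume) :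
    ∃ h : L2, hat h =ᵐ[volume] U := by
  have hm : MemLp (fun η => U ((2 * Real.pi) • η)) 2 volume := by
    have hq : Measure.QuasiMeasurePreserving (fun x : Plane => (2 * Real.pi) • x) volume volume := by
      refine ⟨measurable_const_smul _, ?_⟩
      rw [Measure.map_addHaar_smul _ (by positivity)]
      exact Measure.smul_absolutelyContinuous
    refine ⟨hU.1.comp_quasiMeasurePreserving hq, ?_⟩
    rw [eLpNorm_two_comp_smul (by positivity) _ hU.1]
    exact ENNReal.mul_lt_top ENNReal.ofReal_lt_top hU.2
  refine ⟨𝓕⁻ (hm.toLp _), ?_⟩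
  have := ae_comp_smul (c := (2 * Real.pi)⁻¹) (by positivity) hm.coeFn_toLp
  filter_upwards [this] with ξ hξ
  rw [hat, FourierTransform.fourier_fourierInv_eq, hξ, two_pi_smul_inv]

theorem hat_expItD (t : ℝ) (g : L2) :
    hat (expItD t g) =ᵐ[volume] fun ξ => Complex.exp (((t * jap ξ : ℝ) : ℂ) * Complex.I) * hat g ξ := by
  have := ae_comp_smul (c := (2 * Real.pi)⁻¹) (by positivity)
    (memLp_phase_mul t (𝓕 g : L2)).coeFn_toLp
  filter_upwards [this] with ξ hξ
  rw [hat, expItD, FourierTransform.fourier_fourierInv_eq, hξ, two_pi_smul_inv, hat]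

/-! ### The Japanese bracket: elementary bounds and integrability of its powers. -/

section Jap

variable {E : Type*} [NormedAddCommGroup E]

theorem jap_sq (x : E) : jap x ^ 2 = 1 + ‖x‖ ^ 2 := Real.sq_sqrt (by positivity)

theorem one_le_jap (x : E) : 1 ≤ jap x := by
  rw [jap, Real.one_le_sqrt]; nlinarith [sq_nonneg ‖x‖]

theorem jap_pos (x : E) : 0 < jap x := one_pos.trans_le (one_le_jap x)

theorem norm_le_jap (x : E) : ‖x‖ ≤ jap x :=
  Real.le_sqrt_of_sq_le (by linarith)

theorem jap_le_one_add (x : E) : jap x ≤ 1 + ‖x‖ := by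
  rw [jap, Real.sqrt_le_left (by positivity)]; nlinarith [norm_nonneg x]

/-- Since `⟨x⟩² - ⟨y⟩² = |x|² - |y|²` and `⟨x⟩ + ⟨y⟩` dominates `|x| + |y|`, the bracket is as
Lipschitz as the norm. -/
theorem abs_jap_sub_le (x y : E) : |jap x - jap y| ≤ ‖x - y‖ := by
  have h1 : (jap x - jap y) * (jap x + jap y) = (‖x‖ - ‖y‖) * (‖x‖ + ‖y‖) := by
    linear_combination jap_sq x - jap_sq y
  have h2 : |jap x - jap y| * (jap x + jap y) ≤ ‖x - y‖ * (jap x + jap y) := by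
    have h3 : 0 < jap x + jap y := add_pos (jap_pos x) (jap_pos y)
    calc |jap x - jap y| * (jap x + jap y) = |‖x‖ - ‖y‖| * (‖x‖ + ‖y‖) := by
          rw [← abs_of_pos h3, ← abs_mul, h1, abs_mul, abs_of_nonneg (a := ‖x‖ + ‖y‖) (by positivity)]
      _ ≤ ‖x - y‖ * (jap x + jap y) := by
          gcongr
          · exact abs_norm_sub_norm_le x y
          · exact norm_le_jap x
          · exact norm_le_jap y
  exact le_of_mul_le_mul_right h2 (add_pos (jap_pos x) (jap_pos y))

end Jap

theorem integrable_jap_rpow {s : ℝ} (hs : s < -2) :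
    Integrable (fun x : Plane => jap x ^ s) volume := by
  have := integrable_rpow_neg_one_add_norm_sq (E := Plane) (μ := volume) (r := -s)
    (by rw [finrank_plane]; push_cast; linarith)
  refine this.congr (Filter.Eventually.of_forall fun x => ?_)
  simp only [jap]
  rw [Real.sqrt_eq_rpow, ← Real.rpow_mul (by positivity)]
  congr 1; ring

theorem continuous_jap_rpow (s : ℝ) : Continuous fun x : Plane => jap x ^ s :=
  continuous_jap.rpow_const fun x => Or.inl (jap_pos x).ne'

theorem memLp_jap_rpow {s : ℝ} (hs : s < -1) :
    MemLp (fun x : Plane => jap x ^ s) 2 volume := by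
  rw [memLp_two_iff_integrable_sq (continuous_jap_rpow s).aestronglyMeasurable]
  refine (integrable_jap_rpow (s := s * 2) (by linarith)).congr
    (Filter.Eventually.of_forall fun x => ?_)
  simp only
  rw [Real.rpow_mul (jap_pos x).le, Real.rpow_two]

theorem exists_eLpNorm_jap_rpow_le {s : ℝ} (hs : s < -1) :
    ∃ C : ℝ, 0 < C ∧ eLpNorm (fun x : Plane => jap x ^ s) 2 volume ≤ ENNReal.ofReal C := by
  refine ⟨(eLpNorm (fun x : Plane => jap x ^ s) 2 volume).toReal + 1, by positivity, ?_⟩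
  rw [← ENNReal.ofReal_toReal (memLp_jap_rpow hs).2.ne]
  exact ENNReal.ofReal_le_ofReal (by simp)

/-- Cauchy–Schwarz in terms of upper bounds for the two `L²` norms. -/
theorem integral_norm_mul_le_of_eLpNorm_le {α E F : Type*} [MeasurableSpace α] {μ : Measure α}
    [NormedAddCommGroup E] [NormedAddCommGroup F] {g : α → E} {h : α → F}
    (hg : AEStronglyMeasurable g μ) (hh : AEStronglyMeasurable h μ) {a b : ℝ} (ha : 0 ≤ a)
    (hb : 0 ≤ b)
    (hga : eLpNorm g 2 μ ≤ ENNReal.ofReal a) (hhb : eLpNorm h 2 μ ≤ ENNReal.ofReal b) :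
    Integrable (fun x => ‖g x‖ * ‖h x‖) μ ∧ ∫ x, ‖g x‖ * ‖h x‖ ∂μ ≤ a * b := by
  have hgm : MemLp g 2 μ := ⟨hg, hga.trans_lt ENNReal.ofReal_lt_top⟩
  have hhm : MemLp h 2 μ := ⟨hh, hhb.trans_lt ENNReal.ofReal_lt_top⟩
  have hi : Integrable (fun x => ‖g x‖ * ‖h x‖) μ := hgm.norm.integrable_mul hhm.norm
  refine ⟨hi, ?_⟩
  have h1 : ENNReal.ofReal (∫ x, ‖g x‖ * ‖h x‖ ∂μ) ≤ ENNReal.ofReal (a * b) := by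
    rw [ofReal_integral_eq_lintegral_ofReal hi
      (Filter.Eventually.of_forall fun x => by positivity), ENNReal.ofReal_mul ha]
    calc ∫⁻ x, ENNReal.ofReal (‖g x‖ * ‖h x‖) ∂μ = ∫⁻ x, ‖g x‖ₑ * ‖h x‖ₑ ∂μ := by
          refine lintegral_congr fun x => ?_
          rw [ENNReal.ofReal_mul (norm_nonneg _), ofReal_norm, ofReal_norm]
      _ ≤ eLpNorm g 2 μ * eLpNorm h 2 μ := by
          have := ENNReal.lintegral_mul_le_Lp_mul_Lq μ (p := 2) (q := 2)
            ⟨by norm_num, by norm_num, by norm_num⟩ hg.enorm hh.enorm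
          rw [eLpNorm_eq_lintegral_rpow_enorm_toReal (by norm_num) (by norm_num),
            eLpNorm_eq_lintegral_rpow_enorm_toReal (by norm_num) (by norm_num)]
          simpa using this
      _ ≤ _ := mul_le_mul' hga hhb
  exact (ENNReal.ofReal_le_ofReal_iff (by positivity)).1 h1

theorem norm_exp_ofReal_mul_I_sub_le (a b : ℝ) :
    ‖Complex.exp (a * Complex.I) - Complex.exp (b * Complex.I)‖ ≤ |a - b| := by
  have h : Complex.exp (a * Complex.I) - Complex.exp (b * Complex.I)
      = Complex.exp (b * Complex.I) * (Complex.exp (Complex.I * ((a - b : ℝ) : ℂ)) - 1) := by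
    rw [mul_sub, ← Complex.exp_add]; congr 2
    · push_cast; ring
    · ring
  rw [h, norm_mul, Complex.norm_exp_ofReal_mul_I, one_mul]
  exact Real.norm_exp_I_mul_ofReal_sub_one_le

theorem norm_exp_ofReal_mul_I_sub_le_two (a b : ℝ) :
    ‖Complex.exp (a * Complex.I) - Complex.exp (b * Complex.I)‖ ≤ 2 := by
  refine (norm_sub_le _ _).trans ?_
  rw [Complex.norm_exp_ofReal_mul_I, Complex.norm_exp_ofReal_mul_I]; norm_num

/-! ### Regularity and decay of the transform of a profile. -/

/-- A profile `f` with `‖⟨x⟩² f‖_{L²} ≤ β` and `‖⟨ξ⟩ⁿ f̂‖_{L²} ≤ β`. -/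
structure ProfileBound (n β : ℝ) (f : Plane → ℂ) : Prop where
  meas : AEStronglyMeasurable f volume
  weight : eLpNorm (fun x => ((jap x ^ 2 : ℝ) : ℂ) * f x) 2 volume ≤ ENNReal.ofReal β
  sobolev : eLpNorm (fun ξ => ((jap ξ ^ n : ℝ) : ℂ) * ft f ξ) 2 volume ≤ ENNReal.ofReal β

theorem norm_ft_le (f : Plane → ℂ) (ξ : Plane) : ‖ft f ξ‖ ≤ ∫ x, ‖f x‖ := by
  refine (norm_integral_le_integral_norm _).trans_eq ?_
  refine integral_congr_ae (Filter.Eventually.of_forall fun x => ?_)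
  simp only [norm_mul]
  rw [← neg_mul, ← Complex.ofReal_neg, Complex.norm_exp_ofReal_mul_I, one_mul]

theorem integrable_exp_mul {f : Plane → ℂ} (hf : Integrable f) (ξ : Plane) :
    Integrable fun x => Complex.exp (-((inner ℝ x ξ : ℝ) * Complex.I)) * f x := by
  refine hf.bdd_mul (c := 1) ?_ (Filter.Eventually.of_forall fun x => ?_)
  · exact (by fun_prop : Continuous fun x : Plane =>
      Complex.exp (-((inner ℝ x ξ : ℝ) * Complex.I))).aestronglyMeasurable
  · rw [← neg_mul, ← Complex.ofReal_neg, Complex.norm_exp_ofReal_mul_I]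

theorem continuous_ft {f : Plane → ℂ} (hf : Integrable f) : Continuous (ft f) := by
  have hc : Continuous (𝓕 f) :=
    VectorFourier.fourierIntegral_continuous Real.continuous_fourierChar
      (by exact continuous_inner) hf
  have : ft f = fun ξ => 𝓕 f ((2 * Real.pi)⁻¹ • ξ) := funext (ft_eq_fourier f)
  rw [this]; fun_prop

theorem ft_sub {f g : Plane → ℂ} (hf : Integrable f) (hg : Integrable g) (ξ : Plane) :
    ft f ξ - ft g ξ = ft (fun x => f x - g x) ξ := by
  rw [ft, ft, ft, ← integral_sub (integrable_exp_mul hf ξ) (integrable_exp_mul hg ξ)]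
  simp only [mul_sub]

/-- Weighted `L¹` bounds for a profile. -/
theorem exists_integral_weight_le {s : ℝ} (hs : s < 1) : ∃ C : ℝ, 0 < C ∧
    ∀ (n β : ℝ) (f : Plane → ℂ), 0 ≤ β → ProfileBound n β f →
      Integrable (fun x => jap x ^ s * ‖f x‖) ∧ ∫ x, jap x ^ s * ‖f x‖ ≤ C * β := by
  -- Cauchy–Schwarz on `⟨x⟩^{s-2} · ⟨x⟩²|f|`; the first factor is square integrable in the plane
  -- exactly when `s < 1`.
  obtain ⟨C, hC, hCb⟩ := exists_eLpNorm_jap_rpow_le (s := s - 2) (by linarith)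
  refine ⟨C, hC, fun n β f hβ hf => ?_⟩
  have := integral_norm_mul_le_of_eLpNorm_le
    (continuous_jap_rpow (s - 2)).aestronglyMeasurable
    (((Complex.continuous_ofReal.comp (continuous_jap.pow 2)).aestronglyMeasurable).mul hf.meas)
    hC.le hβ hCb hf.weight
  have he : (fun x : Plane => ‖jap x ^ (s - 2)‖ * ‖((jap x ^ 2 : ℝ) : ℂ) * f x‖)
      = fun x => jap x ^ s * ‖f x‖ := by
    ext x
    have hj := jap_pos x
    rw [norm_mul, Complex.norm_real, Real.norm_of_nonneg (by positivity),
      Real.norm_of_nonneg (by positivity), ← mul_assoc, ← Real.rpow_two, ← Real.rpow_add hj]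
    norm_num
  rw [← he]
  exact this

theorem ProfileBound.integrable {n β : ℝ} {f : Plane → ℂ} (hβ : 0 ≤ β) (hf : ProfileBound n β f) :
    Integrable f := by
  obtain ⟨C, -, h⟩ := exists_integral_weight_le (s := 0) (by norm_num)
  have := (h n β f hβ hf).1
  simp only [Real.rpow_zero, one_mul] at this
  exact (integrable_norm_iff hf.meas).1 this

/-- Sup and Hölder bounds for the Fourier transform of a profile. -/
theorem exists_ft_holder : ∃ C : ℝ, 0 < C ∧
    ∀ (n β : ℝ) (f : Plane → ℂ), 0 ≤ β → ProfileBound n β f →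
      (∀ ξ, ‖ft f ξ‖ ≤ C * β) ∧
      ∀ ξ η, ‖ft f (ξ + η) - ft f ξ‖ ≤ C * β * Real.sqrt ‖η‖ := by
  obtain ⟨C, hC, h⟩ := exists_integral_weight_le (s := 1 / 2) (by norm_num)
  refine ⟨2 * C, by positivity, fun n β f hβ hf => ?_⟩
  obtain ⟨hi, hb⟩ := h n β f hβ hf
  have hfi := hf.integrable hβ
  have h1 : ∫ x, ‖f x‖ ≤ C * β := by
    refine le_trans (integral_mono hfi.norm hi fun x => ?_) hb
    exact le_mul_of_one_le_left (norm_nonneg _)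
      (Real.one_le_rpow (one_le_jap x) (by norm_num))
  refine ⟨fun ξ => (norm_ft_le f ξ).trans (h1.trans ?_), fun ξ η => ?_⟩
  · have : 0 ≤ C * β := by positivity
    linarith
  rw [ft, ft, ← integral_sub (integrable_exp_mul hfi _) (integrable_exp_mul hfi _)]
  -- The difference of exponentials is at most `2` and at most `⟨x⟩|η|`; the geometric mean of the
  -- two bounds costs only half a power of the weight.
  have key : ∀ x, ‖Complex.exp (-((inner ℝ x (ξ + η) : ℝ) * Complex.I)) * f x
      - Complex.exp (-((inner ℝ x ξ : ℝ) * Complex.I)) * f x‖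
      ≤ 2 * Real.sqrt ‖η‖ * (jap x ^ (1 / 2 : ℝ) * ‖f x‖) := by
    intro x
    rw [← sub_mul, norm_mul, ← mul_assoc]
    gcongr
    have e1 := norm_exp_ofReal_mul_I_sub_le (-inner ℝ x (ξ + η)) (-inner ℝ x ξ)
    have e2 := norm_exp_ofReal_mul_I_sub_le_two (-inner ℝ x (ξ + η)) (-inner ℝ x ξ)
    push_cast at e1 e2
    simp only [neg_mul] at e1 e2
    set z := ‖Complex.exp (-((inner ℝ x (ξ + η) : ℝ) * Complex.I))
      - Complex.exp (-((inner ℝ x ξ : ℝ) * Complex.I))‖ with hz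
    have e3 : z ≤ jap x * ‖η‖ := by
      refine e1.trans ?_
      have : -inner ℝ x (ξ + η) - -inner ℝ x ξ = -inner ℝ x η := by rw [inner_add_right]; ring
      rw [this, abs_neg]
      exact (abs_real_inner_le_norm x η).trans (by gcongr; exact norm_le_jap x)
    have hz0 : 0 ≤ z := norm_nonneg _
    rw [← Real.sqrt_eq_rpow, mul_assoc, ← Real.sqrt_mul (norm_nonneg _)]
    have : z ≤ Real.sqrt (4 * (‖η‖ * jap x)) := Real.le_sqrt_of_sq_le (by nlinarith)
    rw [Real.sqrt_mul (by norm_num)] at this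
    have h4 : Real.sqrt 4 = 2 := by
      rw [show (4 : ℝ) = 2 ^ 2 by norm_num]; exact Real.sqrt_sq (by norm_num)
    rwa [h4] at this
  refine (norm_integral_le_of_norm_le (hi.const_mul _)
    (Filter.Eventually.of_forall key)).trans ?_
  rw [integral_const_mul]
  calc 2 * √‖η‖ * ∫ x, jap x ^ (1 / 2 : ℝ) * ‖f x‖ ≤ 2 * √‖η‖ * (C * β) := by gcongr
    _ = _ := by ring

/-- Weighted `L¹` bound for the Fourier transform of a profile. -/
theorem exists_integral_ft_le : ∃ C : ℝ, 0 < C ∧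
    ∀ (n β : ℝ) (f : Plane → ℂ), 0 ≤ β → ProfileBound n β f →
      Integrable (fun ξ => jap ξ ^ (n - 2) * ‖ft f ξ‖) ∧
      ∫ ξ, jap ξ ^ (n - 2) * ‖ft f ξ‖ ≤ C * β := by
  -- Two powers of `⟨ξ⟩` pay for the passage from `L²` to `L¹` in the plane.
  obtain ⟨C, hC, hCb⟩ := exists_eLpNorm_jap_rpow_le (s := -2) (by norm_num)
  refine ⟨C, hC, fun n β f hβ hf => ?_⟩
  have := integral_norm_mul_le_of_eLpNorm_le
    (continuous_jap_rpow (-2)).aestronglyMeasurable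
    (((Complex.continuous_ofReal.comp (continuous_jap_rpow n)).aestronglyMeasurable).mul
      (continuous_ft (hf.integrable hβ)).aestronglyMeasurable)
    hC.le hβ hCb hf.sobolev
  have he : (fun x : Plane => ‖jap x ^ (-2 : ℝ)‖ * ‖((jap x ^ n : ℝ) : ℂ) * ft f x‖)
      = fun x => jap x ^ (n - 2) * ‖ft f x‖ := by
    ext x
    have hj := jap_pos x
    rw [norm_mul, Complex.norm_real, Real.norm_of_nonneg (by positivity),
      Real.norm_of_nonneg (by positivity), ← mul_assoc, ← Real.rpow_add hj]
    congr 2; ring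
  rw [← he]
  exact this

/-- Pointwise decay of the Fourier transform of a profile, by interpolating the Hölder bound with
the weighted `L²` bound. -/
theorem exists_ft_decay {n : ℝ} (hn : 0 ≤ n) : ∃ C : ℝ, 0 < C ∧
    ∀ (β : ℝ) (f : Plane → ℂ), 0 ≤ β → ProfileBound n β f →
      ∀ ξ, jap ξ ^ (n / 3) * ‖ft f ξ‖ ≤ C * β := by
  obtain ⟨C, hC, h⟩ := exists_ft_holder
  refine ⟨(8 * C ^ 2 * 2 ^ n) ^ (1 / 3 : ℝ), by positivity, fun β f hβ hf ξ => ?_⟩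
  obtain ⟨hsup, hhol⟩ := h n β f hβ hf
  set a := ‖ft f ξ‖ with ha
  rcases eq_or_lt_of_le (norm_nonneg (ft f ξ)) with h0 | h0
  · rw [ha, ← h0, mul_zero]; positivity
  have hL : 0 < C * β := h0.trans_le (hsup ξ)
  have hβ0 : 0 < β := pos_of_mul_pos_right hL hC.le
  have ha0 : 0 < a := h0
  -- With this radius the Hölder bound moves `f̂` by at most `Cβ√r = a/2`, so `|f̂| ≥ a/2` on the
  -- ball; and `r ≤ 1/4` keeps `⟨ζ⟩ ≥ ⟨ξ⟩/2` there. The weighted `L²` norm over the ball then forces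
  -- `⟨ξ⟩ⁿ a · a² ≲ β³`, whose cube root is the claim.
  set r := (a / (2 * (C * β))) ^ 2 with hr
  have hr0 : 0 < r := by positivity
  have haL : a / (2 * (C * β)) ≤ 1 / 2 := by
    rw [div_le_iff₀ (by positivity)]; linarith [hsup ξ]
  have hr1 : r ≤ 1 / 4 := by
    have : r ≤ (1 / 2) ^ 2 := by rw [hr]; gcongr
    norm_num at this ⊢; exact this
  set c := (jap ξ / 2) ^ n * (a / 2) with hc
  have hc0 : 0 < c := by have := jap_pos ξ; positivity
  have hlow : ∀ ζ ∈ Metric.ball ξ r, c ≤ ‖((jap ζ ^ n : ℝ) : ℂ) * ft f ζ‖ := by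
    intro ζ hζ
    rw [mem_ball_iff_norm] at hζ
    have hj := jap_pos ζ
    rw [norm_mul, Complex.norm_real, Real.norm_of_nonneg (by positivity), hc]
    have e1 : jap ξ / 2 ≤ jap ζ := by
      have := abs_jap_sub_le ζ ξ
      have h2 := (abs_le.1 this).1
      have := one_le_jap ξ
      linarith
    have e2 : a / 2 ≤ ‖ft f ζ‖ := by
      have h2 := hhol ξ (ζ - ξ)
      rw [add_sub_cancel] at h2
      have h3 : Real.sqrt ‖ζ - ξ‖ ≤ a / (2 * (C * β)) := by
        rw [Real.sqrt_le_left (by positivity)]; exact hζ.le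
      have h4 : C * β * Real.sqrt ‖ζ - ξ‖ ≤ a / 2 := by
        calc C * β * Real.sqrt ‖ζ - ξ‖ ≤ C * β * (a / (2 * (C * β))) := by gcongr
          _ = a / 2 := by field_simp
      have h5 := norm_sub_norm_le (ft f ξ) (ft f ζ)
      rw [norm_sub_rev] at h5
      linarith
    have := jap_pos ξ
    gcongr
  have hm : eLpNorm ((Metric.ball ξ r).indicator fun _ => (c : ℝ)) 2 volume ≤ ENNReal.ofReal β := by
    refine le_trans (eLpNorm_mono_real (g := fun ζ => ‖((jap ζ ^ n : ℝ) : ℂ) * ft f ζ‖) fun ζ => ?_)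
      ((eLpNorm_norm _).trans_le hf.sobolev)
    by_cases hζ : ζ ∈ Metric.ball ξ r
    · rw [indicator_of_mem hζ, Real.norm_of_nonneg hc0.le]; exact hlow ζ hζ
    · rw [indicator_of_notMem hζ, norm_zero]; positivity
  rw [eLpNorm_indicator_const measurableSet_ball (by norm_num) (by norm_num),
    EuclideanSpace.volume_ball_fin_two] at hm
  have hm2 : c * r ≤ β := by
    have hpi : ENNReal.ofReal c * ENNReal.ofReal r
        ≤ ‖c‖ₑ * (ENNReal.ofReal r ^ 2 * ENNReal.ofReal Real.pi) ^ (1 / ENNReal.toReal 2) := by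
      rw [← ofReal_norm, Real.norm_of_nonneg hc0.le]
      gcongr
      calc ENNReal.ofReal r = (ENNReal.ofReal r ^ (2 : ℝ)) ^ (1 / 2 : ℝ) := by
            rw [← ENNReal.rpow_mul]; norm_num
        _ ≤ (ENNReal.ofReal r ^ 2 * ENNReal.ofReal Real.pi) ^ (1 / 2 : ℝ) := by
            gcongr
            rw [ENNReal.rpow_two]
            refine le_mul_of_one_le_right' ?_
            rw [ENNReal.one_le_ofReal]
            linarith [Real.pi_gt_three]
        _ = _ := by simp
    have h6 := hpi.trans hm
    rw [← ENNReal.ofReal_mul hc0.le] at h6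
    exact (ENNReal.ofReal_le_ofReal_iff hβ).1 h6
  have hjn : (jap ξ / 2) ^ n = jap ξ ^ n / 2 ^ n := Real.div_rpow (jap_pos ξ).le (by norm_num) n
  have h2n : (0 : ℝ) < 2 ^ n := by positivity
  have hcube : jap ξ ^ n * a ^ 3 ≤ 8 * C ^ 2 * 2 ^ n * β ^ 3 := by
    rw [hc, hr, hjn] at hm2
    have e : jap ξ ^ n / 2 ^ n * (a / 2) * (a / (2 * (C * β))) ^ 2
        = jap ξ ^ n * a ^ 3 / (8 * C ^ 2 * 2 ^ n * β ^ 2) := by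
      field_simp; ring
    rw [e, div_le_iff₀ (by positivity)] at hm2
    linarith
  have hj := jap_pos ξ
  have h7 := Real.rpow_le_rpow (by positivity) hcube (show (0 : ℝ) ≤ 1 / 3 by norm_num)
  have hcr : ∀ y : ℝ, 0 ≤ y → (y ^ 3) ^ (1 / 3 : ℝ) = y := fun y hy => by
    rw [← Real.rpow_natCast, ← Real.rpow_mul hy]; norm_num
  rw [Real.mul_rpow (by positivity) (by positivity), Real.mul_rpow (by positivity) (by positivity),
    hcr a ha0.le, hcr β hβ, ← Real.rpow_mul hj.le, mul_one_div] at h7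
  exact h7

/-! ### Calculus of line derivatives and integration by parts. -/

section LineDeriv

theorem hasLineDerivAt_congr_deriv {E : Type*} [NormedAddCommGroup E] [NormedSpace ℝ E] {f : Plane → E}
    {a b : E} {ξ v : Plane} (h : HasLineDerivAt ℝ f a ξ v) (e : a = b) :
    HasLineDerivAt ℝ f b ξ v := e ▸ h

variable {𝕜 : Type*} [NontriviallyNormedField 𝕜] [NormedAlgebra ℝ 𝕜]
  {f g : Plane → 𝕜} {f' g' : 𝕜} {ξ v : Plane}

theorem hasLineDerivAt_mul (hf : HasLineDerivAt ℝ f f' ξ v) (hg : HasLineDerivAt ℝ g g' ξ v) :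
    HasLineDerivAt ℝ (fun ζ => f ζ * g ζ) (f' * g ξ + f ξ * g') ξ v := by
  have := HasDerivAt.mul hf hg
  simp only [zero_smul, add_zero] at this
  exact this

theorem hasLineDerivAt_add (hf : HasLineDerivAt ℝ f f' ξ v) (hg : HasLineDerivAt ℝ g g' ξ v) :
    HasLineDerivAt ℝ (fun ζ => f ζ + g ζ) (f' + g') ξ v :=
  HasDerivAt.add hf hg

theorem hasLineDerivAt_sub (hf : HasLineDerivAt ℝ f f' ξ v) (hg : HasLineDerivAt ℝ g g' ξ v) :
    HasLineDerivAt ℝ (fun ζ => f ζ - g ζ) (f' - g') ξ v :=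
  HasDerivAt.sub hf hg

theorem hasLineDerivAt_const (c : 𝕜) : HasLineDerivAt ℝ (fun _ : Plane => c) 0 ξ v :=
  hasDerivAt_const _ _

theorem hasLineDerivAt_inv {f : Plane → ℝ} {f' : ℝ} (hf : HasLineDerivAt ℝ f f' ξ v)
    (h0 : f ξ ≠ 0) : HasLineDerivAt ℝ (fun ζ => (f ζ)⁻¹) (-f' / f ξ ^ 2) ξ v := by
  have := HasDerivAt.inv (c := fun s : ℝ => f (ξ + s • v)) (x := (0 : ℝ)) hf (by simpa using h0)
  simp only [zero_smul, add_zero] at this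
  exact this

theorem hasLineDerivAt_ofReal {f : Plane → ℝ} {f' : ℝ} (hf : HasLineDerivAt ℝ f f' ξ v) :
    HasLineDerivAt ℝ (fun ζ => (f ζ : ℂ)) (f' : ℂ) ξ v :=
  HasDerivAt.ofReal_comp hf

theorem hasLineDerivAt_cexp {f : Plane → ℝ} {f' : ℝ} (hf : HasLineDerivAt ℝ f f' ξ v) :
    HasLineDerivAt ℝ (fun ζ => Complex.exp (f ζ * Complex.I))
      (Complex.exp (f ξ * Complex.I) * (f' * Complex.I)) ξ v := by
  have := HasDerivAt.cexp ((HasDerivAt.ofReal_comp hf).mul_const Complex.I)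
  simpa [HasLineDerivAt] using this

theorem hasLineDerivAt_comp {θ : ℝ → ℝ} {θ' : ℝ} {f : Plane → ℝ} {f' : ℝ}
    (hθ : HasDerivAt θ θ' (f ξ)) (hf : HasLineDerivAt ℝ f f' ξ v) :
    HasLineDerivAt ℝ (fun ζ => θ (f ζ)) (θ' * f') ξ v := by
  have := HasDerivAt.comp (h₂ := θ) (h := fun s : ℝ => f (ξ + s • v)) (x := (0 : ℝ))
    (h₂' := θ') (by simpa using hθ) hf
  exact this

theorem hasLineDerivAt_inner_left (x : Plane) :
    HasLineDerivAt ℝ (fun ζ : Plane => (inner ℝ x ζ : ℝ)) (inner ℝ x v) ξ v := by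
  have := ((hasDerivAt_id (0 : ℝ)).mul_const (inner ℝ x v)).const_add (inner ℝ x ξ)
  simpa [HasLineDerivAt, inner_add_right, inner_smul_right] using this

theorem hasLineDerivAt_inner_right (x : Plane) :
    HasLineDerivAt ℝ (fun ζ : Plane => (inner ℝ ζ x : ℝ)) (inner ℝ v x) ξ v := by
  simpa only [real_inner_comm] using hasLineDerivAt_inner_left (ξ := ξ) (v := v) x

/-- Integration by parts along a direction for continuously differentiable functions, one of them
compactly supported. -/
theorem integral_mul_lineDeriv {c c' g g' : Plane → ℂ} {v : Plane} (hc : Continuous c)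
    (hc' : Continuous c') (hg : Continuous g) (hg' : Continuous g') (hs : HasCompactSupport g)
    (hs' : HasCompactSupport g') (hcd : ∀ ξ, HasLineDerivAt ℝ c (c' ξ) ξ v)
    (hgd : ∀ ξ, HasLineDerivAt ℝ g (g' ξ) ξ v) :
    ∫ ξ, c ξ * g' ξ = -∫ ξ, c' ξ * g ξ := by
  have := integral_bilinear_hasLineDerivAt_right_eq_neg_left_of_integrable
    (μ := (volume : Measure Plane)) (B := ContinuousLinearMap.mul ℝ ℂ) (f := c) (f' := c') (g := g)
    (g' := g') (v := v)
    ((hc'.mul hg).integrable_of_hasCompactSupport hs.mul_left)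
    ((hc.mul hg').integrable_of_hasCompactSupport hs'.mul_left)
    ((hc.mul hg).integrable_of_hasCompactSupport hs.mul_left)
    (fun x _ => hcd x) (fun x _ => hgd x)
  simpa using this

end LineDeriv

/-! ### Derivatives of the Japanese bracket -/

/-- The derivative of `⟨ξ⟩` in direction `v`. -/
noncomputable def djap (v ξ : Plane) : ℝ := inner ℝ ξ v * (jap ξ)⁻¹

/-- The second derivative of `⟨ξ⟩` in directions `u`, `v`. -/
noncomputable def ddjap (u v ξ : Plane) : ℝ :=
  (inner ℝ u v - djap u ξ * djap v ξ) * (jap ξ)⁻¹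

/-- The third derivative of `⟨ξ⟩` in directions `z`, `u`, `v`. -/
noncomputable def dddjap (z u v ξ : Plane) : ℝ :=
  -(ddjap z u ξ * djap v ξ + djap u ξ * ddjap z v ξ + ddjap u v ξ * djap z ξ) * (jap ξ)⁻¹

theorem hasLineDerivAt_jap (ξ v : Plane) : HasLineDerivAt ℝ (jap : Plane → ℝ) (djap v ξ) ξ v := by
  have h0 : HasLineDerivAt ℝ (fun ζ : Plane => 1 + ‖ζ‖ ^ 2) (2 * inner ℝ ξ v) ξ v := by
    have h := hasLineDerivAt_add (ξ := ξ) (v := v) (hasLineDerivAt_const (1 : ℝ))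
      (((hasStrictFDerivAt_norm_sq ξ).hasFDerivAt).hasLineDerivAt v)
    simpa using h
  have h1 : HasDerivAt Real.sqrt (1 / (2 * jap ξ)) (1 + ‖ξ‖ ^ 2) :=
    Real.hasDerivAt_sqrt (by positivity)
  refine hasLineDerivAt_congr_deriv (hasLineDerivAt_comp h1 h0) ?_
  have := (jap_pos ξ).ne'
  rw [djap]; field_simp

theorem hasLineDerivAt_inv_jap (ξ v : Plane) :
    HasLineDerivAt ℝ (fun ζ : Plane => (jap ζ)⁻¹) (-djap v ξ * (jap ξ)⁻¹ * (jap ξ)⁻¹) ξ v := by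
  refine hasLineDerivAt_congr_deriv (hasLineDerivAt_inv (hasLineDerivAt_jap ξ v) (jap_pos ξ).ne') ?_
  have := (jap_pos ξ).ne'
  field_simp

theorem hasLineDerivAt_djap (ξ u v : Plane) : HasLineDerivAt ℝ (djap v) (ddjap u v ξ) ξ u := by
  refine hasLineDerivAt_congr_deriv (hasLineDerivAt_mul (hasLineDerivAt_inner_right v)
    (hasLineDerivAt_inv_jap ξ u)) ?_
  rw [ddjap, djap, djap]; ring

theorem hasLineDerivAt_ddjap (ξ z u v : Plane) :
    HasLineDerivAt ℝ (ddjap u v) (dddjap z u v ξ) ξ z := by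
  refine hasLineDerivAt_congr_deriv
    (hasLineDerivAt_mul (hasLineDerivAt_sub (hasLineDerivAt_const (inner ℝ u v))
    (hasLineDerivAt_mul (hasLineDerivAt_djap ξ z u) (hasLineDerivAt_djap ξ z v)))
    (hasLineDerivAt_inv_jap ξ z)) ?_
  simp only [dddjap, ddjap]; ring

theorem continuous_jap_inv : Continuous fun ξ : Plane => (jap ξ)⁻¹ :=
  continuous_jap.inv₀ fun ξ => (jap_pos ξ).ne'

theorem continuous_djap (v : Plane) : Continuous (djap v) := by
  have := continuous_jap_inv
  unfold djap; fun_prop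

theorem continuous_ddjap (u v : Plane) : Continuous (ddjap u v) := by
  have := continuous_jap_inv
  have := continuous_djap
  unfold ddjap; fun_prop

theorem continuous_dddjap (z u v : Plane) : Continuous (dddjap z u v) := by
  have := continuous_jap_inv
  have := continuous_djap
  have := continuous_ddjap
  unfold dddjap; fun_prop

theorem abs_djap_le (v ξ : Plane) : |djap v ξ| ≤ ‖v‖ := by
  rw [djap, abs_mul, abs_inv, abs_of_pos (jap_pos ξ), ← div_eq_mul_inv, div_le_iff₀ (jap_pos ξ)]
  calc |inner ℝ ξ v| ≤ ‖ξ‖ * ‖v‖ := abs_real_inner_le_norm ξ v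
    _ ≤ jap ξ * ‖v‖ := by gcongr; exact norm_le_jap ξ
    _ = _ := mul_comm _ _

theorem inv_jap_le_one (ξ : Plane) : (jap ξ)⁻¹ ≤ 1 := inv_le_one_of_one_le₀ (one_le_jap ξ)

theorem abs_ddjap_le (u v ξ : Plane) : |ddjap u v ξ| ≤ 2 * ‖u‖ * ‖v‖ := by
  have h1 := abs_djap_le u ξ
  have h2 := abs_djap_le v ξ
  have h3 := inv_jap_le_one ξ
  have hj := inv_pos.2 (jap_pos ξ)
  rw [ddjap, abs_mul, abs_of_pos hj]
  calc |inner ℝ u v - djap u ξ * djap v ξ| * (jap ξ)⁻¹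
      ≤ (|inner ℝ u v| + |djap u ξ| * |djap v ξ|) * 1 := by
        rw [← abs_mul]; gcongr; exact abs_sub _ _
    _ ≤ (‖u‖ * ‖v‖ + ‖u‖ * ‖v‖) * 1 := by
        gcongr; exact abs_real_inner_le_norm u v
    _ = _ := by ring

theorem abs_dddjap_le (z u v ξ : Plane) : |dddjap z u v ξ| ≤ 6 * ‖z‖ * ‖u‖ * ‖v‖ := by
  have hj := inv_pos.2 (jap_pos ξ)
  rw [dddjap, abs_mul, abs_of_pos hj, abs_neg]
  calc |ddjap z u ξ * djap v ξ + djap u ξ * ddjap z v ξ + ddjap u v ξ * djap z ξ| * (jap ξ)⁻¹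
      ≤ (|ddjap z u ξ| * |djap v ξ| + |djap u ξ| * |ddjap z v ξ| + |ddjap u v ξ| * |djap z ξ|) * 1 := by
        rw [← abs_mul, ← abs_mul, ← abs_mul]
        gcongr
        · exact abs_add_three _ _ _
        · exact inv_jap_le_one ξ
    _ ≤ ((2 * ‖z‖ * ‖u‖) * ‖v‖ + ‖u‖ * (2 * ‖z‖ * ‖v‖) + (2 * ‖u‖ * ‖v‖) * ‖z‖) * 1 := by
        gcongr <;> first | apply abs_ddjap_le | apply abs_djap_le
    _ = _ := by ring

/-- The standard unit vectors of the plane. -/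
noncomputable def e (j : Fin 2) : Plane := EuclideanSpace.single j 1

theorem norm_e (j : Fin 2) : ‖e j‖ = 1 := by simp [e]

/-- `G1` and `G2` are the first and second directional derivatives of the compactly supported
`C²` function `G`. -/
structure IsC2c (G : Plane → ℂ) (G1 : Plane → Plane → ℂ) (G2 : Plane → Plane → Plane → ℂ) :
    Prop where
  cont : Continuous G
  cont1 : ∀ v, Continuous (G1 v)
  cont2 : ∀ u v, Continuous (G2 u v)
  supp : HasCompactSupport G
  supp1 : ∀ v, HasCompactSupport (G1 v)
  supp2 : ∀ u v, HasCompactSupport (G2 u v)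
  deriv1 : ∀ v ξ, HasLineDerivAt ℝ G (G1 v ξ) ξ v
  deriv2 : ∀ u v ξ, HasLineDerivAt ℝ (G1 v) (G2 u v ξ) ξ u

/-! ### Stationary phase for `x·ξ - t⟨ξ⟩`: coefficients of the integration by parts. -/

section Oscillatory

variable (t : ℝ) (v : Plane)

/-- The components of the gradient of `v·ξ - ⟨ξ⟩`. -/
noncomputable def oscY (j : Fin 2) (ξ : Plane) : ℝ := v j - djap (e j) ξ

/-- The weight `(1 + t|∇(v·ξ - ⟨ξ⟩)|²)⁻¹`. -/
noncomputable def oscW (ξ : Plane) : ℝ := (1 + t * (oscY v 0 ξ ^ 2 + oscY v 1 ξ ^ 2))⁻¹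

/-- This is `-1/2` times the derivative of `|∇(v·ξ - ⟨ξ⟩)|²` along `u`. In the names below, the
suffixes `1` and `2` mark first and second directional derivatives. -/
noncomputable def oscS (u ξ : Plane) : ℝ :=
  oscY v 0 ξ * ddjap u (e 0) ξ + oscY v 1 ξ * ddjap u (e 1) ξ

noncomputable def oscS1 (z u ξ : Plane) : ℝ :=
  (oscY v 0 ξ * dddjap z u (e 0) ξ - ddjap z (e 0) ξ * ddjap u (e 0) ξ)
    + (oscY v 1 ξ * dddjap z u (e 1) ξ - ddjap z (e 1) ξ * ddjap u (e 1) ξ)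

noncomputable def oscW1 (u ξ : Plane) : ℝ := 2 * t * oscW t v ξ ^ 2 * oscS v u ξ

noncomputable def oscW2 (z u ξ : Plane) : ℝ :=
  2 * t * (2 * oscW t v ξ * oscW1 t v z ξ * oscS v u ξ + oscW t v ξ ^ 2 * oscS1 v z u ξ)

noncomputable def oscB (j : Fin 2) (ξ : Plane) : ℝ := oscW t v ξ * oscY v j ξ

noncomputable def oscB1 (u : Plane) (j : Fin 2) (ξ : Plane) : ℝ :=
  oscW1 t v u ξ * oscY v j ξ - oscW t v ξ * ddjap u (e j) ξ

noncomputable def oscB2 (z u : Plane) (j : Fin 2) (ξ : Plane) : ℝ :=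
  oscW2 t v z u ξ * oscY v j ξ - oscW1 t v u ξ * ddjap z (e j) ξ
    - (oscW1 t v z ξ * ddjap u (e j) ξ + oscW t v ξ * dddjap z u (e j) ξ)

/-- With `b = w∇(v·ξ - ⟨ξ⟩)`, whose components are `oscB`, this is `w + i div b`: the zeroth order
coefficient after one integration by parts. -/
noncomputable def oscA (ξ : Plane) : ℂ :=
  oscW t v ξ + ((oscB1 t v (e 0) 0 ξ + oscB1 t v (e 1) 1 ξ : ℝ) : ℂ) * Complex.I

noncomputable def oscA1 (z ξ : Plane) : ℂ :=
  oscW1 t v z ξ + ((oscB2 t v z (e 0) 0 ξ + oscB2 t v z (e 1) 1 ξ : ℝ) : ℂ) * Complex.I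

variable {t}

theorem hasLineDerivAt_oscY (j : Fin 2) (u ξ : Plane) :
    HasLineDerivAt ℝ (oscY v j) (-ddjap u (e j) ξ) ξ u :=
  hasLineDerivAt_congr_deriv (hasLineDerivAt_sub (hasLineDerivAt_const (v j))
    (hasLineDerivAt_djap ξ u (e j))) (by ring)

theorem oscW_aux_pos (ht : 0 < t) (ξ : Plane) : 0 < 1 + t * (oscY v 0 ξ ^ 2 + oscY v 1 ξ ^ 2) := by positivity

theorem hasLineDerivAt_oscW (ht : 0 < t) (u ξ : Plane) :
    HasLineDerivAt ℝ (oscW t v) (oscW1 t v u ξ) ξ u := by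
  have h (j : Fin 2) := hasLineDerivAt_mul (hasLineDerivAt_oscY v j u ξ) (hasLineDerivAt_oscY v j u ξ)
  have h2 : HasLineDerivAt ℝ (fun ζ => 1 + t * (oscY v 0 ζ ^ 2 + oscY v 1 ζ ^ 2))
      (-2 * t * oscS v u ξ) ξ u := by
    have := hasLineDerivAt_add (hasLineDerivAt_const (1 : ℝ))
      (hasLineDerivAt_mul (hasLineDerivAt_const t) (hasLineDerivAt_add (h 0) (h 1)))
    simp only [← pow_two] at this
    refine hasLineDerivAt_congr_deriv this ?_
    rw [oscS]; ring
  refine hasLineDerivAt_congr_deriv (hasLineDerivAt_inv h2 (oscW_aux_pos v ht ξ).ne') ?_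
  rw [oscW1, oscW]
  have := (oscW_aux_pos v ht ξ).ne'
  field_simp

theorem hasLineDerivAt_oscS (z u ξ : Plane) :
    HasLineDerivAt ℝ (oscS v u) (oscS1 v z u ξ) ξ z := by
  refine hasLineDerivAt_congr_deriv (hasLineDerivAt_add
    (hasLineDerivAt_mul (hasLineDerivAt_oscY v 0 z ξ) (hasLineDerivAt_ddjap ξ z u (e 0)))
    (hasLineDerivAt_mul (hasLineDerivAt_oscY v 1 z ξ) (hasLineDerivAt_ddjap ξ z u (e 1)))) ?_
  rw [oscS1]; ring

theorem hasLineDerivAt_oscW1 (ht : 0 < t) (z u ξ : Plane) :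
    HasLineDerivAt ℝ (oscW1 t v u) (oscW2 t v z u ξ) ξ z := by
  have hw := hasLineDerivAt_oscW v ht z ξ
  have := hasLineDerivAt_mul (hasLineDerivAt_mul (hasLineDerivAt_const (2 * t))
    (hasLineDerivAt_mul hw hw)) (hasLineDerivAt_oscS v z u ξ)
  simp only [← pow_two] at this
  refine hasLineDerivAt_congr_deriv this ?_
  rw [oscW2]; ring

theorem hasLineDerivAt_oscB (ht : 0 < t) (u : Plane) (j : Fin 2) (ξ : Plane) :
    HasLineDerivAt ℝ (oscB t v j) (oscB1 t v u j ξ) ξ u := by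
  refine hasLineDerivAt_congr_deriv (hasLineDerivAt_mul (hasLineDerivAt_oscW v ht u ξ)
    (hasLineDerivAt_oscY v j u ξ)) ?_
  rw [oscB1]; ring

theorem hasLineDerivAt_oscB1 (ht : 0 < t) (z u : Plane) (j : Fin 2) (ξ : Plane) :
    HasLineDerivAt ℝ (oscB1 t v u j) (oscB2 t v z u j ξ) ξ z := by
  refine hasLineDerivAt_congr_deriv (hasLineDerivAt_sub
    (hasLineDerivAt_mul (hasLineDerivAt_oscW1 v ht z u ξ) (hasLineDerivAt_oscY v j z ξ))
    (hasLineDerivAt_mul (hasLineDerivAt_oscW v ht z ξ) (hasLineDerivAt_ddjap ξ z u (e j)))) ?_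
  rw [oscB2]; ring

theorem hasLineDerivAt_oscA (ht : 0 < t) (z ξ : Plane) : HasLineDerivAt ℝ (oscA t v) (oscA1 t v z ξ) ξ z := by
  refine hasLineDerivAt_congr_deriv (hasLineDerivAt_add
    (hasLineDerivAt_ofReal (hasLineDerivAt_oscW v ht z ξ))
    (hasLineDerivAt_mul (hasLineDerivAt_ofReal
      (hasLineDerivAt_add (hasLineDerivAt_oscB1 v ht z (e 0) 0 ξ)
        (hasLineDerivAt_oscB1 v ht z (e 1) 1 ξ))) (hasLineDerivAt_const Complex.I))) ?_
  rw [oscA1]; ring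

theorem continuous_oscY (j : Fin 2) : Continuous (oscY v j) := by
  have := continuous_djap (e j)
  unfold oscY; fun_prop

theorem continuous_oscW (ht : 0 < t) : Continuous (oscW t v) := by
  have := continuous_oscY v
  exact Continuous.inv₀ (by fun_prop) fun ξ => (oscW_aux_pos v ht ξ).ne'

theorem continuous_oscS (u : Plane) : Continuous (oscS v u) := by
  have := continuous_oscY v
  have := continuous_ddjap
  unfold oscS; fun_prop

theorem continuous_oscS1 (z u : Plane) : Continuous (oscS1 v z u) := by
  have := continuous_oscY v
  have := continuous_ddjap
  have := continuous_dddjap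
  unfold oscS1; fun_prop

theorem continuous_oscW1 (ht : 0 < t) (u : Plane) : Continuous (oscW1 t v u) := by
  have := continuous_oscW v ht
  have := continuous_oscS v u
  unfold oscW1; fun_prop

theorem continuous_oscW2 (ht : 0 < t) (z u : Plane) : Continuous (oscW2 t v z u) := by
  have := continuous_oscW v ht
  have := continuous_oscW1 v ht
  have := continuous_oscS v u
  have := continuous_oscS1 v z u
  unfold oscW2; fun_prop

theorem continuous_oscB (ht : 0 < t) (j : Fin 2) : Continuous (oscB t v j) := by
  have := continuous_oscW v ht
  have := continuous_oscY v
  unfold oscB; fun_prop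

theorem continuous_oscB1 (ht : 0 < t) (u : Plane) (j : Fin 2) : Continuous (oscB1 t v u j) := by
  have := continuous_oscW v ht
  have := continuous_oscW1 v ht
  have := continuous_oscY v
  have := continuous_ddjap
  unfold oscB1; fun_prop

theorem continuous_oscB2 (ht : 0 < t) (z u : Plane) (j : Fin 2) : Continuous (oscB2 t v z u j) := by
  have := continuous_oscW v ht
  have := continuous_oscW1 v ht
  have := continuous_oscW2 v ht
  have := continuous_oscY v
  have := continuous_ddjap
  have := continuous_dddjap
  unfold oscB2; fun_prop

theorem continuous_oscA (ht : 0 < t) : Continuous (oscA t v) := by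
  have := continuous_oscW v ht
  have := continuous_oscB1 v ht
  unfold oscA; fun_prop

theorem continuous_oscA1 (ht : 0 < t) (z : Plane) : Continuous (oscA1 t v z) := by
  have := continuous_oscW1 v ht
  have := continuous_oscB2 v ht
  unfold oscA1; fun_prop

/-! Bounds in terms of `σ = √w`. -/

theorem oscW_pos (ht : 0 < t) (ξ : Plane) : 0 < oscW t v ξ := inv_pos.2 (oscW_aux_pos v ht ξ)

theorem oscW_le_one (ht : 0 < t) (ξ : Plane) : oscW t v ξ ≤ 1 :=
  inv_le_one_of_one_le₀ (le_add_of_nonneg_right (by positivity))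

/-- Because `t|y|²w = 1 - w`, each factor `y` is worth `1/(√t σ)` with `σ = √w`. All the coefficient
bounds follow by counting such factors. -/
theorem osc_abs_le (ht : 0 < t) (j : Fin 2) (ξ : Plane) :
    |oscY v j ξ| * (Real.sqrt t * Real.sqrt (oscW t v ξ)) ≤ 1 := by
  have hw := oscW_pos v ht ξ
  rw [← Real.sqrt_mul ht.le, ← Real.sqrt_sq_eq_abs, ← Real.sqrt_mul (by positivity),
    Real.sqrt_le_one]
  have h1 : (1 + t * (oscY v 0 ξ ^ 2 + oscY v 1 ξ ^ 2)) * oscW t v ξ = 1 :=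
    mul_inv_cancel₀ (oscW_aux_pos v ht ξ).ne'
  have h2 : oscY v j ξ ^ 2 ≤ oscY v 0 ξ ^ 2 + oscY v 1 ξ ^ 2 := by
    fin_cases j <;> simp [sq_nonneg]
  calc oscY v j ξ ^ 2 * (t * oscW t v ξ) ≤
        (oscY v 0 ξ ^ 2 + oscY v 1 ξ ^ 2) * (t * oscW t v ξ) := by gcongr
    _ ≤ 1 := by nlinarith

end Oscillatory

/-- Elementary bounds behind the stationary phase estimate. -/
theorem osc_bounds {t : ℝ} (ht : 1 ≤ t) (v ξ : Plane) :
    (∀ j, |oscB t v j ξ| ≤ Real.sqrt (oscW t v ξ) / Real.sqrt t) ∧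
    (∀ i j, |oscB1 t v (e i) j ξ| ≤ 10 * oscW t v ξ) ∧
    ‖oscA t v ξ‖ ≤ 21 * oscW t v ξ ∧
    ∀ i, ‖oscA1 t v (e i) ξ‖ ≤ 420 * Real.sqrt t * oscW t v ξ := by
  have ht0 : 0 < t := by linarith
  have hw := oscW_pos v ht0 ξ
  have hw1 := oscW_le_one v ht0 ξ
  set w := oscW t v ξ with hwdef
  set T := Real.sqrt t with hT
  set σ := Real.sqrt w with hσ
  have hσ0 : 0 < σ := Real.sqrt_pos.2 hw
  have hσ1 : σ ≤ 1 := Real.sqrt_le_one.2 hw1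
  have hσ2 : σ ^ 2 = w := Real.sq_sqrt hw.le
  have hT1 : 1 ≤ T := Real.one_le_sqrt.2 ht
  have hT2 : T ^ 2 = t := Real.sq_sqrt ht0.le
  have hT0 : 0 < T := by linarith
  have hy : ∀ j, |oscY v j ξ| ≤ 1 / (T * σ) := fun j => by
    rw [le_div_iff₀ (by positivity)]; exact osc_abs_le v ht0 j ξ
  have hh : ∀ i j, |ddjap (e i) (e j) ξ| ≤ 2 := fun i j => by
    simpa [norm_e] using abs_ddjap_le (e i) (e j) ξ
  have hd : ∀ i j k, |dddjap (e i) (e j) (e k) ξ| ≤ 6 := fun i j k => by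
    simpa [norm_e] using abs_dddjap_le (e i) (e j) (e k) ξ
  have hS : ∀ i, |oscS v (e i) ξ| ≤ 4 / (T * σ) := fun i => by
    calc |oscS v (e i) ξ| ≤ |oscY v 0 ξ| * |ddjap (e i) (e 0) ξ|
          + |oscY v 1 ξ| * |ddjap (e i) (e 1) ξ| := by
          rw [oscS, ← abs_mul, ← abs_mul]; exact abs_add_le _ _
      _ ≤ 1 / (T * σ) * 2 + 1 / (T * σ) * 2 := by
          gcongr <;> first | apply hy | apply hh
      _ = _ := by ring
  have hS1 : ∀ i l, |oscS1 v (e i) (e l) ξ| ≤ 12 / (T * σ) + 8 := fun i l => by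
    have hone : ∀ m, |oscY v m ξ * dddjap (e i) (e l) (e m) ξ
        - ddjap (e i) (e m) ξ * ddjap (e l) (e m) ξ| ≤ 6 / (T * σ) + 4 := fun m => by
      calc _ ≤ |oscY v m ξ| * |dddjap (e i) (e l) (e m) ξ|
            + |ddjap (e i) (e m) ξ| * |ddjap (e l) (e m) ξ| := by
            rw [← abs_mul, ← abs_mul]; exact abs_sub _ _
        _ ≤ 1 / (T * σ) * 6 + 2 * 2 := by
            gcongr <;> first | apply hy | apply hh | apply hd
        _ = _ := by ring
    rw [oscS1]
    refine (abs_add_le _ _).trans ((add_le_add (hone 0) (hone 1)).trans_eq ?_)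
    ring
  -- Differentiating `w = σ²` costs a factor `Tσ`, where `T = √t`.
  have hW1 : ∀ i, |oscW1 t v (e i) ξ| ≤ 8 * T * σ ^ 3 := fun i => by
    rw [oscW1, abs_mul, abs_of_pos (by positivity), ← hwdef, ← hσ2, ← hT2]
    calc 2 * T ^ 2 * (σ ^ 2) ^ 2 * |oscS v (e i) ξ|
        ≤ 2 * T ^ 2 * (σ ^ 2) ^ 2 * (4 / (T * σ)) := by gcongr; exact hS i
      _ = _ := by field_simp; ring
  have hW2 : ∀ i l, |oscW2 t v (e i) (e l) ξ| ≤ 144 * T ^ 2 * σ ^ 4 + 24 * T * σ ^ 3 := fun i l => by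
    rw [oscW2, abs_mul, abs_of_pos (by positivity), ← hwdef, ← hσ2, ← hT2]
    calc 2 * T ^ 2 * |2 * σ ^ 2 * oscW1 (T ^ 2) v (e i) ξ * oscS v (e l) ξ
          + (σ ^ 2) ^ 2 * oscS1 v (e i) (e l) ξ|
        ≤ 2 * T ^ 2 * (2 * σ ^ 2 * |oscW1 t v (e i) ξ| * |oscS v (e l) ξ|
          + (σ ^ 2) ^ 2 * |oscS1 v (e i) (e l) ξ|) := by
          gcongr
          refine (abs_add_le _ _).trans_eq ?_
          rw [abs_mul, abs_mul, abs_mul ((σ ^ 2) ^ 2), abs_of_pos (a := 2 * σ ^ 2) (by positivity),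
            abs_of_pos (a := (σ ^ 2) ^ 2) (by positivity), hT2]
      _ ≤ 2 * T ^ 2 * (2 * σ ^ 2 * (8 * T * σ ^ 3) * (4 / (T * σ))
          + (σ ^ 2) ^ 2 * (12 / (T * σ) + 8)) := by
          gcongr
          · exact hW1 i
          · exact hS l
          · exact hS1 i l
      _ = _ := by field_simp; ring
  have hB1 : ∀ i j, |oscB1 t v (e i) j ξ| ≤ 10 * w := fun i j => by
    calc _ ≤ |oscW1 t v (e i) ξ| * |oscY v j ξ| + w * |ddjap (e i) (e j) ξ| := by
          rw [oscB1, ← abs_mul, ← hwdef]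
          refine (abs_sub _ _).trans_eq ?_
          rw [abs_mul w, abs_of_pos hw]
      _ ≤ 8 * T * σ ^ 3 * (1 / (T * σ)) + w * 2 := by
          gcongr <;> first | apply hy | apply hh | apply hW1
      _ = _ := by rw [← hσ2]; field_simp; ring
  have hσ3 : T * σ ^ 3 ≤ T * σ ^ 2 := by
    gcongr T * ?_; exact pow_le_pow_of_le_one hσ0.le hσ1 (by norm_num)
  have hσT : σ ^ 2 ≤ T * σ ^ 2 := le_mul_of_one_le_left (by positivity) hT1
  have hB2 : ∀ z i j, |oscB2 t v (e z) (e i) j ξ| ≤ 206 * T * w := fun z i j => by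
    calc _ ≤ |oscW2 t v (e z) (e i) ξ| * |oscY v j ξ| + |oscW1 t v (e i) ξ| * |ddjap (e z) (e j) ξ|
          + (|oscW1 t v (e z) ξ| * |ddjap (e i) (e j) ξ| + w * |dddjap (e z) (e i) (e j) ξ|) := by
          rw [oscB2, ← hwdef]
          refine (abs_sub _ _).trans ?_
          refine add_le_add ((abs_sub _ _).trans_eq ?_) ((abs_add_le _ _).trans_eq ?_)
          · rw [abs_mul, abs_mul]
          · rw [abs_mul, abs_mul, abs_of_pos hw]
      _ ≤ (144 * T ^ 2 * σ ^ 4 + 24 * T * σ ^ 3) * (1 / (T * σ)) + 8 * T * σ ^ 3 * 2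
          + (8 * T * σ ^ 3 * 2 + w * 6) := by
          gcongr <;> first | apply hy | apply hh | apply hd | apply hW1 | apply hW2
      _ = 176 * (T * σ ^ 3) + 30 * σ ^ 2 := by rw [← hσ2]; field_simp; ring
      _ ≤ 176 * (T * σ ^ 2) + 30 * (T * σ ^ 2) := by gcongr
      _ = _ := by rw [← hσ2]; ring
  refine ⟨fun j => ?_, hB1, ?_, fun i => ?_⟩
  · rw [oscB, abs_mul, ← hwdef, abs_of_pos hw, ← hσ2]
    calc σ ^ 2 * |oscY v j ξ| ≤ σ ^ 2 * (1 / (T * σ)) := by gcongr; exact hy j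
      _ = _ := by field_simp
  · rw [oscA]
    refine (norm_add_le _ _).trans ?_
    rw [norm_mul, Complex.norm_I, mul_one, Complex.norm_real, Complex.norm_real, Real.norm_eq_abs,
      Real.norm_eq_abs, abs_of_pos hw]
    have := abs_add_le (oscB1 t v (e 0) 0 ξ) (oscB1 t v (e 1) 1 ξ)
    have h0 := hB1 0 0
    have h1 := hB1 1 1
    linarith
  · rw [oscA1]
    refine (norm_add_le _ _).trans ?_
    rw [norm_mul, Complex.norm_I, mul_one, Complex.norm_real, Complex.norm_real, Real.norm_eq_abs,
      Real.norm_eq_abs]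
    have := abs_add_le (oscB2 t v (e i) (e 0) 0 ξ) (oscB2 t v (e i) (e 1) 1 ξ)
    have h0 := hB2 i 0 0
    have h1 := hB2 i 1 1
    have h2 := hW1 i
    have h3 : 8 * T * σ ^ 3 ≤ 8 * T * w := by rw [← hσ2]; linarith
    linarith

theorem integral_add_three {α E : Type*} [MeasurableSpace α] {μ : Measure α}
    [NormedAddCommGroup E] [NormedSpace ℝ E] {f g h : α → E}
    (hf : Integrable f μ) (hg : Integrable g μ) (hh : Integrable h μ) :
    (∫ x, f x ∂μ) + (∫ x, g x ∂μ) + (∫ x, h x ∂μ) = ∫ x, (f x + g x + h x) ∂μ := by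
  rw [← integral_add hf hg]; exact (integral_add (hf.add hg) hh).symm

theorem integrable_add_three {α E : Type*} [MeasurableSpace α] {μ : Measure α}
    [NormedAddCommGroup E] {f g h : α → E}
    (hf : Integrable f μ) (hg : Integrable g μ) (hh : Integrable h μ) :
    Integrable (fun x => f x + g x + h x) μ := (hf.add hg).add hh

/-- The phase factor `e^{i(x·ξ - t⟨ξ⟩)}`. -/
noncomputable def osc (t : ℝ) (x ξ : Plane) : ℂ :=
  Complex.exp (((inner ℝ x ξ - t * jap ξ : ℝ) : ℂ) * Complex.I)

theorem norm_osc (t : ℝ) (x ξ : Plane) : ‖osc t x ξ‖ = 1 := Complex.norm_exp_ofReal_mul_I _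

theorem continuous_osc (t : ℝ) (x : Plane) : Continuous (osc t x) := by
  have := continuous_jap (E := Plane)
  unfold osc; fun_prop

theorem hasLineDerivAt_osc {t : ℝ} (ht : 0 < t) (x ξ : Plane) (j : Fin 2) :
    HasLineDerivAt ℝ (osc t x)
      (osc t x ξ * (((t * oscY (t⁻¹ • x) j ξ : ℝ) : ℂ) * Complex.I)) ξ (e j) := by
  refine hasLineDerivAt_congr_deriv (hasLineDerivAt_cexp (hasLineDerivAt_sub
    (hasLineDerivAt_inner_left x) (hasLineDerivAt_mul (hasLineDerivAt_const t)
      (hasLineDerivAt_jap ξ (e j))))) ?_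
  have : inner ℝ x (e j) = x j := by simp [e, EuclideanSpace.inner_single_right]
  rw [osc, this, oscY]
  congr 3
  simp only [PiLp.smul_apply, smul_eq_mul]
  field_simp
  ring

/-- Split `1 = w + w t|y|²` with `y = ∇(v·ξ - ⟨ξ⟩)`, and use `t y_j e^{iφ} = -i∂_j e^{iφ}` on the
second part. The derivative then falls on `b_j g`, with `b = w y`. Near the stationary point `w` is
close to `1`, so no cutoff around it is needed. -/
theorem integral_osc_mul_eq {t : ℝ} (ht : 0 < t) (x : Plane) {g : Plane → ℂ}
    {g1 : Fin 2 → Plane → ℂ} (hg : Continuous g) (hg1 : ∀ j, Continuous (g1 j))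
    (hs : HasCompactSupport g) (hs1 : ∀ j, HasCompactSupport (g1 j))
    (hd : ∀ j ξ, HasLineDerivAt ℝ g (g1 j ξ) ξ (e j)) :
    ∫ ξ, osc t x ξ * g ξ = ∫ ξ, osc t x ξ * (oscA t (t⁻¹ • x) ξ * g ξ
      + Complex.I * (oscB t (t⁻¹ • x) 0 ξ * g1 0 ξ + oscB t (t⁻¹ • x) 1 ξ * g1 1 ξ)) := by
  set v := t⁻¹ • x with hv
  have hE := continuous_osc t x
  have hb := fun j => Complex.continuous_ofReal.comp (continuous_oscB v ht j)
  have hb1 := fun u j => Complex.continuous_ofReal.comp (continuous_oscB1 v ht u j)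
  have hy := fun j => continuous_oscY v j
  have hA := continuous_oscA v ht
  simp only [Function.comp_def] at hb hb1
  have ibp : ∀ j, ∫ ξ, (osc t x ξ * oscB t v j ξ) * g1 j ξ
      = -∫ ξ, (osc t x ξ * (((t * oscY v j ξ : ℝ) : ℂ) * Complex.I) * oscB t v j ξ
        + osc t x ξ * oscB1 t v (e j) j ξ) * g ξ := fun j =>
    integral_mul_lineDeriv (by fun_prop) (by fun_prop) hg (hg1 j) hs (hs1 j)
      (fun ξ => hasLineDerivAt_mul (hasLineDerivAt_osc ht x ξ j)
        (hasLineDerivAt_ofReal (hasLineDerivAt_oscB v ht (e j) j ξ)))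
      (hd j)
  have int1 : ∀ j, Integrable fun ξ => (osc t x ξ * oscB t v j ξ) * g1 j ξ := fun j =>
    Continuous.integrable_of_hasCompactSupport (by fun_prop) (hs1 j).mul_left
  have int2 : ∀ j, Integrable fun ξ =>
      (osc t x ξ * (((t * oscY v j ξ : ℝ) : ℂ) * Complex.I) * oscB t v j ξ
        + osc t x ξ * oscB1 t v (e j) j ξ) * g ξ := fun j =>
    Continuous.integrable_of_hasCompactSupport (by fun_prop) hs.mul_left
  have int3 : Integrable fun ξ => (osc t x ξ * oscA t v ξ) * g ξ :=
    Continuous.integrable_of_hasCompactSupport (by fun_prop) hs.mul_left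
  have e1 : ∫ ξ, osc t x ξ * (oscA t v ξ * g ξ
      + Complex.I * (oscB t v 0 ξ * g1 0 ξ + oscB t v 1 ξ * g1 1 ξ))
      = (∫ ξ, (osc t x ξ * oscA t v ξ) * g ξ)
        + Complex.I * (∫ ξ, (osc t x ξ * oscB t v 0 ξ) * g1 0 ξ)
        + Complex.I * (∫ ξ, (osc t x ξ * oscB t v 1 ξ) * g1 1 ξ) := by
    rw [← integral_const_mul, ← integral_const_mul,
      integral_add_three int3 ((int1 0).const_mul _) ((int1 1).const_mul _)]
    refine integral_congr_ae (Filter.Eventually.of_forall fun ξ => ?_)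
    simp only; ring
  rw [e1, ibp 0, ibp 1, mul_neg, mul_neg, ← neg_mul, ← neg_mul, ← integral_const_mul,
    ← integral_const_mul, integral_add_three int3 ((int2 0).const_mul _) ((int2 1).const_mul _)]
  refine integral_congr_ae (Filter.Eventually.of_forall fun ξ => ?_)
  simp only [oscA, oscB]
  have hw : (oscW t v ξ : ℂ) * (1 + t * (oscY v 0 ξ ^ 2 + oscY v 1 ξ ^ 2)) = 1 := by
    have := inv_mul_cancel₀ (oscW_aux_pos v ht ξ).ne'
    rw [oscW]; exact_mod_cast this
  push_cast
  linear_combination (-(osc t x ξ * g ξ)) * hw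
    + (osc t x ξ * g ξ * oscW t v ξ * t * (oscY v 0 ξ ^ 2 + oscY v 1 ξ ^ 2)) * Complex.I_sq

/-- The identity `integral_osc_mul_eq` is used twice. A single use leaves the weight `w` on `G`,
which would lose a logarithm of `t`; the second use improves it to `w^{3/2}`. The constants are
`1281 = 21² + 2·420` and `83 = 21 + 2·(21 + 10)`, from `osc_bounds`. -/
theorem norm_integral_osc_le {t : ℝ} (ht : 1 ≤ t) (x : Plane) {G : Plane → ℂ}
    {G1 : Plane → Plane → ℂ} {G2 : Plane → Plane → Plane → ℂ} (h : IsC2c G G1 G2) :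
    ‖∫ ξ, osc t x ξ * G ξ‖ ≤
      1281 * (∫ ξ, Real.sqrt (oscW t (t⁻¹ • x) ξ) ^ 3 * ‖G ξ‖)
      + 83 / Real.sqrt t * (∫ ξ, Real.sqrt (oscW t (t⁻¹ • x) ξ) ^ 3 *
          (‖G1 (e 0) ξ‖ + ‖G1 (e 1) ξ‖))
      + t⁻¹ * ∫ ξ, oscW t (t⁻¹ • x) ξ * (‖G2 (e 0) (e 0) ξ‖ + ‖G2 (e 0) (e 1) ξ‖
          + (‖G2 (e 1) (e 0) ξ‖ + ‖G2 (e 1) (e 1) ξ‖)) := by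
  have ht0 : 0 < t := by linarith
  set v := t⁻¹ • x with hv
  have hb := fun j => Complex.continuous_ofReal.comp (continuous_oscB v ht0 j)
  have hb1 := fun u j => Complex.continuous_ofReal.comp (continuous_oscB1 v ht0 u j)
  have hA := continuous_oscA v ht0
  have hA1 := continuous_oscA1 v ht0
  have hw := continuous_oscW v ht0
  simp only [Function.comp_def] at hb hb1
  have c0 := h.cont
  have c1 := h.cont1
  have c2 := h.cont2
  set g : Plane → ℂ := fun ξ => oscA t v ξ * G ξ
      + Complex.I * (oscB t v 0 ξ * G1 (e 0) ξ + oscB t v 1 ξ * G1 (e 1) ξ) with hg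
  set D : Fin 2 → Plane → ℂ := fun l ξ => (oscA1 t v (e l) ξ * G ξ + oscA t v ξ * G1 (e l) ξ)
      + Complex.I * ((oscB1 t v (e l) 0 ξ * G1 (e 0) ξ + oscB t v 0 ξ * G2 (e l) (e 0) ξ)
        + (oscB1 t v (e l) 1 ξ * G1 (e 1) ξ + oscB t v 1 ξ * G2 (e l) (e 1) ξ)) with hD
  have hgs : HasCompactSupport g :=
    h.supp.mul_left.add ((((h.supp1 _).mul_left).add ((h.supp1 _).mul_left)).mul_left)
  have hDs : ∀ l, HasCompactSupport (D l) := fun l =>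
    (h.supp.mul_left.add ((h.supp1 _).mul_left)).add
      (((((h.supp1 _).mul_left).add ((h.supp2 _ _).mul_left)).add
        (((h.supp1 _).mul_left).add ((h.supp2 _ _).mul_left))).mul_left)
  have hDd : ∀ l ξ, HasLineDerivAt ℝ g (D l ξ) ξ (e l) := fun l ξ => by
    refine hasLineDerivAt_congr_deriv (hasLineDerivAt_add
      (hasLineDerivAt_mul (hasLineDerivAt_oscA v ht0 (e l) ξ) (h.deriv1 (e l) ξ))
      (hasLineDerivAt_mul (hasLineDerivAt_const Complex.I) (hasLineDerivAt_add
        (hasLineDerivAt_mul (hasLineDerivAt_ofReal (hasLineDerivAt_oscB v ht0 (e l) 0 ξ))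
          (h.deriv2 (e l) (e 0) ξ))
        (hasLineDerivAt_mul (hasLineDerivAt_ofReal (hasLineDerivAt_oscB v ht0 (e l) 1 ξ))
          (h.deriv2 (e l) (e 1) ξ))))) ?_
    simp only [hD]; ring
  rw [integral_osc_mul_eq ht0 x (g1 := fun j => G1 (e j)) c0 (fun j => c1 _) h.supp
    (fun j => h.supp1 _) (fun j ξ => h.deriv1 _ ξ)]
  change ‖∫ ξ, osc t x ξ * g ξ‖ ≤ _
  rw [integral_osc_mul_eq ht0 x (g := g) (g1 := D) (by fun_prop) (fun j => by fun_prop) hgs hDs hDd]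
  have i1 : Integrable fun ξ => Real.sqrt (oscW t v ξ) ^ 3 * ‖G ξ‖ :=
    Continuous.integrable_of_hasCompactSupport (by fun_prop) h.supp.norm.mul_left
  have i2 : Integrable fun ξ => Real.sqrt (oscW t v ξ) ^ 3 * (‖G1 (e 0) ξ‖ + ‖G1 (e 1) ξ‖) :=
    Continuous.integrable_of_hasCompactSupport (by fun_prop)
      ((h.supp1 _).norm.add (h.supp1 _).norm).mul_left
  have i3 : Integrable fun ξ => oscW t v ξ * (‖G2 (e 0) (e 0) ξ‖ + ‖G2 (e 0) (e 1) ξ‖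
          + (‖G2 (e 1) (e 0) ξ‖ + ‖G2 (e 1) (e 1) ξ‖)) :=
    Continuous.integrable_of_hasCompactSupport (by fun_prop)
      (((h.supp2 _ _).norm.add (h.supp2 _ _).norm).add
        ((h.supp2 _ _).norm.add (h.supp2 _ _).norm)).mul_left
  rw [← integral_const_mul, ← integral_const_mul, ← integral_const_mul,
    integral_add_three (i1.const_mul _) (i2.const_mul _) (i3.const_mul _)]
  refine norm_integral_le_of_norm_le (integrable_add_three (i1.const_mul _) (i2.const_mul _)
    (i3.const_mul _)) (Filter.Eventually.of_forall fun ξ => ?_)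
  rw [norm_mul, norm_osc, one_mul]
  obtain ⟨B0, B1, A0, A1⟩ := osc_bounds ht v ξ
  have hw0 := oscW_pos v ht0 ξ
  have hw1 := oscW_le_one v ht0 ξ
  set w := oscW t v ξ with hwdef
  set T := Real.sqrt t with hT
  set σ := Real.sqrt w with hσ
  have hσ0 : 0 < σ := Real.sqrt_pos.2 hw0
  have hσ1 : σ ≤ 1 := Real.sqrt_le_one.2 hw1
  have hσ2 : w = σ ^ 2 := (Real.sq_sqrt hw0.le).symm
  have hT0 : 0 < T := Real.sqrt_pos.2 ht0
  have hT2 : t = T ^ 2 := (Real.sq_sqrt ht0.le).symm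
  rw [hσ2] at A0 A1 B1
  set n0 := ‖G ξ‖
  set n1 := ‖G1 (e 0) ξ‖ + ‖G1 (e 1) ξ‖ with hn1
  have hn : ∀ l, ‖G1 (e l) ξ‖ ≤ n1 := fun l => by
    have h0 := norm_nonneg (G1 (e 0) ξ)
    have h1 := norm_nonneg (G1 (e 1) ξ)
    fin_cases l <;> simp [hn1]
  have hBn : ∀ j z, ‖(oscB t v j ξ : ℂ) * z‖ ≤ σ / T * ‖z‖ := fun j z => by
    rw [norm_mul, Complex.norm_real]; gcongr; exact B0 j
  have hB1n : ∀ i j z, ‖(oscB1 t v (e i) j ξ : ℂ) * z‖ ≤ 10 * σ ^ 2 * ‖z‖ := fun i j z => by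
    rw [norm_mul, Complex.norm_real]; gcongr; exact B1 i j
  have hAn : ∀ z, ‖oscA t v ξ * z‖ ≤ 21 * σ ^ 2 * ‖z‖ := fun z => by
    rw [norm_mul]; gcongr
  have hA1n : ∀ i z, ‖oscA1 t v (e i) ξ * z‖ ≤ 420 * T * σ ^ 2 * ‖z‖ := fun i z => by
    rw [norm_mul]; gcongr; exact A1 i
  have hIn : ∀ z : ℂ, ‖Complex.I * z‖ = ‖z‖ := fun z => by simp
  have gb : ‖g ξ‖ ≤ 21 * σ ^ 2 * n0 + σ / T * n1 := by
    refine (norm_add_le _ _).trans (add_le_add (hAn _) ?_)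
    rw [hIn]
    refine (norm_add_le _ _).trans ((add_le_add (hBn _ _) (hBn _ _)).trans_eq ?_)
    rw [hn1]; ring
  have Db : ∀ l, ‖D l ξ‖ ≤ 420 * T * σ ^ 2 * n0 + 31 * σ ^ 2 * n1
      + σ / T * (‖G2 (e l) (e 0) ξ‖ + ‖G2 (e l) (e 1) ξ‖) := fun l => by
    have hD1 : ‖D l ξ‖ ≤ (420 * T * σ ^ 2 * n0 + 21 * σ ^ 2 * n1)
        + ((10 * σ ^ 2 * ‖G1 (e 0) ξ‖ + σ / T * ‖G2 (e l) (e 0) ξ‖)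
          + (10 * σ ^ 2 * ‖G1 (e 1) ξ‖ + σ / T * ‖G2 (e l) (e 1) ξ‖)) := by
      refine (norm_add_le _ _).trans (add_le_add ((norm_add_le _ _).trans
        (add_le_add (hA1n _ _) ((hAn _).trans (by gcongr; exact hn l)))) ?_)
      rw [hIn]
      exact (norm_add_le _ _).trans (add_le_add
        ((norm_add_le _ _).trans (add_le_add (hB1n _ _ _) (hBn _ _)))
        ((norm_add_le _ _).trans (add_le_add (hB1n _ _ _) (hBn _ _))))
    refine hD1.trans_eq ?_
    rw [hn1]; ring
  have n0p : 0 ≤ n0 := norm_nonneg _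
  have n1p : 0 ≤ n1 := by positivity
  have hσ43 : σ ^ 4 ≤ σ ^ 3 := pow_le_pow_of_le_one hσ0.le hσ1 (by norm_num)
  calc _ ≤ 21 * σ ^ 2 * ‖g ξ‖ + (σ / T * ‖D 0 ξ‖ + σ / T * ‖D 1 ξ‖) := by
        refine (norm_add_le _ _).trans (add_le_add (hAn _) ?_)
        rw [hIn]
        exact (norm_add_le _ _).trans (add_le_add (hBn _ _) (hBn _ _))
    _ ≤ 21 * σ ^ 2 * (21 * σ ^ 2 * n0 + σ / T * n1)
        + (σ / T * (420 * T * σ ^ 2 * n0 + 31 * σ ^ 2 * n1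
          + σ / T * (‖G2 (e 0) (e 0) ξ‖ + ‖G2 (e 0) (e 1) ξ‖))
        + σ / T * (420 * T * σ ^ 2 * n0 + 31 * σ ^ 2 * n1
          + σ / T * (‖G2 (e 1) (e 0) ξ‖ + ‖G2 (e 1) (e 1) ξ‖))) := by
        gcongr
        · exact Db 0
        · exact Db 1
    _ = (441 * σ ^ 4 + 840 * σ ^ 3) * n0 + 83 / T * (σ ^ 3 * n1)
        + (T ^ 2)⁻¹ * (σ ^ 2 * (‖G2 (e 0) (e 0) ξ‖ + ‖G2 (e 0) (e 1) ξ‖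
          + (‖G2 (e 1) (e 0) ξ‖ + ‖G2 (e 1) (e 1) ξ‖))) := by
        field_simp; ring
    _ ≤ (441 * σ ^ 3 + 840 * σ ^ 3) * n0 + 83 / T * (σ ^ 3 * n1)
        + (T ^ 2)⁻¹ * (σ ^ 2 * (‖G2 (e 0) (e 0) ξ‖ + ‖G2 (e 0) (e 1) ξ‖
          + (‖G2 (e 1) (e 0) ξ‖ + ‖G2 (e 1) (e 1) ξ‖))) := by gcongr
    _ = _ := by rw [← hσ2, ← hT2]; ring

/-! ### Change of variables to the group velocity. -/

/-- The group velocity `∇⟨ξ⟩ = ξ/⟨ξ⟩`. -/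
noncomputable def velocity (ξ : Plane) : Plane := (jap ξ)⁻¹ • ξ

theorem jap_inv_sq_add (ξ : Plane) : (jap ξ)⁻¹ ^ 2 + ‖velocity ξ‖ ^ 2 = 1 := by
  have h := jap_sq ξ
  have hj := (jap_pos ξ).ne'
  rw [velocity, norm_smul, norm_inv, Real.norm_of_nonneg (jap_pos ξ).le]
  field_simp
  linarith

/-- The speed determines `⟨ξ⟩` through `⟨ξ⟩⁻² + |∇⟨ξ⟩|² = 1`, and then `ξ` is a multiple of the
velocity. -/
theorem velocity_injective : Function.Injective velocity := by
  intro ξ ζ h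
  have h1 := jap_inv_sq_add ξ
  have h2 := jap_inv_sq_add ζ
  rw [h] at h1
  have h3 : (jap ξ)⁻¹ ^ 2 = (jap ζ)⁻¹ ^ 2 := by linarith
  have hj1 := inv_pos.2 (jap_pos ξ)
  have hj2 := inv_pos.2 (jap_pos ζ)
  have h4 : (jap ξ)⁻¹ = (jap ζ)⁻¹ := (pow_left_inj₀ hj1.le hj2.le (by norm_num)).1 h3
  rw [velocity, velocity, h4] at h
  exact smul_right_injective _ hj2.ne' h

/-- The derivative of the group velocity. -/
noncomputable def velocityDeriv (ξ : Plane) : Plane →L[ℝ] Plane :=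
  (jap ξ)⁻¹ • ContinuousLinearMap.id ℝ Plane
    - ((jap ξ)⁻¹ ^ 3) • (innerSL ℝ ξ).smulRight ξ

theorem hasFDerivAt_jap (ξ : Plane) :
    HasFDerivAt (jap : Plane → ℝ) ((jap ξ)⁻¹ • innerSL ℝ ξ) ξ := by
  have h1 : HasDerivAt Real.sqrt (1 / (2 * jap ξ)) (1 + ‖ξ‖ ^ 2) :=
    Real.hasDerivAt_sqrt (by positivity)
  have h2 : HasFDerivAt (fun ζ : Plane => 1 + ‖ζ‖ ^ 2) (2 • innerSL ℝ ξ) ξ :=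
    ((hasStrictFDerivAt_norm_sq ξ).hasFDerivAt).const_add 1
  have h3 := h1.comp_hasFDerivAt ξ h2
  refine HasFDerivAt.congr_fderiv (f := (jap : Plane → ℝ)) h3 ?_
  ext v
  have := (jap_pos ξ).ne'
  simp
  field_simp

theorem hasFDerivAt_velocity (ξ : Plane) : HasFDerivAt velocity (velocityDeriv ξ) ξ := by
  have h1 := (hasDerivAt_inv (jap_pos ξ).ne').comp_hasFDerivAt ξ (hasFDerivAt_jap ξ)
  have h2 := h1.smul (hasFDerivAt_id ξ)
  refine HasFDerivAt.congr_fderiv (f := velocity) h2 ?_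
  ext v i
  have := (jap_pos ξ).ne'
  simp [velocityDeriv]
  field_simp
  ring

/-- The eigenvalues are `⟨ξ⟩⁻¹` across `ξ` and `⟨ξ⟩⁻³` along it. This Jacobian is why the dispersive
estimate costs four powers of `⟨ξ⟩`. -/
theorem det_velocityDeriv (ξ : Plane) : (velocityDeriv ξ).det = ((jap ξ) ^ 4)⁻¹ := by
  rw [ContinuousLinearMap.det,
    ← LinearMap.det_toMatrix (EuclideanSpace.basisFun (Fin 2) ℝ).toBasis, Matrix.det_fin_two]
  simp only [LinearMap.toMatrix_apply, OrthonormalBasis.coe_toBasis,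
    OrthonormalBasis.coe_toBasis_repr_apply, EuclideanSpace.basisFun_apply,
    EuclideanSpace.basisFun_repr, velocityDeriv]
  have h := jap_sq ξ
  rw [EuclideanSpace.norm_sq_eq, Fin.sum_univ_two, Real.norm_eq_abs, Real.norm_eq_abs, sq_abs,
    sq_abs] at h
  have hj := (jap_pos ξ).ne'
  simp [EuclideanSpace.inner_single_right]
  field_simp
  linear_combination jap ξ ^ 2 * h

theorem oscW_eq (t : ℝ) (v ξ : Plane) : oscW t v ξ = (1 + t * ‖v - velocity ξ‖ ^ 2)⁻¹ := by
  rw [oscW, EuclideanSpace.norm_sq_eq, Fin.sum_univ_two]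
  simp only [oscY, djap, e, velocity, EuclideanSpace.inner_single_right, PiLp.sub_apply,
    PiLp.smul_apply, smul_eq_mul, Real.norm_eq_abs, sq_abs]
  simp [mul_comm]

/-- In the variable `η = ∇⟨ξ⟩` the Jacobian absorbs `⟨ξ⟩⁻⁴` and `w^{3/2}` becomes `⟨√t(v - η)⟩⁻³`,
which is integrable on the plane and scales like `1/t`. This is the source of the decay rate. -/
theorem exists_integral_oscW_le : ∃ C : ℝ, 0 < C ∧ ∀ t : ℝ, 0 < t → ∀ v : Plane,
    Integrable (fun ξ : Plane => Real.sqrt (oscW t v ξ) ^ 3 * (jap ξ ^ 4)⁻¹) ∧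
      ∫ ξ, Real.sqrt (oscW t v ξ) ^ 3 * (jap ξ ^ 4)⁻¹ ≤ C / t := by
  have hint : Integrable (fun x : Plane => jap x ^ (-3 : ℝ)) volume :=
    integrable_jap_rpow (by norm_num)
  refine ⟨(∫ x : Plane, jap x ^ (-3 : ℝ)) + 1, ?_, fun t ht v => ?_⟩
  · have : 0 ≤ ∫ x : Plane, jap x ^ (-3 : ℝ) :=
      integral_nonneg fun x => Real.rpow_nonneg (jap_pos x).le _
    positivity
  have hst : 0 < Real.sqrt t := Real.sqrt_pos.2 ht
  set h : Plane → ℝ := fun η => jap (Real.sqrt t • (v - η)) ^ (-3 : ℝ) with hh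
  have hcomp : ∀ ξ, Real.sqrt (oscW t v ξ) ^ 3 = h (velocity ξ) := by
    intro ξ
    have h1 : jap (Real.sqrt t • (v - velocity ξ)) ^ 2 = 1 + t * ‖v - velocity ξ‖ ^ 2 := by
      rw [jap_sq, norm_smul, Real.norm_of_nonneg hst.le, mul_pow, Real.sq_sqrt ht.le]
    have hp := jap_pos (Real.sqrt t • (v - velocity ξ))
    rw [oscW_eq, ← h1, Real.sqrt_inv, Real.sqrt_sq hp.le, hh]
    simp only
    rw [Real.rpow_neg hp.le, inv_pow]
    norm_cast
  have hhi : Integrable h := by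
    have h1 := (hint.comp_smul hst.ne').comp_sub_left v
    exact h1
  have hhI : ∫ η, h η = (∫ x : Plane, jap x ^ (-3 : ℝ)) / t := by
    have h1 := integral_sub_left_eq_self (μ := (volume : Measure Plane))
      (fun y => jap (Real.sqrt t • y) ^ (-3 : ℝ)) v
    rw [hh]
    simp only
    rw [h1, Measure.integral_comp_smul volume (fun y : Plane => jap y ^ (-3 : ℝ)), finrank_plane,
      Real.sq_sqrt ht.le, abs_of_pos (by positivity), smul_eq_mul]
    ring
  have hh0 : ∀ η, 0 ≤ h η := fun η => Real.rpow_nonneg (jap_pos _).le _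
  have hcov := lintegral_image_eq_lintegral_abs_det_fderiv_mul (volume : Measure Plane)
    MeasurableSet.univ (f := velocity) (f' := velocityDeriv)
    (fun x _ => (hasFDerivAt_velocity x).hasFDerivWithinAt) velocity_injective.injOn
    (fun η => ENNReal.ofReal (h η))
  have hle : ∫⁻ ξ, ENNReal.ofReal (Real.sqrt (oscW t v ξ) ^ 3 * (jap ξ ^ 4)⁻¹)
      ≤ ENNReal.ofReal ((∫ x : Plane, jap x ^ (-3 : ℝ)) / t) := by
    calc _ = ∫⁻ ξ in univ, ENNReal.ofReal |(velocityDeriv ξ).det| * ENNReal.ofReal (h (velocity ξ)) := by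
          rw [setLIntegral_univ]
          refine lintegral_congr fun ξ => ?_
          have := jap_pos ξ
          rw [det_velocityDeriv, abs_of_pos (by positivity), ← ENNReal.ofReal_mul (by positivity),
            hcomp, mul_comm]
      _ = ∫⁻ η in velocity '' univ, ENNReal.ofReal (h η) := hcov.symm
      _ ≤ ∫⁻ η, ENNReal.ofReal (h η) := setLIntegral_le_lintegral _ _
      _ = _ := by
          rw [← hhI, ofReal_integral_eq_lintegral_ofReal hhi (Filter.Eventually.of_forall hh0)]
  have hcont : Continuous fun ξ : Plane => Real.sqrt (oscW t v ξ) ^ 3 * (jap ξ ^ 4)⁻¹ := by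
    have h1 := continuous_oscW v ht
    have h2 : Continuous fun ξ : Plane => (jap ξ ^ 4)⁻¹ :=
      (continuous_jap.pow 4).inv₀ fun ξ => (pow_pos (jap_pos ξ) 4).ne'
    fun_prop
  have hpos : ∀ ξ : Plane, 0 ≤ Real.sqrt (oscW t v ξ) ^ 3 * (jap ξ ^ 4)⁻¹ := fun ξ => by
    have := jap_pos ξ
    positivity
  have hI : Integrable (fun ξ : Plane => Real.sqrt (oscW t v ξ) ^ 3 * (jap ξ ^ 4)⁻¹) := by
    refine ⟨hcont.aestronglyMeasurable, ?_⟩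
    rw [hasFiniteIntegral_iff_ofReal (Filter.Eventually.of_forall hpos)]
    exact hle.trans_lt ENNReal.ofReal_lt_top
  refine ⟨hI, ?_⟩
  rw [← ofReal_integral_eq_lintegral_ofReal hI (Filter.Eventually.of_forall hpos)] at hle
  have hnn : 0 ≤ ∫ x : Plane, jap x ^ (-3 : ℝ) :=
    integral_nonneg fun x => Real.rpow_nonneg (jap_pos x).le _
  refine ((ENNReal.ofReal_le_ofReal_iff (by positivity)).1 hle).trans ?_
  gcongr
  linarith

/-! ### Truncation of a profile in space and in frequency. -/

/-- A smooth cutoff on the line, with its first two derivatives. -/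
theorem exists_cutoff : ∃ (θ θ1 θ2 : ℝ → ℝ) (K : ℝ), 1 ≤ K ∧ Continuous θ ∧ Continuous θ1 ∧
    Continuous θ2 ∧ (∀ s, HasDerivAt θ (θ1 s) s) ∧ (∀ s, HasDerivAt θ1 (θ2 s) s) ∧
    (∀ s, 0 ≤ θ s ∧ θ s ≤ 1) ∧ (∀ s ≤ 1, θ s = 1) ∧
    (∀ s, 4 ≤ s → θ s = 0 ∧ θ1 s = 0 ∧ θ2 s = 0) ∧ (∀ s, |θ1 s| ≤ K) ∧ ∀ s, |θ2 s| ≤ K := by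
  -- The cutoff will be applied to `⟨ξ⟩²/M²`, so the thresholds `1` and `4` stand for `⟨ξ⟩ = M` and
  -- `⟨ξ⟩ = 2M`.
  set θ : ℝ → ℝ := fun s => Real.smoothTransition ((4 - s) / 3) with hθ
  have hsm : ContDiff ℝ 2 θ := by
    have := Real.smoothTransition.contDiff (n := 2)
    exact this.comp ((contDiff_const.sub contDiff_id).div_const 3)
  have h1 : ContDiff ℝ 1 (deriv θ) := by
    have := (contDiff_succ_iff_deriv (n := 1) (f := θ)).1 (by simpa using! hsm)
    exact this.2.2
  have h2 : ContDiff ℝ 0 (deriv (deriv θ)) := by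
    have := (contDiff_succ_iff_deriv (n := 0) (f := deriv θ)).1 (by simpa using! h1)
    exact this.2.2
  have c1 : Continuous (deriv θ) := h1.continuous
  have c2 : Continuous (deriv (deriv θ)) := h2.continuous
  have hone : ∀ s ≤ 1, θ s = 1 := fun s hs =>
    Real.smoothTransition.one_of_one_le (by linarith)
  have hzero : ∀ s, 4 ≤ s → θ s = 0 := fun s hs =>
    Real.smoothTransition.zero_of_nonpos (by linarith)
  have d1l : ∀ s < 1, deriv θ s = 0 := fun s hs => by
    have : θ =ᶠ[nhds s] fun _ => 1 := by
      filter_upwards [Iio_mem_nhds hs] with r hr using hone r (le_of_lt hr)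
    rw [this.deriv_eq]; simp
  have d1r : ∀ s, 4 < s → deriv θ s = 0 := fun s hs => by
    have : θ =ᶠ[nhds s] fun _ => 0 := by
      filter_upwards [Ioi_mem_nhds hs] with r hr using hzero r (le_of_lt hr)
    rw [this.deriv_eq]; simp
  have d2l : ∀ s < 1, deriv (deriv θ) s = 0 := fun s hs => by
    have : deriv θ =ᶠ[nhds s] fun _ => 0 := by
      filter_upwards [Iio_mem_nhds hs] with r hr using d1l r hr
    rw [this.deriv_eq]; simp
  have d2r : ∀ s, 4 < s → deriv (deriv θ) s = 0 := fun s hs => by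
    have : deriv θ =ᶠ[nhds s] fun _ => 0 := by
      filter_upwards [Ioi_mem_nhds hs] with r hr using d1r r hr
    rw [this.deriv_eq]; simp
  have ext4 : ∀ g : ℝ → ℝ, Continuous g → (∀ s, 4 < s → g s = 0) → ∀ s, 4 ≤ s → g s = 0 := by
    intro g hg h s hs
    have hcl : IsClosed {s | g s = 0} := isClosed_eq hg continuous_const
    have : Ici (4 : ℝ) ⊆ {s | g s = 0} := by
      rw [← closure_Ioi]; exact hcl.closure_subset_iff.2 h
    exact this hs
  have bdd : ∀ g : ℝ → ℝ, Continuous g → (∀ s < 1, g s = 0) → (∀ s, 4 < s → g s = 0) →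
      ∃ K, ∀ s, |g s| ≤ K := by
    intro g hg hl hr
    obtain ⟨K, hK⟩ := isCompact_Icc.exists_bound_of_continuousOn (s := Icc (1 : ℝ) 4) hg.continuousOn
    refine ⟨max K 0, fun s => ?_⟩
    rcases lt_or_ge s 1 with h | h
    · rw [hl s h, abs_zero]; exact le_max_right _ _
    rcases lt_or_ge 4 s with h' | h'
    · rw [hr s h', abs_zero]; exact le_max_right _ _
    · exact (hK s ⟨h, h'⟩).trans (le_max_left _ _)
  obtain ⟨K1, hK1⟩ := bdd _ c1 d1l d1r
  obtain ⟨K2, hK2⟩ := bdd _ c2 d2l d2r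
  refine ⟨θ, deriv θ, deriv (deriv θ), max 1 (max K1 K2), le_max_left _ _, hsm.continuous, c1, c2,
    fun s => (hsm.differentiable (by norm_num) s).hasDerivAt,
    fun s => (h1.differentiable (by norm_num) s).hasDerivAt,
    fun s => ⟨Real.smoothTransition.nonneg _, Real.smoothTransition.le_one _⟩, hone,
    fun s hs => ⟨hzero s hs, ext4 _ c1 d1r s hs, ext4 _ c2 d2r s hs⟩,
    fun s => (hK1 s).trans ((le_max_left _ _).trans (le_max_right _ _)),
    fun s => (hK2 s).trans ((le_max_right _ _).trans (le_max_right _ _))⟩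

theorem hasLineDerivAt_ft {f : Plane → ℂ} (hf : Integrable f)
    (hf1 : Integrable fun x => ‖x‖ * ‖f x‖) (v ξ : Plane) :
    HasLineDerivAt ℝ (ft f) (ft (fun x => -((inner ℝ x v : ℝ) * Complex.I) * f x) ξ) ξ v := by
  have hexp : ∀ (x : Plane) (s : ℝ), HasDerivAt
      (fun s : ℝ => Complex.exp (-((inner ℝ x (ξ + s • v) : ℝ) * Complex.I)) * f x)
      (Complex.exp (-((inner ℝ x (ξ + s • v) : ℝ) * Complex.I))
        * (-((inner ℝ x v : ℝ) * Complex.I) * f x)) s := by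
    intro x s
    have h1 : HasDerivAt (fun s : ℝ => (inner ℝ x (ξ + s • v) : ℝ)) (inner ℝ x v) s := by
      have := ((hasDerivAt_id s).mul_const (inner ℝ x v)).const_add (inner ℝ x ξ)
      simpa [inner_add_right, inner_smul_right] using this
    have h2 := ((h1.ofReal_comp.mul_const Complex.I).neg.cexp).mul_const (f x)
    exact HasDerivAt.congr_deriv h2 (mul_assoc _ _ _)
  have key := hasDerivAt_integral_of_dominated_loc_of_deriv_le (μ := (volume : Measure Plane))
    (F := fun (s : ℝ) x => Complex.exp (-((inner ℝ x (ξ + s • v) : ℝ) * Complex.I)) * f x)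
    (F' := fun (s : ℝ) x => Complex.exp (-((inner ℝ x (ξ + s • v) : ℝ) * Complex.I))
        * (-((inner ℝ x v : ℝ) * Complex.I) * f x))
    (x₀ := (0 : ℝ)) (s := univ) (bound := fun x => ‖v‖ * (‖x‖ * ‖f x‖)) Filter.univ_mem
    (Filter.Eventually.of_forall fun s => (integrable_exp_mul hf _).1)
    (integrable_exp_mul hf _) ?_ ?_ (hf1.const_mul _)
    (Filter.Eventually.of_forall fun x s _ => hexp x s)
  · have h2 := key.2
    simp only [zero_smul, add_zero] at h2
    exact h2
  · refine AEStronglyMeasurable.mul ?_ (AEStronglyMeasurable.mul ?_ hf.1)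
    · exact (by fun_prop : Continuous fun x : Plane =>
        Complex.exp (-((inner ℝ x (ξ + (0 : ℝ) • v) : ℝ) * Complex.I))).aestronglyMeasurable
    · exact (by fun_prop : Continuous fun x : Plane =>
        (-((inner ℝ x v : ℝ) * Complex.I) : ℂ)).aestronglyMeasurable
  · refine Filter.Eventually.of_forall fun x s _ => ?_
    rw [norm_mul, ← neg_mul, ← Complex.ofReal_neg, Complex.norm_exp_ofReal_mul_I, one_mul, norm_mul,
      norm_neg, norm_mul, Complex.norm_I, mul_one, Complex.norm_real, ← mul_assoc]
    gcongr
    rw [mul_comm]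
    exact abs_real_inner_le_norm x v

/-- Plancherel for functions in `L¹ ∩ L²`. -/
theorem eLpNorm_ft {f : Plane → ℂ} (h1 : Integrable f) (h2 : MemLp f 2 volume) :
    eLpNorm (ft f) 2 volume = ENNReal.ofReal (2 * Real.pi) * eLpNorm f 2 volume := by
  have hae := h2.coeFn_toLp
  have h1' : Integrable (h2.toLp f : Plane → ℂ) := h1.congr hae.symm
  have h3 := hat_ae_eq_ft h1'
  have h4 : ft (h2.toLp f : Plane → ℂ) = ft f := by
    ext ξ
    exact integral_congr_ae (hae.mono fun x hx => by simp only [hx])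
  rw [h4] at h3
  rw [← eLpNorm_congr_ae h3, eLpNorm_hat, eLpNorm_congr_ae hae]

/-- Truncation of a profile to bounded `x` gives a smooth Fourier transform. -/
theorem exists_spatial_trunc : ∃ C : ℝ, 0 < C ∧ ∀ (n β : ℝ) (f : Plane → ℂ), 0 ≤ β →
    ProfileBound n β f → ∀ R : ℝ, 1 ≤ R →
    ∃ (F : Plane → ℂ) (F1 : Plane → Plane → ℂ) (F2 : Plane → Plane → Plane → ℂ),
      Continuous F ∧ (∀ v, Continuous (F1 v)) ∧ (∀ u v, Continuous (F2 u v)) ∧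
      (∀ v ξ, HasLineDerivAt ℝ F (F1 v ξ) ξ v) ∧
      (∀ u v ξ, HasLineDerivAt ℝ (F1 v) (F2 u v ξ) ξ u) ∧
      (∀ ξ, ‖ft f ξ - F ξ‖ ≤ C * β * R ^ (-(9 / 10) : ℝ)) ∧
      (∀ ξ, ‖F ξ‖ ≤ C * β) ∧
      (∀ v ξ, ‖v‖ ≤ 1 → ‖F1 v ξ‖ ≤ C * β * R ^ (1 / 100 : ℝ)) ∧
      ∀ u v, ‖u‖ ≤ 1 → ‖v‖ ≤ 1 → eLpNorm (F2 u v) 2 volume ≤ ENNReal.ofReal (C * β) := by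
  -- Weighted `L¹` bounds are available below exponent `1`. The exponent `9/10` controls the
  -- discarded tail; `99/100` controls the first derivative up to a loss `R^{1/100}`.
  obtain ⟨C0, hC0, h0⟩ := exists_integral_weight_le (s := 9 / 10) (by norm_num)
  obtain ⟨C1, hC1, h1⟩ := exists_integral_weight_le (s := 99 / 100) (by norm_num)
  refine ⟨C0 + 2 * C1 + 2 * Real.pi, by positivity, fun n β f hβ hf R hR => ?_⟩
  obtain ⟨i0, b0⟩ := h0 n β f hβ hf
  obtain ⟨i1, b1⟩ := h1 n β f hβ hf
  have hfi := hf.integrable hβ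
  have hR0 : 0 < R := by linarith
  set S : Set Plane := Metric.closedBall 0 R with hS
  have hSm : MeasurableSet S := measurableSet_closedBall
  -- A sharp cutoff suffices: compact support in `x` already makes the transform smooth.
  set g : Plane → ℂ := S.indicator f with hg
  have hgi : Integrable g := hfi.indicator hSm
  have hgout : ∀ x, R < ‖x‖ → g x = 0 := fun x hx =>
    indicator_of_notMem (by simpa [hS] using hx) _
  have hgle : ∀ x, ‖g x‖ ≤ ‖f x‖ := fun x => norm_indicator_le_norm_self _ _
  have hn1 : ∀ v : Plane, Integrable fun x => (-((inner ℝ x v : ℝ) * Complex.I)) * g x := by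
    intro v
    refine ((hgi.norm.const_mul (R * ‖v‖))).mono'
      ((by fun_prop : Continuous fun x : Plane =>
        (-((inner ℝ x v : ℝ) * Complex.I) : ℂ)).aestronglyMeasurable.mul hgi.1)
      (Filter.Eventually.of_forall fun x => ?_)
    rw [norm_mul, norm_neg, norm_mul, Complex.norm_I, mul_one, Complex.norm_real]
    rcases le_or_gt ‖x‖ R with h | h
    · gcongr
      exact (abs_real_inner_le_norm x v).trans (by gcongr)
    · simp [hgout x h]
  have hx1 : ∀ h : Plane → ℂ, Integrable h → (∀ x, R < ‖x‖ → h x = 0) →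
      Integrable fun x => ‖x‖ * ‖h x‖ := by
    intro h hh hout
    refine (hh.norm.const_mul R).mono' (continuous_norm.aestronglyMeasurable.mul hh.1.norm)
      (Filter.Eventually.of_forall fun x => ?_)
    rw [Real.norm_of_nonneg (by positivity)]
    rcases le_or_gt ‖x‖ R with h | h
    · gcongr
    · simp [hout x h]
  have hn2 : ∀ u v : Plane, Integrable fun x =>
      (-((inner ℝ x u : ℝ) * Complex.I)) * ((-((inner ℝ x v : ℝ) * Complex.I)) * g x) := by
    intro u v
    refine ((hn1 v).norm.const_mul (R * ‖u‖)).mono'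
      ((by fun_prop : Continuous fun x : Plane =>
        (-((inner ℝ x u : ℝ) * Complex.I) : ℂ)).aestronglyMeasurable.mul (hn1 v).1)
      (Filter.Eventually.of_forall fun x => ?_)
    rw [norm_mul, norm_neg, norm_mul, Complex.norm_I, mul_one, Complex.norm_real]
    rcases le_or_gt ‖x‖ R with h | h
    · gcongr
      exact (abs_real_inner_le_norm x u).trans (by gcongr)
    · simp [hgout x h]
  refine ⟨ft g, fun v => ft fun x => (-((inner ℝ x v : ℝ) * Complex.I)) * g x,
    fun u v => ft fun x => (-((inner ℝ x u : ℝ) * Complex.I)) *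
      ((-((inner ℝ x v : ℝ) * Complex.I)) * g x),
    continuous_ft hgi, fun v => continuous_ft (hn1 v), fun u v => continuous_ft (hn2 u v),
    fun v ξ => hasLineDerivAt_ft hgi (hx1 g hgi hgout) v ξ,
    fun u v ξ => hasLineDerivAt_ft (hn1 v) (hx1 _ (hn1 v) fun x hx => by simp [hgout x hx]) u ξ,
    fun ξ => ?_, fun ξ => ?_, fun v ξ hv => ?_, fun u v hu hv => ?_⟩
  · rw [ft_sub hfi hgi]
    refine (norm_ft_le _ ξ).trans ?_
    calc ∫ x, ‖f x - g x‖ ≤ ∫ x, R ^ (-(9 / 10) : ℝ) * (jap x ^ (9 / 10 : ℝ) * ‖f x‖) := by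
          refine integral_mono (hfi.sub hgi).norm (i0.const_mul _) fun x => ?_
          simp only
          have hj := jap_pos x
          rcases le_or_gt ‖x‖ R with h | h
          · have : g x = f x := indicator_of_mem (by simpa [hS] using h) _
            rw [this, sub_self, norm_zero]; positivity
          · rw [hgout x h, sub_zero, ← mul_assoc]
            refine le_mul_of_one_le_left (norm_nonneg _) ?_
            rw [Real.rpow_neg hR0.le, inv_mul_eq_div, one_le_div (by positivity)]
            exact Real.rpow_le_rpow hR0.le (h.le.trans (norm_le_jap x)) (by norm_num)
      _ = R ^ (-(9 / 10) : ℝ) * ∫ x, jap x ^ (9 / 10 : ℝ) * ‖f x‖ := integral_const_mul _ _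
      _ ≤ R ^ (-(9 / 10) : ℝ) * (C0 * β) := by gcongr
      _ ≤ R ^ (-(9 / 10) : ℝ) * ((C0 + 2 * C1 + 2 * Real.pi) * β) := by
          gcongr; linarith [Real.pi_pos]
      _ = _ := by ring
  · refine (norm_ft_le _ ξ).trans ?_
    calc ∫ x, ‖g x‖ ≤ ∫ x, jap x ^ (9 / 10 : ℝ) * ‖f x‖ := by
          refine integral_mono hgi.norm i0 fun x => (hgle x).trans ?_
          exact le_mul_of_one_le_left (norm_nonneg _)
            (Real.one_le_rpow (one_le_jap x) (by norm_num))
      _ ≤ C0 * β := b0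
      _ ≤ _ := by gcongr; linarith [Real.pi_pos]
  · refine (norm_ft_le _ ξ).trans ?_
    calc ∫ x, ‖-((inner ℝ x v : ℝ) * Complex.I) * g x‖
        ≤ ∫ x, (2 * R ^ (1 / 100 : ℝ)) * (jap x ^ (99 / 100 : ℝ) * ‖f x‖) := by
          refine integral_mono (hn1 v).norm (i1.const_mul _) fun x => ?_
          simp only
          rw [norm_mul, norm_neg, norm_mul, Complex.norm_I, mul_one, Complex.norm_real]
          have hj := jap_pos x
          rcases le_or_gt ‖x‖ R with h | h
          · rw [← mul_assoc]
            gcongr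
            · calc |inner ℝ x v| ≤ ‖x‖ * ‖v‖ := abs_real_inner_le_norm x v
                _ ≤ jap x * 1 := by gcongr; exact norm_le_jap x
                _ = jap x ^ (1 / 100 : ℝ) * jap x ^ (99 / 100 : ℝ) := by
                    rw [← Real.rpow_add hj]; norm_num
                _ ≤ (2 * R) ^ (1 / 100 : ℝ) * jap x ^ (99 / 100 : ℝ) := by
                    gcongr
                    linarith [jap_le_one_add x]
                _ ≤ _ := by
                    rw [Real.mul_rpow (by norm_num) hR0.le]
                    gcongr
                    calc (2 : ℝ) ^ (1 / 100 : ℝ) ≤ 2 ^ (1 : ℝ) := by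
                          gcongr <;> norm_num
                      _ = 2 := by norm_num
            · exact hgle x
          · rw [hgout x h, norm_zero, mul_zero]; positivity
      _ = 2 * R ^ (1 / 100 : ℝ) * ∫ x, jap x ^ (99 / 100 : ℝ) * ‖f x‖ := integral_const_mul _ _
      _ ≤ 2 * R ^ (1 / 100 : ℝ) * (C1 * β) := by gcongr
      _ = R ^ (1 / 100 : ℝ) * ((2 * C1) * β) := by ring
      _ ≤ R ^ (1 / 100 : ℝ) * ((C0 + 2 * C1 + 2 * Real.pi) * β) := by
          gcongr; linarith [Real.pi_pos]
      _ = _ := by ring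
  -- Two factors of `x` use up the whole weight `⟨x⟩²`, so the second derivatives are controlled by
  -- Plancherel in `L²` only, uniformly in `R`.
  · have hle : eLpNorm (fun x => (-((inner ℝ x u : ℝ) * Complex.I)) *
        ((-((inner ℝ x v : ℝ) * Complex.I)) * g x)) 2 volume ≤ ENNReal.ofReal β := by
      refine (eLpNorm_mono fun x => ?_).trans hf.weight
      have hj := jap_pos x
      rw [norm_mul, norm_mul, norm_neg, norm_neg, norm_mul, norm_mul, Complex.norm_I, mul_one,
        mul_one, Complex.norm_real, Complex.norm_real, norm_mul, Complex.norm_real, ← mul_assoc,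
        Real.norm_of_nonneg (r := jap x ^ 2) (by positivity), pow_two]
      have hi : ∀ w : Plane, ‖w‖ ≤ 1 → ‖inner ℝ x w‖ ≤ jap x := fun w hw =>
        calc ‖inner ℝ x w‖ ≤ ‖x‖ * ‖w‖ := norm_inner_le_norm x w
          _ ≤ jap x * 1 := by gcongr; exact norm_le_jap x
          _ = _ := mul_one _
      gcongr
      · exact hi u hu
      · exact hi v hv
      · exact hgle x
    rw [eLpNorm_ft (hn2 u v) ⟨(hn2 u v).1, hle.trans_lt ENNReal.ofReal_lt_top⟩]
    calc _ ≤ ENNReal.ofReal (2 * Real.pi) * ENNReal.ofReal β := by gcongr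
      _ = ENNReal.ofReal (2 * Real.pi * β) := (ENNReal.ofReal_mul (by positivity)).symm
      _ ≤ _ := by
          apply ENNReal.ofReal_le_ofReal
          gcongr
          linarith

theorem hasLineDerivAt_jap_sq_mul (m : ℝ) (ξ v : Plane) :
    HasLineDerivAt ℝ (fun ζ : Plane => jap ζ ^ 2 * m) (2 * m * inner ℝ ξ v) ξ v := by
  have h := hasLineDerivAt_mul (hasLineDerivAt_mul (hasLineDerivAt_jap ξ v) (hasLineDerivAt_jap ξ v))
    (hasLineDerivAt_const m)
  simp only [← pow_two] at h
  refine hasLineDerivAt_congr_deriv h ?_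
  have := (jap_pos ξ).ne'
  rw [djap]; field_simp; ring

/-- A frequency cutoff at scale `M`, with its first two derivatives. -/
theorem exists_frequency_cutoff : ∃ K : ℝ, 1 ≤ K ∧ ∀ M : ℝ, 1 ≤ M →
    ∃ (χ : Plane → ℝ) (χ1 : Plane → Plane → ℝ) (χ2 : Plane → Plane → Plane → ℝ),
      Continuous χ ∧ (∀ v, Continuous (χ1 v)) ∧ (∀ u v, Continuous (χ2 u v)) ∧
      (∀ v ξ, HasLineDerivAt ℝ χ (χ1 v ξ) ξ v) ∧
      (∀ u v ξ, HasLineDerivAt ℝ (χ1 v) (χ2 u v ξ) ξ u) ∧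
      (∀ ξ, 0 ≤ χ ξ ∧ χ ξ ≤ 1) ∧ (∀ ξ, jap ξ ≤ M → χ ξ = 1) ∧
      (∀ ξ, 2 * M < jap ξ → χ ξ = 0 ∧ (∀ v, χ1 v ξ = 0) ∧ ∀ u v, χ2 u v ξ = 0) ∧
      (∀ v ξ, ‖v‖ ≤ 1 → |χ1 v ξ| ≤ K) ∧ ∀ u v ξ, ‖u‖ ≤ 1 → ‖v‖ ≤ 1 → |χ2 u v ξ| ≤ K := by
  obtain ⟨θ, θ1, θ2, K, hK, c0, c1, c2, d0, d1, h01, hone, hzero, b1, b2⟩ := exists_cutoff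
  -- The second derivative of `θ(m⟨ξ⟩²)` is at most `4·4·K + 2·K`.
  refine ⟨18 * K, by linarith, fun M hM => ?_⟩
  set m : ℝ := (M ^ 2)⁻¹ with hm
  have hM0 : 0 < M := by linarith
  have hm0 : 0 < m := by positivity
  have hm1 : m ≤ 1 := inv_le_one_of_one_le₀ (one_le_pow₀ hM)
  have hMm : M ^ 2 * m = 1 := mul_inv_cancel₀ (by positivity)
  have cj := continuous_jap (E := Plane)
  have hq : ∀ ξ : Plane, 2 * M < jap ξ → 4 ≤ jap ξ ^ 2 * m := fun ξ h => by
    have : (2 * M) ^ 2 ≤ jap ξ ^ 2 := by gcongr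
    calc (4 : ℝ) = (2 * M) ^ 2 * m := by linear_combination (-4) * hMm
      _ ≤ _ := by gcongr
  have hq1 : ∀ v ξ : Plane, jap ξ ≤ 2 * M → ‖v‖ ≤ 1 → |2 * m * inner ℝ ξ v| ≤ 4 := fun v ξ h hv => by
    rw [abs_mul, abs_of_pos (by positivity)]
    calc 2 * m * |inner ℝ ξ v| ≤ 2 * m * (‖ξ‖ * ‖v‖) := by gcongr; exact abs_real_inner_le_norm ξ v
      _ ≤ 2 * m * ((2 * M) * 1) := by gcongr; exact (norm_le_jap ξ).trans h
      _ ≤ 2 * m * ((2 * M) * M) := by gcongr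
      _ = 4 := by linear_combination 4 * hMm
  have hq2 : ∀ u v : Plane, ‖u‖ ≤ 1 → ‖v‖ ≤ 1 → |2 * m * inner ℝ u v| ≤ 2 := fun u v hu hv => by
    rw [abs_mul, abs_of_pos (by positivity)]
    calc 2 * m * |inner ℝ u v| ≤ 2 * m * (‖u‖ * ‖v‖) := by gcongr; exact abs_real_inner_le_norm u v
      _ ≤ 2 * 1 * (1 * 1) := by gcongr
      _ = 2 := by norm_num
  refine ⟨fun ξ => θ (jap ξ ^ 2 * m), fun v ξ => θ1 (jap ξ ^ 2 * m) * (2 * m * inner ℝ ξ v),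
    fun u v ξ => θ2 (jap ξ ^ 2 * m) * (2 * m * inner ℝ ξ u) * (2 * m * inner ℝ ξ v)
      + θ1 (jap ξ ^ 2 * m) * (2 * m * inner ℝ u v), by fun_prop, fun v => by fun_prop,
    fun u v => by fun_prop, fun v ξ => ?_, fun u v ξ => ?_, fun ξ => h01 _, fun ξ h => ?_,
    fun ξ h => ?_, fun v ξ hv => ?_, fun u v ξ hu hv => ?_⟩
  · exact hasLineDerivAt_comp (d0 _) (hasLineDerivAt_jap_sq_mul m ξ v)
  · refine hasLineDerivAt_congr_deriv (hasLineDerivAt_mul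
      (hasLineDerivAt_comp (d1 _) (hasLineDerivAt_jap_sq_mul m ξ u))
      (hasLineDerivAt_mul (hasLineDerivAt_const (2 * m)) (hasLineDerivAt_inner_right v))) ?_
    ring
  · refine hone _ ?_
    have hj := jap_pos ξ
    calc jap ξ ^ 2 * m ≤ M ^ 2 * m := by gcongr
      _ = 1 := hMm
  · obtain ⟨z0, z1, z2⟩ := hzero _ (hq ξ h)
    exact ⟨z0, fun v => by simp [z1], fun u v => by simp [z1, z2]⟩
  · rcases lt_or_ge (2 * M) (jap ξ) with h | h
    · simp only [(hzero _ (hq ξ h)).2.1, zero_mul, abs_zero]; linarith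
    · rw [abs_mul]
      calc _ ≤ K * 4 := by gcongr <;> [exact b1 _; exact hq1 v ξ h hv]
        _ ≤ _ := by linarith
  · rcases lt_or_ge (2 * M) (jap ξ) with h | h
    · simp only [(hzero _ (hq ξ h)).2.1, (hzero _ (hq ξ h)).2.2, zero_mul, add_zero, abs_zero]
      linarith
    · refine (abs_add_le _ _).trans ?_
      rw [abs_mul, abs_mul, abs_mul (θ1 _)]
      calc _ ≤ K * 4 * 4 + K * 2 := by
            gcongr
            · exact b2 _
            · exact hq1 u ξ h hu
            · exact hq1 v ξ h hv
            · exact b1 _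
            · exact hq2 u v hu hv
        _ = _ := by ring

theorem jap_rpow_le_of_le {s : ℝ} (hs : 0 ≤ s) {N : ℝ} (ξ : Plane) (h : jap ξ ≤ N) :
    jap ξ ^ s ≤ N ^ (s + 3) * jap ξ ^ (-3 : ℝ) := by
  have hj := jap_pos ξ
  have hN : 0 < N := hj.trans_le h
  calc jap ξ ^ s = jap ξ ^ (s + 3) * jap ξ ^ (-3 : ℝ) := by
        rw [← Real.rpow_add hj]; congr 1; ring
    _ ≤ _ := by gcongr

theorem jap_rpow_le_of_ge {s r : ℝ} (hs : s ≤ r) {N : ℝ} (hN : 0 < N) (ξ : Plane) (h : N ≤ jap ξ) :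
    jap ξ ^ s ≤ N ^ (s - r) * jap ξ ^ r := by
  have hj := jap_pos ξ
  calc jap ξ ^ s = jap ξ ^ (s - r) * jap ξ ^ r := by
        rw [← Real.rpow_add hj]; congr 1; ring
    _ ≤ _ := by
        gcongr ?_ * _
        exact Real.rpow_le_rpow_of_nonpos hN h (by linarith)

/-- Truncation of a profile at distance `τ²` in space and at frequency `τ^{2/n}`. -/
theorem exists_trunc {n k : ℝ} (hn : 1000 ≤ n) (hk : k = n / 100) : ∃ C : ℝ, 0 < C ∧
    ∀ (β : ℝ) (f : Plane → ℂ), 0 ≤ β → ProfileBound n β f → ∀ τ : ℝ, 1 ≤ τ →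
    ∃ (G : Plane → ℂ) (G1 : Plane → Plane → ℂ) (G2 Q : Plane → Plane → Plane → ℂ),
      IsC2c G G1 G2 ∧
      (∀ ξ, 2 * τ ^ (2 / n) < jap ξ → G ξ = 0 ∧ (∀ v, G1 v ξ = 0) ∧ ∀ u v, G2 u v ξ = 0) ∧
      (∀ ξ, ‖G ξ‖ ≤ ‖ft f ξ‖ + C * β * τ ^ (-(3 / 2) : ℝ)) ∧
      (∀ ξ, ‖G ξ‖ ≤ C * β) ∧
      (∀ v ξ, ‖v‖ ≤ 1 → ‖G1 v ξ‖ ≤ C * β * τ ^ (1 / 50 : ℝ)) ∧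
      (∀ u v, Continuous (Q u v)) ∧
      (∀ u v, ‖u‖ ≤ 1 → ‖v‖ ≤ 1 → eLpNorm (Q u v) 2 volume ≤ ENNReal.ofReal (C * β)) ∧
      (∀ u v ξ, ‖u‖ ≤ 1 → ‖v‖ ≤ 1 → ‖G2 u v ξ‖ ≤ ‖Q u v ξ‖ + C * β * τ ^ (1 / 50 : ℝ)) ∧
      Integrable (fun ξ => jap ξ ^ k * ‖ft f ξ - G ξ‖) ∧
      ∫ ξ, jap ξ ^ k * ‖ft f ξ - G ξ‖ ≤ C * β * τ ^ (-(3 / 2) : ℝ) := by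
  obtain ⟨K, hK, hcut⟩ := exists_frequency_cutoff
  obtain ⟨C0, hC0, hsp⟩ := exists_spatial_trunc
  obtain ⟨C1, hC1, hint⟩ := exists_integral_ft_le
  set J : ℝ := ∫ ξ : Plane, jap ξ ^ (-3 : ℝ) with hJ
  have hJ0 : 0 ≤ J := integral_nonneg fun ξ => Real.rpow_nonneg (jap_pos ξ).le _
  have hn0 : 0 < n := by linarith
  have hk0 : 0 ≤ k := by rw [hk]; positivity
  set c2 : ℝ := 2 ^ (k + 3) with hc2
  have hc20 : 0 < c2 := by positivity
  refine ⟨4 * K * C0 + C0 * c2 * J + C1, by positivity, fun β f hβ hf τ hτ => ?_⟩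
  set C := 4 * K * C0 + C0 * c2 * J + C1 with hC
  have hKC : 4 * K * C0 ≤ C := by
    have : 0 ≤ C0 * c2 * J := by positivity
    linarith
  have hC0K : C0 ≤ K * C0 := le_mul_of_one_le_left hC0.le hK
  have hC0C : C0 ≤ C := by linarith
  have hτ0 : 0 < τ := by linarith
  -- Below this frequency, trading `⟨ξ⟩^k` for the integrable `⟨ξ⟩⁻³` costs `M^{k+3} = τ^{1/50 +
  -- 6/n}`, against the gain `τ^{-9/5}` of the spatial cutoff at `τ²`. Above it, the weight `n - 2`
  -- gains `M^{k-(n-2)} = τ^{-99/50 + 4/n}`. Both errors are `O(τ^{-3/2})`.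
  set M := τ ^ (2 / n) with hM
  have hM1 : 1 ≤ M := Real.one_le_rpow hτ (by positivity)
  have hM0 : 0 < M := by linarith
  obtain ⟨χ, χ1, χ2, cχ, cχ1, cχ2, dχ, dχ1, hχ01, hχone, hχzero, bχ1, bχ2⟩ := hcut M hM1
  obtain ⟨F, F1, F2, cF, cF1, cF2, dF, dF1, hFF, bF, bF1, bF2⟩ :=
    hsp n β f hβ hf (τ ^ 2) (one_le_pow₀ hτ)
  obtain ⟨if0, bf0⟩ := hint n β f hβ hf
  have e1 : (τ ^ 2) ^ (1 / 100 : ℝ) = τ ^ (1 / 50 : ℝ) := by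
    rw [← Real.rpow_natCast, ← Real.rpow_mul hτ0.le]; norm_num
  have e2 : (τ ^ 2) ^ (-(9 / 10) : ℝ) = τ ^ (-(9 / 5) : ℝ) := by
    rw [← Real.rpow_natCast, ← Real.rpow_mul hτ0.le]; norm_num
  rw [e2] at hFF
  simp only [e1] at bF1
  have h50 : 1 ≤ τ ^ (1 / 50 : ℝ) := Real.one_le_rpow hτ (by norm_num)
  have cG2 : ∀ u v, Continuous fun ξ => ((χ2 u v ξ : ℂ) * F ξ + (χ1 v ξ : ℂ) * F1 u ξ)
      + ((χ1 u ξ : ℂ) * F1 v ξ + (χ ξ : ℂ) * F2 u v ξ) := fun u v => by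
    have h1 := cF1 u
    have h2 := cF1 v
    have h3 := cF2 u v
    have h4 := cχ1 u
    have h5 := cχ1 v
    have h6 := cχ2 u v
    fun_prop
  have cG1 : ∀ v, Continuous fun ξ => (χ1 v ξ : ℂ) * F ξ + (χ ξ : ℂ) * F1 v ξ := fun v => by
    have h2 := cF1 v
    have h5 := cχ1 v
    fun_prop
  have hout : ∀ ξ ∉ Metric.closedBall (0 : Plane) (2 * M), 2 * M < jap ξ := fun ξ h => by
    simp only [Metric.mem_closedBall, dist_zero_right, not_le] at h
    exact h.trans_le (norm_le_jap ξ)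
  have hcomp := isCompact_closedBall (0 : Plane) (2 * M)
  have hτ95 : τ ^ (-(9 / 5) : ℝ) ≤ τ ^ (-(3 / 2) : ℝ) :=
    Real.rpow_le_rpow_of_exponent_le hτ (by norm_num)
  have herr : ∀ ξ, jap ξ ^ k * ‖ft f ξ - χ ξ * F ξ‖ ≤
      (C0 * β * τ ^ (-(9 / 5) : ℝ) * (2 * M) ^ (k + 3)) * jap ξ ^ (-3 : ℝ)
        + M ^ (k - (n - 2)) * (jap ξ ^ (n - 2) * ‖ft f ξ‖) := fun ξ => by
    have hj := jap_pos ξ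
    -- The first term is the spatial error at low frequency, the second the frequency tail.
    have hd : ft f ξ - χ ξ * F ξ = χ ξ * (ft f ξ - F ξ) + (1 - χ ξ : ℝ) * ft f ξ := by
      push_cast; ring
    have h1 : ‖ft f ξ - χ ξ * F ξ‖ ≤ χ ξ * (C0 * β * τ ^ (-(9 / 5) : ℝ)) + (1 - χ ξ) * ‖ft f ξ‖ := by
      rw [hd]
      refine (norm_add_le _ _).trans ?_
      rw [norm_mul, norm_mul, Complex.norm_real, Complex.norm_real, Real.norm_of_nonneg (hχ01 ξ).1,
        Real.norm_of_nonneg (by linarith [(hχ01 ξ).2])]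
      gcongr
      · exact (hχ01 ξ).1
      · exact hFF ξ
    have h2 : jap ξ ^ k * χ ξ ≤ (2 * M) ^ (k + 3) * jap ξ ^ (-3 : ℝ) := by
      rcases lt_or_ge (2 * M) (jap ξ) with h | h
      · rw [(hχzero ξ h).1, mul_zero]; positivity
      · calc jap ξ ^ k * χ ξ ≤ jap ξ ^ k * 1 := by gcongr; exact (hχ01 ξ).2
          _ ≤ _ := by rw [mul_one]; exact jap_rpow_le_of_le hk0 ξ h
    have h3 : jap ξ ^ k * (1 - χ ξ) ≤ M ^ (k - (n - 2)) * jap ξ ^ (n - 2) := by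
      rcases le_or_gt (jap ξ) M with h | h
      · rw [hχone ξ h, sub_self, mul_zero]; positivity
      · calc jap ξ ^ k * (1 - χ ξ) ≤ jap ξ ^ k * 1 := by gcongr; linarith [(hχ01 ξ).1]
          _ ≤ _ := by
            rw [mul_one]; exact jap_rpow_le_of_ge (by rw [hk]; linarith) hM0 ξ h.le
    calc jap ξ ^ k * ‖ft f ξ - χ ξ * F ξ‖
        ≤ jap ξ ^ k * (χ ξ * (C0 * β * τ ^ (-(9 / 5) : ℝ)) + (1 - χ ξ) * ‖ft f ξ‖) := by gcongr
      _ = (jap ξ ^ k * χ ξ) * (C0 * β * τ ^ (-(9 / 5) : ℝ))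
          + (jap ξ ^ k * (1 - χ ξ)) * ‖ft f ξ‖ := by ring
      _ ≤ ((2 * M) ^ (k + 3) * jap ξ ^ (-3 : ℝ)) * (C0 * β * τ ^ (-(9 / 5) : ℝ))
          + (M ^ (k - (n - 2)) * jap ξ ^ (n - 2)) * ‖ft f ξ‖ := by gcongr
      _ = _ := by ring
  have hrhs : Integrable fun ξ : Plane =>
      (C0 * β * τ ^ (-(9 / 5) : ℝ) * (2 * M) ^ (k + 3)) * jap ξ ^ (-3 : ℝ)
        + M ^ (k - (n - 2)) * (jap ξ ^ (n - 2) * ‖ft f ξ‖) :=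
    ((integrable_jap_rpow (by norm_num)).const_mul _).add (if0.const_mul _)
  have cft := continuous_ft (hf.integrable hβ)
  have hlhs : Integrable fun ξ : Plane => jap ξ ^ k * ‖ft f ξ - χ ξ * F ξ‖ := by
    refine hrhs.mono' ?_ (Filter.Eventually.of_forall fun ξ => ?_)
    · have := continuous_jap_rpow k
      exact (by fun_prop : Continuous fun ξ : Plane =>
        jap ξ ^ k * ‖ft f ξ - χ ξ * F ξ‖).aestronglyMeasurable
    · have hj := jap_pos ξ
      rw [Real.norm_of_nonneg (by positivity)]
      exact herr ξ
  refine ⟨fun ξ => χ ξ * F ξ, fun v ξ => χ1 v ξ * F ξ + χ ξ * F1 v ξ,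
    fun u v ξ => (χ2 u v ξ * F ξ + χ1 v ξ * F1 u ξ) + (χ1 u ξ * F1 v ξ + χ ξ * F2 u v ξ), F2,
    ⟨by fun_prop, cG1, cG2, HasCompactSupport.intro hcomp fun ξ h => by simp [hχzero ξ (hout ξ h)],
      fun v => HasCompactSupport.intro hcomp fun ξ h => by simp [hχzero ξ (hout ξ h)],
      fun u v => HasCompactSupport.intro hcomp fun ξ h => by simp [hχzero ξ (hout ξ h)],
      fun v ξ => hasLineDerivAt_mul (hasLineDerivAt_ofReal (dχ v ξ)) (dF v ξ),
      fun u v ξ => hasLineDerivAt_add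
        (hasLineDerivAt_mul (hasLineDerivAt_ofReal (dχ1 u v ξ)) (dF u ξ))
        (hasLineDerivAt_mul (hasLineDerivAt_ofReal (dχ u ξ)) (dF1 u v ξ))⟩,
    fun ξ h => ?_, fun ξ => ?_, fun ξ => ?_, fun v ξ hv => ?_, cF2, fun u v hu hv => ?_,
    fun u v ξ hu hv => ?_, hlhs, ?_⟩
  · obtain ⟨z0, z1, z2⟩ := hχzero ξ h
    exact ⟨by simp [z0], fun v => by simp [z0, z1], fun u v => by simp [z0, z1, z2]⟩
  · have h1 : ‖(χ ξ : ℂ) * F ξ‖ ≤ ‖F ξ‖ := by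
      rw [norm_mul, Complex.norm_real, Real.norm_of_nonneg (hχ01 ξ).1]
      exact mul_le_of_le_one_left (norm_nonneg _) (hχ01 ξ).2
    have h2 := norm_sub_norm_le (F ξ) (ft f ξ)
    rw [norm_sub_rev] at h2
    have h3 : C0 * β * τ ^ (-(9 / 5) : ℝ) ≤ C * β * τ ^ (-(3 / 2) : ℝ) := by gcongr
    linarith [hFF ξ]
  · rw [norm_mul, Complex.norm_real, Real.norm_of_nonneg (hχ01 ξ).1]
    calc χ ξ * ‖F ξ‖ ≤ 1 * (C0 * β) := by gcongr <;> [exact (hχ01 ξ).2; exact bF ξ]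
      _ ≤ C * β := by rw [one_mul]; gcongr
  · refine (norm_add_le _ _).trans ?_
    rw [norm_mul, norm_mul, Complex.norm_real, Complex.norm_real, Real.norm_eq_abs,
      Real.norm_of_nonneg (hχ01 ξ).1]
    calc |χ1 v ξ| * ‖F ξ‖ + χ ξ * ‖F1 v ξ‖ ≤ K * (C0 * β) + 1 * (C0 * β * τ ^ (1 / 50 : ℝ)) := by
          gcongr
          · exact bχ1 v ξ hv
          · exact bF ξ
          · exact (hχ01 ξ).2
          · exact bF1 v ξ hv
      _ ≤ (K * (C0 * β)) * τ ^ (1 / 50 : ℝ) + (K * C0) * β * τ ^ (1 / 50 : ℝ) := by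
          have h1 : K * (C0 * β) ≤ K * (C0 * β) * τ ^ (1 / 50 : ℝ) :=
            le_mul_of_one_le_right (by positivity) h50
          have h2 : C0 * β * τ ^ (1 / 50 : ℝ) ≤ K * C0 * β * τ ^ (1 / 50 : ℝ) := by gcongr
          linarith
      _ = (2 * K * C0) * β * τ ^ (1 / 50 : ℝ) := by ring
      _ ≤ _ := by
          gcongr
          have : 0 < K * C0 := by positivity
          linarith
  · exact (bF2 u v hu hv).trans (ENNReal.ofReal_le_ofReal (by gcongr))
  · refine (norm_add_le _ _).trans ((add_le_add (norm_add_le _ _) (norm_add_le _ _)).trans ?_)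
    simp only [norm_mul, Complex.norm_real, Real.norm_eq_abs]
    rw [abs_of_nonneg (hχ01 ξ).1]
    calc _ ≤ (K * (C0 * β) + K * (C0 * β * τ ^ (1 / 50 : ℝ)))
          + (K * (C0 * β * τ ^ (1 / 50 : ℝ)) + 1 * ‖F2 u v ξ‖) := by
          gcongr
          · exact bχ2 u v ξ hu hv
          · exact bF ξ
          · exact bχ1 v ξ hv
          · exact bF1 u ξ hu
          · exact bχ1 u ξ hu
          · exact bF1 v ξ hv
          · exact (hχ01 ξ).2
      _ ≤ ((K * (C0 * β)) * τ ^ (1 / 50 : ℝ) + K * (C0 * β * τ ^ (1 / 50 : ℝ)))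
          + (K * (C0 * β * τ ^ (1 / 50 : ℝ)) + 1 * ‖F2 u v ξ‖) := by
          have h1 : K * (C0 * β) ≤ K * (C0 * β) * τ ^ (1 / 50 : ℝ) :=
            le_mul_of_one_le_right (by positivity) h50
          linarith
      _ = ‖F2 u v ξ‖ + (3 * K * C0) * β * τ ^ (1 / 50 : ℝ) := by ring
      _ ≤ _ := by
          gcongr
          have : 0 < K * C0 := by positivity
          linarith
  · refine (integral_mono hlhs hrhs herr).trans ?_
    rw [integral_add ((integrable_jap_rpow (by norm_num)).const_mul _) (if0.const_mul _),
      integral_const_mul, integral_const_mul, ← hJ]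
    have x1 : τ ^ (-(9 / 5) : ℝ) * (2 * M) ^ (k + 3) ≤ c2 * τ ^ (-(3 / 2) : ℝ) := by
      rw [Real.mul_rpow (by norm_num) hM0.le, ← hc2, hM, ← Real.rpow_mul hτ0.le, mul_left_comm,
        ← Real.rpow_add hτ0]
      gcongr
      · rw [hk]
        have : 2 / n * (n / 100 + 3) = 1 / 50 + 6 / n := by field_simp; ring
        rw [this]
        have : 6 / n ≤ 6 / 1000 := by gcongr
        linarith
    have x2 : M ^ (k - (n - 2)) ≤ τ ^ (-(3 / 2) : ℝ) := by
      rw [hM, ← Real.rpow_mul hτ0.le]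
      gcongr
      · rw [hk]
        have : 2 / n * (n / 100 - (n - 2)) = -(99 / 50) + 4 / n := by field_simp; ring
        rw [this]
        have : 4 / n ≤ 4 / 1000 := by gcongr
        linarith
    have hI0 : 0 ≤ ∫ ξ, jap ξ ^ (n - 2) * ‖ft f ξ‖ :=
      integral_nonneg fun ξ => mul_nonneg (Real.rpow_nonneg (jap_pos ξ).le _) (norm_nonneg _)
    calc _ = C0 * β * J * (τ ^ (-(9 / 5) : ℝ) * (2 * M) ^ (k + 3))
          + M ^ (k - (n - 2)) * ∫ ξ, jap ξ ^ (n - 2) * ‖ft f ξ‖ := by ring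
      _ ≤ C0 * β * J * (c2 * τ ^ (-(3 / 2) : ℝ)) + τ ^ (-(3 / 2) : ℝ) * (C1 * β) := by gcongr
      _ = (C0 * c2 * J + C1) * β * τ ^ (-(3 / 2) : ℝ) := by ring
      _ ≤ _ := by
          gcongr
          have : 0 < 4 * K * C0 := by positivity
          linarith

/-! ### The linear dispersive estimate. -/

theorem eLpNorm_two_le_of_integral_sq {α E : Type*} [MeasurableSpace α] {μ : Measure α}
    [NormedAddCommGroup E] {g : α → E} (hg : AEStronglyMeasurable g μ) {a : ℝ}
    (hi : Integrable (fun x => ‖g x‖ ^ 2) μ) (ha : ∫ x, ‖g x‖ ^ 2 ∂μ ≤ a) :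
    eLpNorm g 2 μ ≤ ENNReal.ofReal (Real.sqrt a) := by
  have hm : MemLp g 2 μ := (memLp_two_iff_integrable_sq_norm hg).2 hi
  rw [hm.eLpNorm_eq_integral_rpow_norm (by norm_num) (by norm_num)]
  apply ENNReal.ofReal_le_ofReal
  rw [Real.sqrt_eq_rpow]
  simp only [ENNReal.toReal_ofNat, Real.rpow_ofNat, one_div]
  gcongr

/-- Decay of an oscillatory integral whose amplitude is controlled with weights. -/
theorem exists_norm_integral_osc_le : ∃ C : ℝ, 0 < C ∧ ∀ (t : ℝ), 1 ≤ t → ∀ (x : Plane)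
    (G : Plane → ℂ) (G1 : Plane → Plane → ℂ) (G2 : Plane → Plane → Plane → ℂ)
    (R : Plane → Plane → Plane → ℝ) (a b c : ℝ), IsC2c G G1 G2 → 0 ≤ a → 0 ≤ b → 0 ≤ c →
    (∀ ξ, ‖G ξ‖ ≤ a * (jap ξ ^ 4)⁻¹) →
    (∀ v ξ, ‖v‖ ≤ 1 → ‖G1 v ξ‖ ≤ b * (jap ξ ^ 4)⁻¹) →
    (∀ u v, Continuous (R u v)) →
    (∀ u v, ‖u‖ ≤ 1 → ‖v‖ ≤ 1 → eLpNorm (R u v) 2 volume ≤ ENNReal.ofReal c) →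
    (∀ u v ξ, ‖u‖ ≤ 1 → ‖v‖ ≤ 1 → ‖G2 u v ξ‖ ≤ (jap ξ ^ 2)⁻¹ * ‖R u v ξ‖) →
    ‖∫ ξ, osc t x ξ * G ξ‖ ≤ C * (a + b / Real.sqrt t + c / Real.sqrt t) / t := by
  obtain ⟨C, hC, hw⟩ := exists_integral_oscW_le
  refine ⟨1281 * C + 166 * C + 4 * Real.sqrt C, by positivity,
    fun t ht x G G1 G2 R a b c h ha hb hc hG hG1 hR hRn hG2 => ?_⟩
  have ht0 : 0 < t := by linarith
  obtain ⟨wi, wb⟩ := hw t ht0 (t⁻¹ • x)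
  set w := oscW t (t⁻¹ • x) with hwdef
  have hw0 : ∀ ξ, 0 < w ξ := oscW_pos _ ht0
  have hw1 : ∀ ξ, w ξ ≤ 1 := oscW_le_one _ ht0
  have cw : Continuous w := continuous_oscW _ ht0
  have cj := continuous_jap (E := Plane)
  have hj := fun ξ : Plane => jap_pos ξ
  have hs : ∀ ξ, Real.sqrt (w ξ) * Real.sqrt (w ξ) = w ξ := fun ξ => Real.mul_self_sqrt (hw0 ξ).le
  have hs1 : ∀ ξ, Real.sqrt (w ξ) ≤ 1 := fun ξ => Real.sqrt_le_one.2 (hw1 ξ)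
  have b1 : ∫ ξ, Real.sqrt (w ξ) ^ 3 * ‖G ξ‖ ≤ a * (C / t) := by
    calc _ ≤ ∫ ξ, a * (Real.sqrt (w ξ) ^ 3 * (jap ξ ^ 4)⁻¹) := by
          refine integral_mono_of_nonneg (Filter.Eventually.of_forall fun ξ => by positivity)
            (wi.const_mul a) (Filter.Eventually.of_forall fun ξ => ?_)
          have := mul_le_mul_of_nonneg_left (hG ξ) (by positivity : 0 ≤ Real.sqrt (w ξ) ^ 3)
          dsimp only
          linarith
      _ ≤ _ := by rw [integral_const_mul]; gcongr
  have b2 : ∫ ξ, Real.sqrt (w ξ) ^ 3 * (‖G1 (e 0) ξ‖ + ‖G1 (e 1) ξ‖) ≤ 2 * b * (C / t) := by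
    calc _ ≤ ∫ ξ, (2 * b) * (Real.sqrt (w ξ) ^ 3 * (jap ξ ^ 4)⁻¹) := by
          refine integral_mono_of_nonneg (Filter.Eventually.of_forall fun ξ => by positivity)
            (wi.const_mul _) (Filter.Eventually.of_forall fun ξ => ?_)
          have := mul_le_mul_of_nonneg_left (add_le_add (hG1 (e 0) ξ (norm_e 0).le)
            (hG1 (e 1) ξ (norm_e 1).le)) (by positivity : 0 ≤ Real.sqrt (w ξ) ^ 3)
          dsimp only
          linarith
      _ ≤ _ := by rw [integral_const_mul]; gcongr
  -- The second derivatives lie only in `L²`, so they are paired by Cauchy–Schwarz with `w⟨ξ⟩⁻²`.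
  -- Since `w ≤ 1`, the square of the latter is at most `w^{3/2}⟨ξ⟩⁻⁴`, hence its norm is at most
  -- `(C/t)^{1/2}`.
  have cR : Continuous fun ξ => w ξ * (jap ξ ^ 2)⁻¹ :=
    cw.mul ((cj.pow 2).inv₀ fun ξ => (pow_pos (hj ξ) 2).ne')
  have hsq : ∀ ξ, ‖w ξ * (jap ξ ^ 2)⁻¹‖ ^ 2 ≤ Real.sqrt (w ξ) ^ 3 * (jap ξ ^ 4)⁻¹ := fun ξ => by
    have h2 : ‖w ξ * (jap ξ ^ 2)⁻¹‖ ^ 2 = w ξ ^ 2 * (jap ξ ^ 4)⁻¹ := by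
      rw [Real.norm_eq_abs, sq_abs, mul_pow, inv_pow]; ring
    rw [h2]
    have := hj ξ
    gcongr
    calc w ξ ^ 2 = Real.sqrt (w ξ) ^ 3 * Real.sqrt (w ξ) := by
          linear_combination (-1 : ℝ) * (w ξ + Real.sqrt (w ξ) * Real.sqrt (w ξ)) * hs ξ
      _ ≤ Real.sqrt (w ξ) ^ 3 * 1 := by gcongr; exact hs1 ξ
      _ = _ := mul_one _
  have si : Integrable fun ξ => ‖w ξ * (jap ξ ^ 2)⁻¹‖ ^ 2 :=
    wi.mono' ((cR.norm.pow 2).aestronglyMeasurable) (Filter.Eventually.of_forall fun ξ => by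
      rw [Real.norm_of_nonneg (by positivity)]; exact hsq ξ)
  have hL := eLpNorm_two_le_of_integral_sq cR.aestronglyMeasurable si ((integral_mono si wi hsq).trans wb)
  have key : ∀ u v, ‖u‖ ≤ 1 → ‖v‖ ≤ 1 → Integrable (fun ξ => w ξ * ‖G2 u v ξ‖) ∧
      ∫ ξ, w ξ * ‖G2 u v ξ‖ ≤ Real.sqrt (C / t) * c := fun u v hu hv => by
    obtain ⟨i, bb⟩ := integral_norm_mul_le_of_eLpNorm_le cR.aestronglyMeasurable
      (hR u v).aestronglyMeasurable (Real.sqrt_nonneg _) hc hL (hRn u v hu hv)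
    have hle : ∀ ξ, w ξ * ‖G2 u v ξ‖ ≤ ‖w ξ * (jap ξ ^ 2)⁻¹‖ * ‖R u v ξ‖ := fun ξ => by
      have h1 := hw0 ξ
      have h2 := hj ξ
      rw [Real.norm_of_nonneg (by positivity), mul_assoc]
      gcongr
      exact hG2 u v ξ hu hv
    have c2 := h.cont2 u v
    have i2 := i.mono' (f := fun ξ => w ξ * ‖G2 u v ξ‖)
      (by fun_prop : Continuous fun ξ => w ξ * ‖G2 u v ξ‖).aestronglyMeasurable
      (Filter.Eventually.of_forall fun ξ => by
        rw [Real.norm_of_nonneg (mul_nonneg (hw0 ξ).le (norm_nonneg _))]; exact hle ξ)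
    exact ⟨i2, (integral_mono i2 i hle).trans bb⟩
  have b3 : ∫ ξ, w ξ * (‖G2 (e 0) (e 0) ξ‖ + ‖G2 (e 0) (e 1) ξ‖
      + (‖G2 (e 1) (e 0) ξ‖ + ‖G2 (e 1) (e 1) ξ‖)) ≤ 4 * (Real.sqrt (C / t) * c) := by
    obtain ⟨i1, l1⟩ := key (e 0) (e 0) (norm_e 0).le (norm_e 0).le
    obtain ⟨i2, l2⟩ := key (e 0) (e 1) (norm_e 0).le (norm_e 1).le
    obtain ⟨i3, l3⟩ := key (e 1) (e 0) (norm_e 1).le (norm_e 0).le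
    obtain ⟨i4, l4⟩ := key (e 1) (e 1) (norm_e 1).le (norm_e 1).le
    simp only [mul_add]
    have e1 := integral_add (i1.add i2) (i3.add i4)
    simp only [Pi.add_apply] at e1
    rw [e1, integral_add i1 i2, integral_add i3 i4]
    linarith
  refine (norm_integral_osc_le ht x h).trans ?_
  have hst : 0 < Real.sqrt t := Real.sqrt_pos.2 ht0
  calc _ ≤ 1281 * (a * (C / t)) + 83 / Real.sqrt t * (2 * b * (C / t))
        + t⁻¹ * (4 * (Real.sqrt (C / t) * c)) := by gcongr
    _ = (1281 * C * a + 166 * C * (b / Real.sqrt t) + 4 * Real.sqrt C * (c / Real.sqrt t)) / t := by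
        rw [Real.sqrt_div hC.le]; field_simp; ring
    _ ≤ _ := by
        have : 0 ≤ b / Real.sqrt t := by positivity
        have : 0 ≤ c / Real.sqrt t := by positivity
        have : 0 < Real.sqrt C := Real.sqrt_pos.2 hC
        gcongr ?_ / t
        calc _ ≤ (1281 * C + 166 * C + 4 * Real.sqrt C) * a
              + (1281 * C + 166 * C + 4 * Real.sqrt C) * (b / Real.sqrt t)
              + (1281 * C + 166 * C + 4 * Real.sqrt C) * (c / Real.sqrt t) := by
              gcongr <;> linarith
          _ = _ := by ring

/-- `p` is `C²` with derivatives of order at most two bounded by `N ⟨ξ⟩^k`. -/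
structure IsSymbol (k N : ℝ) (p : Plane → ℂ) (p1 : Plane → Plane → ℂ)
    (p2 : Plane → Plane → Plane → ℂ) : Prop where
  cont : Continuous p
  cont1 : ∀ v, Continuous (p1 v)
  cont2 : ∀ u v, Continuous (p2 u v)
  deriv1 : ∀ v ξ, HasLineDerivAt ℝ p (p1 v ξ) ξ v
  deriv2 : ∀ u v ξ, HasLineDerivAt ℝ (p1 v) (p2 u v ξ) ξ u
  bound : ∀ ξ, ‖p ξ‖ ≤ N * jap ξ ^ k
  bound1 : ∀ v ξ, ‖v‖ ≤ 1 → ‖p1 v ξ‖ ≤ N * jap ξ ^ k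
  bound2 : ∀ u v ξ, ‖u‖ ≤ 1 → ‖v‖ ≤ 1 → ‖p2 u v ξ‖ ≤ N * jap ξ ^ k

theorem IsSymbol.mul_isC2c {k N : ℝ} {p p1 p2} (hp : IsSymbol k N p p1 p2) {G G1 G2}
    (h : IsC2c G G1 G2) : IsC2c (fun ξ => p ξ * G ξ) (fun v ξ => p1 v ξ * G ξ + p ξ * G1 v ξ)
      (fun u v ξ => (p2 u v ξ * G ξ + p1 v ξ * G1 u ξ) + (p1 u ξ * G1 v ξ + p ξ * G2 u v ξ)) where
  cont := hp.cont.mul h.cont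
  cont1 v := ((hp.cont1 v).mul h.cont).add (hp.cont.mul (h.cont1 v))
  cont2 u v := (((hp.cont2 u v).mul h.cont).add ((hp.cont1 v).mul (h.cont1 u))).add
    (((hp.cont1 u).mul (h.cont1 v)).add (hp.cont.mul (h.cont2 u v)))
  supp := h.supp.mul_left
  supp1 v := h.supp.mul_left.add (h.supp1 v).mul_left
  supp2 u v := (h.supp.mul_left.add (h.supp1 u).mul_left).add
    ((h.supp1 v).mul_left.add (h.supp2 u v).mul_left)
  deriv1 v ξ := hasLineDerivAt_mul (hp.deriv1 v ξ) (h.deriv1 v ξ)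
  deriv2 u v ξ := hasLineDerivAt_add
    (hasLineDerivAt_mul (hp.deriv2 u v ξ) (h.deriv1 u ξ))
    (hasLineDerivAt_mul (hp.deriv1 u ξ) (h.deriv2 u v ξ))

set_option maxHeartbeats 1000000 in
/-- Pointwise decay `t⁻¹` of `e^{-it⟨D⟩} p(D) f`, in terms of a weighted sup norm of `f̂` and, with
a gain in time, of the weighted norms of `f`. -/
theorem exists_linear_decay {n k : ℝ} (hn : 1000 ≤ n) (hk : k = n / 100) : ∃ C : ℝ, 0 < C ∧
    ∀ (β N S : ℝ) (f : Plane → ℂ) p p1 p2, 0 ≤ β → 0 ≤ N → 0 ≤ S → ProfileBound n β f →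
    IsSymbol k N p p1 p2 → (∀ ξ, jap ξ ^ (k + 4) * ‖ft f ξ‖ ≤ S) →
    ∀ t : ℝ, 1 ≤ t → ∀ x : Plane,
      ‖∫ ξ, osc t x ξ * (p ξ * ft f ξ)‖ ≤ C * N * (S + β * t ^ (-(2 / 5) : ℝ)) / t := by
  obtain ⟨K, hK, htr⟩ := exists_trunc hn hk
  obtain ⟨D, hD, hosc⟩ := exists_norm_integral_osc_le
  obtain ⟨J, hJ, hJb⟩ := exists_eLpNorm_jap_rpow_le (s := -2) (by norm_num)
  obtain ⟨C1, hC1, hint⟩ := exists_integral_ft_le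
  set c4 : ℝ := 2 ^ (k + 4) with hc4
  have hc40 : 0 < c4 := by positivity
  refine ⟨D * (1 + c4 * K + 2 * c4 * K + c4 * K * (1 + 4 * J)) + K, by positivity,
    fun β N S f p p1 p2 hβ hN hS hf hp hF t ht x => ?_⟩
  obtain ⟨G, G1, G2, Q, hG, hsupp, bG, bG', bG1, cQ, bQ, bG2, hi, hr⟩ := htr β f hβ hf t ht
  have ht0 : 0 < t := by linarith
  have hj := fun ξ : Plane => jap_pos ξ
  have hj1 := fun ξ : Plane => one_le_jap ξ
  have hk0 : 0 ≤ k := by rw [hk]; positivity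
  set M := t ^ (2 / n) with hM
  have hM1 : 1 ≤ M := Real.one_le_rpow ht (by positivity)
  have hM0 : 0 < M := by linarith
  -- On the support of the truncation `⟨ξ⟩^k ≤ Λ⟨ξ⟩⁻⁴`. This loses only `t^{1/50 + 8/n}`, which the
  -- gain in `t` of the `β` terms absorbs.
  set Λ := (2 * M) ^ (k + 4) with hΛ
  have hΛ0 : 0 < Λ := by positivity
  have hΛt : Λ ≤ c4 * t ^ (3 / 100 : ℝ) := by
    rw [hΛ, Real.mul_rpow (by norm_num) hM0.le, ← hc4, hM, ← Real.rpow_mul ht0.le]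
    gcongr
    · rw [hk]
      have : 2 / n * (n / 100 + 4) = 1 / 50 + 8 / n := by field_simp; ring
      rw [this]
      have : 8 / n ≤ 8 / 1000 := by gcongr
      linarith
  have h50 : 1 ≤ t ^ (1 / 50 : ℝ) := Real.one_le_rpow ht (by norm_num)
  have w4 : ∀ ξ, jap ξ ≤ 2 * M → jap ξ ^ k ≤ Λ * (jap ξ ^ 4)⁻¹ := fun ξ h => by
    have := hj ξ
    rw [← div_eq_mul_inv, le_div_iff₀ (by positivity), ← Real.rpow_natCast, ← Real.rpow_add this]
    push_cast
    exact Real.rpow_le_rpow this.le h (by linarith)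
  have w2 : ∀ ξ, jap ξ ≤ 2 * M → jap ξ ^ k ≤ Λ * (jap ξ ^ 2)⁻¹ := fun ξ h => by
    refine (w4 ξ h).trans ?_
    have := hj ξ
    gcongr
    · exact hj1 ξ
    · norm_num
  set γ := K * β * t ^ (1 / 50 : ℝ) with hγ
  have hγ0 : 0 ≤ γ := by positivity
  have hγ1 : K * β ≤ γ := le_mul_of_one_le_right (by positivity) h50
  -- the main part
  have main := hosc t ht x _ _ _
    -- `Q` carries the square integrable part of the second derivatives; the bounded remainder is
    -- given `⟨ξ⟩⁻²` to become square integrable too. The sup norm `S` enters only through the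
    -- undifferentiated amplitude on the next line, which is why it suffers no loss in `t`.
    (fun u v ξ => N * Λ * (‖Q u v ξ‖ + 4 * γ * jap ξ ^ (-2 : ℝ)))
    (N * (S + Λ * (K * β * t ^ (-(3 / 2) : ℝ)))) (N * (Λ * (2 * γ)))
    (N * Λ * (K * β + 4 * γ * J)) (hp.mul_isC2c hG) (by positivity) (by positivity)
    (by positivity) (fun ξ => ?_) (fun v ξ hv => ?_) (fun u v => ?_) (fun u v hu hv => ?_)
    (fun u v ξ hu hv => ?_)
  rotate_left
  · rcases lt_or_ge (2 * M) (jap ξ) with h | h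
    · have := hj ξ
      rw [(hsupp ξ h).1, mul_zero, norm_zero]; positivity
    · have hjj := hj ξ
      rw [norm_mul]
      calc ‖p ξ‖ * ‖G ξ‖ ≤ (N * jap ξ ^ k) * (‖ft f ξ‖ + K * β * t ^ (-(3 / 2) : ℝ)) :=
            mul_le_mul (hp.bound ξ) (bG ξ) (norm_nonneg _) (by positivity)
        _ = N * (jap ξ ^ k * ‖ft f ξ‖ + jap ξ ^ k * (K * β * t ^ (-(3 / 2) : ℝ))) := by ring
        _ ≤ N * (S * (jap ξ ^ 4)⁻¹ + (Λ * (jap ξ ^ 4)⁻¹) * (K * β * t ^ (-(3 / 2) : ℝ))) := by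
            gcongr ?_ * (?_ + ?_ * _)
            · rw [← div_eq_mul_inv, le_div_iff₀ (by positivity)]
              calc jap ξ ^ k * ‖ft f ξ‖ * jap ξ ^ 4 = (jap ξ ^ k * jap ξ ^ (4 : ℝ)) * ‖ft f ξ‖ := by
                    rw [show jap ξ ^ (4 : ℝ) = jap ξ ^ 4 by norm_cast]; ring
                _ ≤ S := by rw [← Real.rpow_add hjj]; exact hF ξ
            · exact w4 ξ h
        _ = _ := by ring
  · rcases lt_or_ge (2 * M) (jap ξ) with h | h
    · have := hj ξ
      rw [(hsupp ξ h).1, (hsupp ξ h).2.1, mul_zero, mul_zero, add_zero, norm_zero]; positivity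
    · have hjj := hj ξ
      refine (norm_add_le _ _).trans ?_
      rw [norm_mul, norm_mul]
      calc _ ≤ (N * jap ξ ^ k) * γ + (N * jap ξ ^ k) * γ := by
            gcongr
            · exact hp.bound1 v ξ hv
            · exact (bG' ξ).trans hγ1
            · exact hp.bound ξ
            · exact bG1 v ξ hv
        _ = N * (jap ξ ^ k * (2 * γ)) := by ring
        _ ≤ N * ((Λ * (jap ξ ^ 4)⁻¹) * (2 * γ)) := by gcongr; exact w4 ξ h
        _ = _ := by ring
  · have h1 := cQ u v
    have h2 := continuous_jap_rpow (-2)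
    fun_prop
  · have h1 := cQ u v
    have h2 := continuous_jap_rpow (-2)
    have e1 : (fun ξ => N * Λ * (‖Q u v ξ‖ + 4 * γ * jap ξ ^ (-2 : ℝ)))
        = (N * Λ) • ((fun ξ => ‖Q u v ξ‖) + (4 * γ) • fun ξ => jap ξ ^ (-2 : ℝ)) := by
      ext ξ; simp
    rw [e1, eLpNorm_const_smul, ENNReal.ofReal_mul (by positivity), ← ofReal_norm,
      Real.norm_of_nonneg (by positivity)]
    gcongr
    refine (eLpNorm_add_le h1.norm.aestronglyMeasurable
      (h2.const_smul _).aestronglyMeasurable (by norm_num)).trans ?_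
    rw [eLpNorm_norm, eLpNorm_const_smul, ENNReal.ofReal_add (by positivity) (by positivity),
      ENNReal.ofReal_mul (p := 4 * γ) (by positivity), ← ofReal_norm,
      Real.norm_of_nonneg (by positivity : (0 : ℝ) ≤ 4 * γ)]
    gcongr
    exact bQ u v hu hv
  · have hjj := hj ξ
    rcases lt_or_ge (2 * M) (jap ξ) with h | h
    · rw [(hsupp ξ h).1, (hsupp ξ h).2.1, (hsupp ξ h).2.1, (hsupp ξ h).2.2]
      simp only [mul_zero, add_zero, norm_zero]; positivity
    · refine (norm_add_le _ _).trans ((add_le_add (norm_add_le _ _) (norm_add_le _ _)).trans ?_)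
      simp only [norm_mul (_ : ℂ)]
      calc _ ≤ ((N * jap ξ ^ k) * γ + (N * jap ξ ^ k) * γ)
            + ((N * jap ξ ^ k) * γ + (N * jap ξ ^ k) * (‖Q u v ξ‖ + γ)) := by
            gcongr
            · exact hp.bound2 u v ξ hu hv
            · exact (bG' ξ).trans hγ1
            · exact hp.bound1 v ξ hv
            · exact bG1 u ξ hu
            · exact hp.bound1 u ξ hu
            · exact bG1 v ξ hv
            · exact hp.bound ξ
            · exact bG2 u v ξ hu hv
        _ = N * (jap ξ ^ k * ‖Q u v ξ‖ + jap ξ ^ k * (4 * γ)) := by ring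
        _ ≤ N * ((Λ * (jap ξ ^ 2)⁻¹) * ‖Q u v ξ‖ + (Λ * (jap ξ ^ 4)⁻¹) * (4 * γ)) := by
            gcongr <;> [exact w2 ξ h; exact w4 ξ h]
        _ = (jap ξ ^ 2)⁻¹ * ‖N * Λ * (‖Q u v ξ‖ + 4 * γ * jap ξ ^ (-2 : ℝ))‖ := by
            rw [Real.norm_of_nonneg (by positivity), Real.rpow_neg hjj.le,
              show jap ξ ^ (2 : ℝ) = jap ξ ^ 2 by norm_cast]
            field_simp
  have cft := continuous_ft (hf.integrable hβ)
  have hcj := continuous_jap_rpow k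
  have co := continuous_osc t x
  have hpc := hp.cont
  have hGc := hG.cont
  have i2 : Integrable fun ξ => osc t x ξ * (p ξ * (ft f ξ - G ξ)) := by
    refine (hi.const_mul N).mono' (by fun_prop : Continuous fun ξ =>
      osc t x ξ * (p ξ * (ft f ξ - G ξ))).aestronglyMeasurable
      (Filter.Eventually.of_forall fun ξ => ?_)
    rw [norm_mul, norm_osc, one_mul, norm_mul, ← mul_assoc]
    gcongr
    exact hp.bound ξ
  have i1 : Integrable fun ξ => osc t x ξ * (p ξ * G ξ) :=
    (by fun_prop : Continuous fun ξ => osc t x ξ * (p ξ * G ξ)).integrable_of_hasCompactSupport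
      (hG.supp.mul_left.mul_left)
  have hsplit : ∫ ξ, osc t x ξ * (p ξ * ft f ξ) =
      (∫ ξ, osc t x ξ * (p ξ * G ξ)) + ∫ ξ, osc t x ξ * (p ξ * (ft f ξ - G ξ)) := by
    rw [← integral_add i1 i2]; congr 1; ext ξ; ring
  have rem : ‖∫ ξ, osc t x ξ * (p ξ * (ft f ξ - G ξ))‖ ≤ N * (K * β * t ^ (-(3 / 2) : ℝ)) := by
    refine (norm_integral_le_of_norm_le (hi.const_mul N) (Filter.Eventually.of_forall fun ξ => ?_)).trans ?_
    · rw [norm_mul, norm_osc, one_mul, norm_mul, ← mul_assoc]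
      gcongr
      exact hp.bound ξ
    · rw [integral_const_mul]; gcongr
  rw [hsplit]
  refine (norm_add_le _ _).trans ((add_le_add main rem).trans ?_)
  -- bookkeeping of powers of `t`
  set X := t ^ (-(2 / 5) : ℝ) with hX
  have hX0 : 0 < X := by positivity
  have rX : ∀ s : ℝ, s ≤ -(2 / 5) → t ^ s ≤ X := fun s hs =>
    Real.rpow_le_rpow_of_exponent_le ht hs
  have y1 : Λ * t ^ (-(3 / 2) : ℝ) ≤ c4 * X := by
    calc _ ≤ (c4 * t ^ (3 / 100 : ℝ)) * t ^ (-(3 / 2) : ℝ) := by gcongr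
      _ = c4 * t ^ (3 / 100 + -(3 / 2) : ℝ) := by rw [Real.rpow_add ht0]; ring
      _ ≤ _ := by gcongr; exact rX _ (by norm_num)
  have y2 : Λ * (t ^ (1 / 50 : ℝ) / Real.sqrt t) ≤ c4 * X := by
    rw [Real.sqrt_eq_rpow, div_eq_mul_inv, ← Real.rpow_neg ht0.le]
    calc _ ≤ (c4 * t ^ (3 / 100 : ℝ)) * (t ^ (1 / 50 : ℝ) * t ^ (-(1 / 2) : ℝ)) := by gcongr
      _ = c4 * t ^ (3 / 100 + (1 / 50 + -(1 / 2)) : ℝ) := by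
          rw [Real.rpow_add ht0, Real.rpow_add ht0]; ring
      _ ≤ _ := by gcongr; exact rX _ (by norm_num)
  have y3 : t ^ (-(3 / 2) : ℝ) ≤ X / t := by
    have : X / t = t ^ (-(2 / 5) + -1 : ℝ) := by
      rw [Real.rpow_add ht0, Real.rpow_neg_one, div_eq_mul_inv]
    rw [this]
    exact Real.rpow_le_rpow_of_exponent_le ht (by norm_num)
  have hst : 0 < Real.sqrt t := Real.sqrt_pos.2 ht0
  have z1 : N * (S + Λ * (K * β * t ^ (-(3 / 2) : ℝ))) ≤ N * (S + c4 * K * (β * X)) := by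
    have := mul_le_mul_of_nonneg_left y1 (by positivity : 0 ≤ K * β)
    gcongr N * (S + ?_)
    linarith
  have z2 : N * (Λ * (2 * γ)) / Real.sqrt t ≤ N * (2 * c4 * K * (β * X)) := by
    calc _ = N * (2 * K * β * (Λ * (t ^ (1 / 50 : ℝ) / Real.sqrt t))) := by rw [hγ]; ring
      _ ≤ N * (2 * K * β * (c4 * X)) := by gcongr
      _ = _ := by ring
  have z3 : N * Λ * (K * β + 4 * γ * J) / Real.sqrt t ≤ N * (c4 * K * (1 + 4 * J) * (β * X)) := by
    calc _ ≤ N * Λ * (γ + 4 * γ * J) / Real.sqrt t := by gcongr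
      _ = N * (K * β * (1 + 4 * J) * (Λ * (t ^ (1 / 50 : ℝ) / Real.sqrt t))) := by rw [hγ]; ring
      _ ≤ N * (K * β * (1 + 4 * J) * (c4 * X)) := by gcongr
      _ = _ := by ring
  have z4 : N * (K * β * t ^ (-(3 / 2) : ℝ)) ≤ K * N * (β * X) / t := by
    calc _ ≤ N * (K * β * (X / t)) := by gcongr
      _ = _ := by ring
  have hβX : 0 ≤ β * X := by positivity
  calc _ ≤ D * (N * (S + c4 * K * (β * X)) + N * (2 * c4 * K * (β * X))
          + N * (c4 * K * (1 + 4 * J) * (β * X))) / t + K * N * (β * X) / t := by gcongr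
    _ = N * (D * S + (D * (c4 * K + 2 * c4 * K + c4 * K * (1 + 4 * J)) + K) * (β * X)) / t := by ring
    _ ≤ N * ((D * (1 + c4 * K + 2 * c4 * K + c4 * K * (1 + 4 * J)) + K) * S
          + (D * (1 + c4 * K + 2 * c4 * K + c4 * K * (1 + 4 * J)) + K) * (β * X)) / t := by
        have : 0 ≤ D * (c4 * K + 2 * c4 * K + c4 * K * (1 + 4 * J)) := by positivity
        gcongr <;> nlinarith
    _ = _ := by ring

/-! ### Nonstationary phase. -/

/-- Nonstationary phase along a line: two integrations by parts. -/
theorem norm_integral_phase_le {t : ℝ} (ht : 0 < t) {v : Plane} {ψ ψ1 ψ2 ψ3 : Plane → ℝ}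
    {a a1 a2 : Plane → ℂ} (cψ : Continuous ψ) (cψ1 : Continuous ψ1) (cψ2 : Continuous ψ2)
    (cψ3 : Continuous ψ3) (d0 : ∀ ξ, HasLineDerivAt ℝ ψ (ψ1 ξ) ξ v)
    (d1 : ∀ ξ, HasLineDerivAt ℝ ψ1 (ψ2 ξ) ξ v) (d2 : ∀ ξ, HasLineDerivAt ℝ ψ2 (ψ3 ξ) ξ v)
    (hpos : ∀ ξ, 0 < ψ1 ξ) (ca : Continuous a) (ca1 : Continuous a1) (ca2 : Continuous a2)
    (sa : HasCompactSupport a) (sa1 : HasCompactSupport a1) (sa2 : HasCompactSupport a2)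
    (da : ∀ ξ, HasLineDerivAt ℝ a (a1 ξ) ξ v) (da1 : ∀ ξ, HasLineDerivAt ℝ a1 (a2 ξ) ξ v)
    {δ Λ : ℝ} (hδ : 0 < δ) (hΛ : 1 ≤ Λ)
    (hb : ∀ ξ, (a ξ = 0 ∧ a1 ξ = 0 ∧ a2 ξ = 0) ∨
      ((ψ1 ξ)⁻¹ ≤ Λ / δ ∧ |ψ2 ξ| ≤ 5 * δ ∧ |ψ3 ξ| ≤ 18 * δ)) :
    ‖∫ ξ, Complex.exp ((t * ψ ξ : ℝ) * Complex.I) * a ξ‖ ≤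
      93 * Λ ^ 4 / (t * δ) ^ 2 * ∫ ξ, (‖a ξ‖ + ‖a1 ξ‖ + ‖a2 ξ‖) := by
  set g : Plane → ℝ := fun ξ => (ψ1 ξ)⁻¹ with hg
  set g1 : Plane → ℝ := fun ξ => -ψ2 ξ * (g ξ * g ξ) with hg1
  set g2 : Plane → ℝ := fun ξ => -ψ3 ξ * (g ξ * g ξ) + 2 * (ψ2 ξ * ψ2 ξ) * (g ξ * g ξ * g ξ) with hg2
  have cg : Continuous g := cψ1.inv₀ fun ξ => (hpos ξ).ne'
  have cg1 : Continuous g1 := by fun_prop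
  have cg2 : Continuous g2 := by fun_prop
  have dg : ∀ ξ, HasLineDerivAt ℝ g (g1 ξ) ξ v := fun ξ => by
    refine hasLineDerivAt_congr_deriv (hasLineDerivAt_inv (d1 ξ) (hpos ξ).ne') ?_
    simp only [hg1, hg]; field_simp
  have dg1 : ∀ ξ, HasLineDerivAt ℝ g1 (g2 ξ) ξ v := fun ξ => by
    refine hasLineDerivAt_congr_deriv (hasLineDerivAt_mul
      (hasLineDerivAt_sub (hasLineDerivAt_const 0) (d2 ξ))
      (hasLineDerivAt_mul (dg ξ) (dg ξ)) |>.congr_of_eventuallyEq ?_) ?_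
    · exact Filter.Eventually.of_forall fun ζ => by simp [hg1]
    · simp only [hg1, hg2]; ring
  set E : Plane → ℂ := fun ξ => Complex.exp ((t * ψ ξ : ℝ) * Complex.I) with hE
  set E1 : Plane → ℂ := fun ξ => E ξ * ((t * ψ1 ξ : ℝ) * Complex.I) with hE1
  have cE : Continuous E := by fun_prop
  have cE1 : Continuous E1 := by fun_prop
  have dE : ∀ ξ, HasLineDerivAt ℝ E (E1 ξ) ξ v := fun ξ => by
    refine hasLineDerivAt_cexp (hasLineDerivAt_congr_deriv
      (hasLineDerivAt_mul (hasLineDerivAt_const t) (d0 ξ)) ?_)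
    ring
  -- one integration by parts
  have step : ∀ b b1 : Plane → ℂ, Continuous b → Continuous b1 → HasCompactSupport b →
      HasCompactSupport b1 → (∀ ξ, HasLineDerivAt ℝ b (b1 ξ) ξ v) →
      ∫ ξ, E ξ * (g1 ξ * b ξ + g ξ * b1 ξ) = -(t * Complex.I * ∫ ξ, E ξ * b ξ) := by
    intro b b1 cb cb1 sb sb1 db
    rw [integral_mul_lineDeriv cE cE1 (g := fun ξ => g ξ * b ξ)
      (g' := fun ξ => g1 ξ * b ξ + g ξ * b1 ξ) (by fun_prop) (by fun_prop) sb.mul_left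
      (sb.mul_left.add sb1.mul_left) dE
      (fun ξ => hasLineDerivAt_mul (hasLineDerivAt_ofReal (dg ξ)) (db ξ)), ← integral_const_mul]
    congr 2; ext ξ
    have : (ψ1 ξ : ℂ) ≠ 0 := by exact_mod_cast (hpos ξ).ne'
    simp only [hE1, hg]; push_cast; field_simp
  set b : Plane → ℂ := fun ξ => g1 ξ * a ξ + g ξ * a1 ξ with hbdef
  set b1 : Plane → ℂ := fun ξ => (g2 ξ * a ξ + g1 ξ * a1 ξ) + (g1 ξ * a1 ξ + g ξ * a2 ξ) with hb1
  have s1 := step a a1 ca ca1 sa sa1 da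
  have s2 := step b b1 (by fun_prop) (by fun_prop) (sa.mul_left.add sa1.mul_left)
    ((sa.mul_left.add sa1.mul_left).add (sa1.mul_left.add sa2.mul_left))
    (fun ξ => hasLineDerivAt_add
      (hasLineDerivAt_mul (hasLineDerivAt_ofReal (dg1 ξ)) (da ξ))
      (hasLineDerivAt_mul (hasLineDerivAt_ofReal (dg ξ)) (da1 ξ)))
  have s3 : (t : ℂ) ^ 2 * ∫ ξ, E ξ * a ξ = -∫ ξ, E ξ * (g1 ξ * b ξ + g ξ * b1 ξ) := by
    rw [s2, s1]; linear_combination ((t : ℂ) ^ 2 * ∫ ξ, E ξ * a ξ) * Complex.I_sq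
  have ia : Integrable fun ξ => ‖a ξ‖ := (ca.integrable_of_hasCompactSupport sa).norm
  have ia1 : Integrable fun ξ => ‖a1 ξ‖ := (ca1.integrable_of_hasCompactSupport sa1).norm
  have ia2 : Integrable fun ξ => ‖a2 ξ‖ := (ca2.integrable_of_hasCompactSupport sa2).norm
  -- After two integrations by parts the coefficients of `a`, `a1`, `a2` are `g1² + g g2`, `3 g g1`
  -- and `g²`, with `g = 1/ψ1`. The first is the worst: `93 = 5·5 + (18 + 50)`, with powers of `Λ ≥
  -- 1` raised to the fourth.
  have hpt : ∀ ξ, ‖E ξ * (g1 ξ * b ξ + g ξ * b1 ξ)‖ ≤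
      93 * Λ ^ 4 / δ ^ 2 * (‖a ξ‖ + ‖a1 ξ‖ + ‖a2 ξ‖) := fun ξ => by
    rw [norm_mul, hE, Complex.norm_exp_ofReal_mul_I, one_mul]
    rcases hb ξ with ⟨z0, z1, z2⟩ | ⟨h1, h2, h3⟩
    · simp [hbdef, hb1, z0, z1, z2]
    · have g0 : 0 ≤ g ξ := inv_nonneg.2 (hpos ξ).le
      change g ξ ≤ Λ / δ at h1
      have q1 : |g1 ξ| ≤ 5 * Λ ^ 2 / δ := by
        rw [hg1, abs_mul, abs_neg, abs_of_nonneg (mul_nonneg g0 g0)]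
        calc _ ≤ 5 * δ * (Λ / δ * (Λ / δ)) := by gcongr
          _ = _ := by field_simp
      have q2 : |g2 ξ| ≤ 68 * Λ ^ 3 / δ := by
        refine (abs_add_le _ _).trans ?_
        rw [abs_mul, abs_neg, abs_of_nonneg (mul_nonneg g0 g0), abs_mul, abs_mul, abs_mul,
          abs_of_nonneg (mul_nonneg (mul_nonneg g0 g0) g0), abs_of_pos (by norm_num : (0 : ℝ) < 2)]
        calc _ ≤ 18 * δ * (Λ / δ * (Λ / δ))
              + 2 * (5 * δ * (5 * δ)) * (Λ / δ * (Λ / δ) * (Λ / δ)) := by gcongr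
          _ = (18 * Λ ^ 2 + 50 * Λ ^ 3) / δ := by field_simp; ring
          _ ≤ (18 * Λ ^ 3 + 50 * Λ ^ 3) / δ := by gcongr; norm_num
          _ = _ := by ring
      have e : (g1 ξ : ℂ) * b ξ + g ξ * b1 ξ = ((g1 ξ * g1 ξ + g ξ * g2 ξ : ℝ) : ℂ) * a ξ
          + ((3 * (g ξ * g1 ξ) : ℝ) : ℂ) * a1 ξ + ((g ξ * g ξ : ℝ) : ℂ) * a2 ξ := by
        simp only [hbdef, hb1]; push_cast; ring
      rw [e]
      refine (norm_add₃_le).trans ?_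
      simp only [norm_mul (_ : ℂ), Complex.norm_real, Real.norm_eq_abs]
      have r1 : |g1 ξ * g1 ξ + g ξ * g2 ξ| ≤ 93 * Λ ^ 4 / δ ^ 2 := by
        refine (abs_add_le _ _).trans ?_
        rw [abs_mul (g1 ξ), abs_mul (g ξ), abs_of_nonneg g0]
        calc _ ≤ (5 * Λ ^ 2 / δ) * (5 * Λ ^ 2 / δ) + Λ / δ * (68 * Λ ^ 3 / δ) := by gcongr
          _ = _ := by field_simp; ring
      have r2 : |3 * (g ξ * g1 ξ)| ≤ 93 * Λ ^ 4 / δ ^ 2 := by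
        rw [abs_mul, abs_mul, abs_of_nonneg g0, abs_of_pos (by norm_num : (0 : ℝ) < 3)]
        calc _ ≤ 3 * (Λ / δ * (5 * Λ ^ 2 / δ)) := by gcongr
          _ = 15 * Λ ^ 3 / δ ^ 2 := by field_simp; ring
          _ ≤ _ := by gcongr <;> first | exact hΛ | norm_num
      have r3 : |g ξ * g ξ| ≤ 93 * Λ ^ 4 / δ ^ 2 := by
        rw [abs_of_nonneg (mul_nonneg g0 g0)]
        calc _ ≤ Λ / δ * (Λ / δ) := by gcongr
          _ = 1 * Λ ^ 2 / δ ^ 2 := by field_simp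
          _ ≤ _ := by gcongr <;> first | exact hΛ | norm_num
      calc _ ≤ 93 * Λ ^ 4 / δ ^ 2 * ‖a ξ‖ + 93 * Λ ^ 4 / δ ^ 2 * ‖a1 ξ‖
            + 93 * Λ ^ 4 / δ ^ 2 * ‖a2 ξ‖ := by gcongr
        _ = _ := by ring
  have s4 : t ^ 2 * ‖∫ ξ, E ξ * a ξ‖ ≤ 93 * Λ ^ 4 / δ ^ 2 * ∫ ξ, (‖a ξ‖ + ‖a1 ξ‖ + ‖a2 ξ‖) := by
    have : t ^ 2 * ‖∫ ξ, E ξ * a ξ‖ = ‖(t : ℂ) ^ 2 * ∫ ξ, E ξ * a ξ‖ := by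
      rw [norm_mul, norm_pow, Complex.norm_real, Real.norm_of_nonneg ht.le]
    rw [this, s3, norm_neg, ← integral_const_mul]
    exact norm_integral_le_of_norm_le (((ia.add ia1).add ia2).const_mul _)
      (Filter.Eventually.of_forall hpt)
  rw [show 93 * Λ ^ 4 / (t * δ) ^ 2 * ∫ ξ, (‖a ξ‖ + ‖a1 ξ‖ + ‖a2 ξ‖) =
    (93 * Λ ^ 4 / δ ^ 2 * ∫ ξ, (‖a ξ‖ + ‖a1 ξ‖ + ‖a2 ξ‖)) / t ^ 2 by field_simp,
    le_div_iff₀ (by positivity), mul_comm]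
  exact s4

/-! ### Increments of the Japanese bracket -/

theorem abs_inv_jap_sub_le (ξ η : Plane) : |(jap (ξ + η))⁻¹ - (jap ξ)⁻¹| ≤ ‖η‖ := by
  have hA := jap_pos (ξ + η)
  have hB := jap_pos ξ
  have h := abs_jap_sub_le (ξ + η) ξ
  rw [add_sub_cancel_left] at h
  rw [inv_sub_inv hA.ne' hB.ne', abs_div, abs_of_pos (mul_pos hA hB), abs_sub_comm]
  refine (div_le_self (abs_nonneg _) ?_).trans h
  nlinarith [one_le_jap (ξ + η), one_le_jap ξ]

theorem abs_djap_sub_le {v : Plane} (hv : ‖v‖ = 1) (ξ η : Plane) :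
    |djap v (ξ + η) - djap v ξ| ≤ 2 * ‖η‖ := by
  have hA := jap_pos (ξ + η)
  have hB := jap_pos ξ
  have h := abs_jap_sub_le (ξ + η) ξ
  rw [add_sub_cancel_left] at h
  have h1 : djap v (ξ + η) - djap v ξ =
      (inner ℝ η v - djap v ξ * (jap (ξ + η) - jap ξ)) * (jap (ξ + η))⁻¹ := by
    simp only [djap, inner_add_left]; field_simp; ring
  rw [h1, abs_mul, abs_of_pos (inv_pos.2 hA)]
  calc _ ≤ (|inner ℝ η v| + |djap v ξ| * |jap (ξ + η) - jap ξ|) * 1 := by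
        rw [← abs_mul]; gcongr
        · exact abs_sub _ _
        · exact inv_jap_le_one _
    _ ≤ (‖η‖ * ‖v‖ + ‖v‖ * ‖η‖) * 1 := by
        gcongr
        · exact abs_real_inner_le_norm _ _
        · exact abs_djap_le _ _
    _ = _ := by rw [hv]; ring

/-- With `x` the derivative of the bracket along `v` and `w = ⟨ξ⟩⁻¹`, the second derivative is `(1 -
x²)w`: a polynomial in two bounded Lipschitz quantities. The third derivative below is `-3x(1 -
x²)w²` and is treated the same way. These bounds make the higher derivatives of `⟨σ⟩ - ⟨σ+η⟩` as
small as `|η|`, matching the lower bound for the first. -/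
theorem abs_ddjap_sub_le {v : Plane} (hv : ‖v‖ = 1) (ξ η : Plane) :
    |ddjap v v (ξ + η) - ddjap v v ξ| ≤ 5 * ‖η‖ := by
  have h1 := abs_djap_sub_le hv ξ η
  have h2 := abs_inv_jap_sub_le ξ η
  have hx := abs_djap_le v (ξ + η)
  have hy := abs_djap_le v ξ
  have hw := inv_jap_le_one (ξ + η)
  have hw0 := inv_pos.2 (jap_pos (ξ + η))
  simp only [ddjap, real_inner_self_eq_norm_sq, hv] at *
  generalize djap v (ξ + η) = x at *
  generalize djap v ξ = y at *
  generalize (jap (ξ + η))⁻¹ = w at *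
  generalize (jap ξ)⁻¹ = z at *
  have e : (1 ^ 2 - x * x) * w - (1 ^ 2 - y * y) * z =
      -((x - y) * (x + y) * w) + (1 - y * y) * (w - z) := by ring
  have hxy : |x + y| ≤ 2 := (abs_add_le _ _).trans (by linarith)
  have hyy : |1 - y * y| ≤ 1 := by
    rw [abs_le] at hy ⊢; constructor <;> nlinarith
  rw [e]
  refine (abs_add_le _ _).trans ?_
  rw [abs_neg, abs_mul, abs_mul, abs_mul (1 - y * y), abs_of_pos hw0]
  calc _ ≤ 2 * ‖η‖ * 2 * 1 + 1 * ‖η‖ := by gcongr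
    _ = _ := by ring

theorem abs_dddjap_sub_le {v : Plane} (hv : ‖v‖ = 1) (ξ η : Plane) :
    |dddjap v v v (ξ + η) - dddjap v v v ξ| ≤ 18 * ‖η‖ := by
  have h1 := abs_djap_sub_le hv ξ η
  have h2 := abs_inv_jap_sub_le ξ η
  have hx := abs_djap_le v (ξ + η)
  have hy := abs_djap_le v ξ
  have hw := inv_jap_le_one (ξ + η)
  have hw0 := inv_pos.2 (jap_pos (ξ + η))
  have hz := inv_jap_le_one ξ
  have hz0 := inv_pos.2 (jap_pos ξ)
  simp only [dddjap, ddjap, real_inner_self_eq_norm_sq, hv] at *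
  generalize djap v (ξ + η) = x at *
  generalize djap v ξ = y at *
  generalize (jap (ξ + η))⁻¹ = w at *
  generalize (jap ξ)⁻¹ = z at *
  have e : -((1 ^ 2 - x * x) * w * x + x * ((1 ^ 2 - x * x) * w) + (1 ^ 2 - x * x) * w * x) * w -
      -((1 ^ 2 - y * y) * z * y + y * ((1 ^ 2 - y * y) * z) + (1 ^ 2 - y * y) * z * y) * z =
      -(3 * ((x - y) * (1 - (x * x + x * y + y * y)) * (w * w)
        + y * (1 - y * y) * ((w - z) * (w + z)))) := by ring
  rw [abs_le] at hx hy
  have k1 : |1 - (x * x + x * y + y * y)| ≤ 2 := by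
    rw [abs_le]; constructor <;> nlinarith [sq_nonneg (x + y), sq_nonneg (x - y)]
  have k2 : |y * (1 - y * y)| ≤ 1 := by
    rw [abs_le]; constructor <;> nlinarith [mul_nonneg (by linarith : 0 ≤ 1 - y) (by linarith : 0 ≤ 1 + y)]
  have k3 : |w + z| ≤ 2 := by rw [abs_of_pos (by linarith)]; linarith
  rw [e, abs_neg, abs_mul, abs_of_pos (by norm_num : (0 : ℝ) < 3)]
  calc _ ≤ 3 * (|x - y| * |1 - (x * x + x * y + y * y)| * |w * w|
        + |y * (1 - y * y)| * (|w - z| * |w + z|)) := by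
        rw [← abs_mul, ← abs_mul, ← abs_mul, ← abs_mul]; gcongr; exact abs_add_le _ _
    _ ≤ 3 * (2 * ‖η‖ * 2 * 1 + 1 * (‖η‖ * 2)) := by
        gcongr
        rw [abs_of_pos (by positivity)]
        exact mul_le_one₀ hw hw0.le hw
    _ = _ := by ring

/-- The velocity is strictly monotone, quantitatively. -/
theorem le_djap_sub {η : Plane} (hη : η ≠ 0) (ξ : Plane) :
    ‖η‖ / (jap (ξ + η) * jap ξ) ^ 2 ≤ djap (‖η‖⁻¹ • η) (ξ + η) - djap (‖η‖⁻¹ • η) ξ := by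
  have hA := jap_pos (ξ + η)
  have hB := jap_pos ξ
  have hA1 := one_le_jap (ξ + η)
  have hB1 := one_le_jap ξ
  have hd : 0 < ‖η‖ := norm_pos_iff.2 hη
  have hAs := jap_sq (ξ + η)
  have hBs := jap_sq ξ
  rw [norm_add_sq_real] at hAs
  have hcs := real_inner_mul_inner_self_le ξ η
  rw [real_inner_self_eq_norm_sq, real_inner_self_eq_norm_sq] at hcs
  simp only [djap, inner_smul_right, inner_add_left, real_inner_self_eq_norm_sq]
  generalize jap (ξ + η) = A at *
  generalize jap ξ = B at *
  generalize inner ℝ ξ η = s at *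
  generalize ‖η‖ = d at *
  generalize ‖ξ‖ = b at *
  -- `P = AB - 1 - a·b` with `a·b = b² + s`
  have hprod : d ^ 2 ≤ (A * B - 1 - (b ^ 2 + s)) * (A * B + 1 + (b ^ 2 + s)) := by
    have : (A * B) ^ 2 = (1 + (b ^ 2 + 2 * s + d ^ 2)) * (1 + b ^ 2) := by rw [mul_pow, hAs, hBs]
    nlinarith
  have habs : (1 + (b ^ 2 + s)) ^ 2 ≤ (A * B) ^ 2 := by
    nlinarith [sq_nonneg d, (by rw [mul_pow, hAs, hBs] : (A * B) ^ 2 = (1 + (b ^ 2 + 2 * s + d ^ 2)) * (1 + b ^ 2))]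
  have hAB : 0 < A * B := mul_pos hA hB
  have h1 := abs_le_of_sq_le_sq' habs hAB.le
  -- From `(AB)² - (1 + ξ·(ξ+η))² = |η|² + |ξ|²|η|² - (ξ·η)²`, Cauchy–Schwarz bounds the difference
  -- of squares below by `|η|²`; its larger factor is at most `2AB`.
  have hP : d ^ 2 ≤ (A * B - 1 - (b ^ 2 + s)) * (2 * (A * B)) := by
    refine hprod.trans (mul_le_mul_of_nonneg_left (by linarith) (by linarith))
  have e : (d⁻¹ * (s + d ^ 2)) * A⁻¹ - (d⁻¹ * s) * B⁻¹ =
      (A + B) * (A * B - 1 - (b ^ 2 + s)) / (A * B * d) := by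
    field_simp
    linear_combination (-B) * hAs + (-A) * hBs
  rw [e, div_le_div_iff₀ (by positivity) (by positivity)]
  have hP0 : 0 ≤ A * B - 1 - (b ^ 2 + s) := by linarith
  calc d * (A * B * d) = d ^ 2 * (A * B) := by ring
    _ ≤ (A * B - 1 - (b ^ 2 + s)) * (2 * (A * B)) * (A * B) := by gcongr
    _ = 2 * (A * B - 1 - (b ^ 2 + s)) * (A * B) ^ 2 := by ring
    _ ≤ (A + B) * (A * B - 1 - (b ^ 2 + s)) * (A * B) ^ 2 := by gcongr; linarith

/-! ### Autocorrelations -/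

/-- The cross-correlation `∫ U(σ + η) conj V(σ) dσ`. -/
noncomputable def corr (U V : Plane → ℂ) (η : Plane) : ℂ :=
  ∫ σ, U (σ + η) * (starRingEnd ℂ) (V σ)

theorem integrable_corr_prod {U V : Plane → ℂ} (hU : Integrable U) (hV : Integrable V) :
    Integrable (fun z : Plane × Plane => U (z.2 + z.1) * (starRingEnd ℂ) (V z.2))
      (volume.prod volume) := by
  have hV' : Integrable (fun σ => (starRingEnd ℂ) (V σ)) :=
    hV.congr' (Complex.continuous_conj.comp_aestronglyMeasurable hV.1)
      (Filter.Eventually.of_forall fun x => by simp)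
  have h := (measurePreserving_add_prod (volume : Measure Plane) volume).integrable_comp_of_integrable
    (hU.mul_prod hV')
  refine h.congr (Filter.Eventually.of_forall fun z => ?_)
  simp [add_comm]

theorem integrable_corr {U V : Plane → ℂ} (hU : Integrable U) (hV : Integrable V) :
    Integrable (corr U V) :=
  (integrable_corr_prod hU hV).integral_prod_left

theorem integral_norm_corr_le {U V : Plane → ℂ} (hU : Integrable U) (hV : Integrable V) :
    ∫ η, ‖corr U V η‖ ≤ (∫ ξ, ‖U ξ‖) * ∫ ξ, ‖V ξ‖ := by
  have h := integrable_corr_prod hU hV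
  calc ∫ η, ‖corr U V η‖ ≤ ∫ η, ∫ σ, ‖U (σ + η)‖ * ‖V σ‖ := by
        refine integral_mono (integrable_corr hU hV).norm ?_ fun η => ?_
        · have := h.norm.integral_prod_left
          simpa using this
        · refine (norm_integral_le_integral_norm _).trans (le_of_eq ?_)
          simp
    _ = ∫ σ, ∫ η, ‖U (σ + η)‖ * ‖V σ‖ := by
        rw [integral_integral_swap]
        simpa [Function.uncurry_def] using h.norm
    _ = ∫ σ, (∫ ξ, ‖U ξ‖) * ‖V σ‖ := by
        congr 1; ext σ
        rw [integral_mul_const, integral_add_left_eq_self (fun η => ‖U η‖) σ]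
    _ = _ := integral_const_mul _ _

theorem integrable_corr_integrand {U V : Plane → ℂ} (cU : Continuous U) {a : ℝ} (hb : ∀ ξ, ‖U ξ‖ ≤ a)
    (hV : Integrable V) (η : Plane) : Integrable fun σ => U (σ + η) * (starRingEnd ℂ) (V σ) := by
  refine (hV.norm.const_mul a).mono' ((cU.comp (continuous_add_const η)).aestronglyMeasurable.mul
    (Complex.continuous_conj.comp_aestronglyMeasurable hV.1)) (Filter.Eventually.of_forall fun σ => ?_)
  rw [norm_mul, RCLike.norm_conj]
  gcongr
  exact hb _

theorem norm_corr_le {U V : Plane → ℂ} {a : ℝ} (hb : ∀ ξ, ‖U ξ‖ ≤ a) (hV : Integrable V)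
    (η : Plane) : ‖corr U V η‖ ≤ a * ∫ ξ, ‖V ξ‖ := by
  rw [corr, ← integral_const_mul]
  refine norm_integral_le_of_norm_le (hV.norm.const_mul a) (Filter.Eventually.of_forall fun σ => ?_)
  rw [norm_mul, RCLike.norm_conj]
  gcongr
  exact hb _

/-- The Fourier counterpart of `|u|²` being real; the cancellation in `im_integral_eq_zero` rests on
it. -/
theorem corr_neg (U : Plane → ℂ) (η : Plane) : corr U U (-η) = (starRingEnd ℂ) (corr U U η) := by
  rw [corr, corr, ← integral_conj, ← integral_add_right_eq_self _ η]
  congr 1; ext σ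
  simp [mul_comm]

theorem norm_corr_le' {U V : Plane → ℂ} {a : ℝ} (hU : Integrable U) (hb : ∀ ξ, ‖V ξ‖ ≤ a)
    (η : Plane) : ‖corr U V η‖ ≤ a * ∫ ξ, ‖U ξ‖ := by
  rw [corr, ← integral_add_right_eq_self (fun ξ => ‖U ξ‖) η, ← integral_const_mul]
  refine norm_integral_le_of_norm_le (((measurePreserving_add_right volume η).integrable_comp_of_integrable
    hU).norm.const_mul a) (Filter.Eventually.of_forall fun σ => ?_)
  rw [norm_mul, RCLike.norm_conj, mul_comm]
  exact mul_le_mul_of_nonneg_right (hb _) (norm_nonneg _)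

/-- Bilinearity in a form suited to truncation: each term contains one factor `U - W`, which is
small in `L¹`. -/
theorem corr_sub_corr {U W : Plane → ℂ} (cU : Continuous U) (cW : Continuous W) {a b : ℝ}
    (hU : ∀ ξ, ‖U ξ‖ ≤ a) (hW : ∀ ξ, ‖W ξ‖ ≤ b) (iU : Integrable U) (iW : Integrable W) (η : Plane) :
    corr U U η - corr W W η = corr (fun ξ => U ξ - W ξ) U η + corr W (fun ξ => U ξ - W ξ) η := by
  have h1 := integrable_corr_integrand (cU.sub cW)
    (fun ξ => (norm_sub_le _ _).trans (add_le_add (hU ξ) (hW ξ))) iU η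
  have h2 := integrable_corr_integrand cW hW (iU.sub iW) η
  simp only [Pi.sub_apply] at h1 h2
  simp only [corr]
  rw [← integral_sub (integrable_corr_integrand cU hU iU η) (integrable_corr_integrand cW hW iW η),
    ← integral_add h1 h2]
  congr 1; ext σ
  simp only [map_sub]; ring

/-! ### Radial integrals -/

theorem exists_integral_norm_rpow_lt {s : ℝ} (hs : -2 < s) : ∃ C : ℝ, 0 < C ∧ ∀ r : ℝ, 0 < r →
    IntegrableOn (fun η : Plane => ‖η‖ ^ s) {η | ‖η‖ < r} ∧
    ∫ η in {η : Plane | ‖η‖ < r}, ‖η‖ ^ s ≤ C * r ^ (s + 2) := by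
  refine ⟨2 * volume.real (Metric.ball (0 : Plane) 1) / (s + 2) + 1, ?_, fun r hr => ?_⟩
  · have : 0 < s + 2 := by linarith
    positivity
  have hs2 : 0 < s + 2 := by linarith
  have hm : MeasurableSet {η : Plane | ‖η‖ < r} := measurableSet_lt measurable_norm measurable_const
  set f : ℝ → ℝ := (Iio r).indicator fun y => y ^ s with hf
  have hind : ({η : Plane | ‖η‖ < r}.indicator fun η : Plane => ‖η‖ ^ s) = fun η => f ‖η‖ := by
    ext η; simp [hf, indicator]
  have hprod : EqOn (fun y : ℝ => y ^ (2 - 1) • f y) ((Iio r).indicator fun y => y ^ (s + 1)) (Ioi 0) := by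
    intro y hy
    by_cases h : y < r
    · simp only [hf, smul_eq_mul, indicator_of_mem (mem_Iio.2 h)]
      rw [Real.rpow_add hy, Real.rpow_one]; ring
    · simp [hf, h]
  have hset : Iio r ∩ Ioi 0 = Ioo 0 r := by ext y; simp [and_comm]
  have hint : IntegrableOn (fun y : ℝ => y ^ (s + 1)) (Ioo 0 r) :=
    (intervalIntegral.intervalIntegrable_rpow' (by linarith : -1 < s + 1)).1.mono_set
      Ioo_subset_Ioc_self
  rw [← integrable_indicator_iff hm, ← integral_indicator hm, hind]
  refine ⟨?_, ?_⟩
  · rw [integrable_fun_norm_addHaar volume, finrank_plane,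
      integrableOn_congr_fun hprod measurableSet_Ioi, IntegrableOn,
      integrable_indicator_iff measurableSet_Iio, IntegrableOn,
      Measure.restrict_restrict measurableSet_Iio, hset]
    exact hint
  · rw [integral_fun_norm_addHaar volume f, finrank_plane,
      setIntegral_congr_fun measurableSet_Ioi hprod, setIntegral_indicator measurableSet_Iio,
      inter_comm, hset, ← integral_Ioc_eq_integral_Ioo, ← intervalIntegral.integral_of_le hr.le,
      integral_rpow (Or.inl (by linarith)), Real.zero_rpow (by linarith)]
    simp only [nsmul_eq_mul, smul_eq_mul, sub_zero]
    rw [show s + 1 + 1 = s + 2 by ring]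
    have : 0 < r ^ (s + 2) := by positivity
    have e : ((2 : ℕ) : ℝ) * (volume.real (Metric.ball (0 : Plane) 1) * (r ^ (s + 2) / (s + 2)))
      = 2 * volume.real (Metric.ball (0 : Plane) 1) / (s + 2) * r ^ (s + 2) := by push_cast; ring
    rw [e]
    gcongr
    linarith

theorem exists_integral_norm_rpow_ge {s : ℝ} (hs : s < -2) : ∃ C : ℝ, 0 < C ∧ ∀ r : ℝ, 0 < r →
    IntegrableOn (fun η : Plane => ‖η‖ ^ s) {η | r ≤ ‖η‖} ∧
    ∫ η in {η : Plane | r ≤ ‖η‖}, ‖η‖ ^ s ≤ C * r ^ (s + 2) := by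
  have hs2 : 0 < -(s + 2) := by linarith
  refine ⟨2 * volume.real (Metric.ball (0 : Plane) 1) / (-(s + 2)) + 1, by positivity, fun r hr => ?_⟩
  have hm : MeasurableSet {η : Plane | r ≤ ‖η‖} := measurableSet_le measurable_const measurable_norm
  set f : ℝ → ℝ := (Ici r).indicator fun y => y ^ s with hf
  have hind : ({η : Plane | r ≤ ‖η‖}.indicator fun η : Plane => ‖η‖ ^ s) = fun η => f ‖η‖ := by
    ext η; simp [hf, indicator]
  have hprod : EqOn (fun y : ℝ => y ^ (2 - 1) • f y) ((Ici r).indicator fun y => y ^ (s + 1)) (Ioi 0) := by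
    intro y hy
    by_cases h : r ≤ y
    · simp only [hf, smul_eq_mul, indicator_of_mem (mem_Ici.2 h)]
      rw [Real.rpow_add hy, Real.rpow_one]; ring
    · simp [hf, h]
  have hset : Ici r ∩ Ioi 0 = Ici r := inter_eq_left.2 fun y hy => hr.trans_le hy
  have hint : IntegrableOn (fun y : ℝ => y ^ (s + 1)) (Ici r) :=
    (integrableOn_Ici_iff_integrableOn_Ioi).2 (integrableOn_Ioi_rpow_of_lt (by linarith) hr)
  rw [← integrable_indicator_iff hm, ← integral_indicator hm, hind]
  refine ⟨?_, ?_⟩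
  · rw [integrable_fun_norm_addHaar volume, finrank_plane,
      integrableOn_congr_fun hprod measurableSet_Ioi, IntegrableOn,
      integrable_indicator_iff measurableSet_Ici, IntegrableOn,
      Measure.restrict_restrict measurableSet_Ici, hset]
    exact hint
  · rw [integral_fun_norm_addHaar volume f, finrank_plane,
      setIntegral_congr_fun measurableSet_Ioi hprod, setIntegral_indicator measurableSet_Ici,
      inter_comm, hset, integral_Ici_eq_integral_Ioi, integral_Ioi_rpow_of_lt (by linarith) hr]
    simp only [nsmul_eq_mul, smul_eq_mul]
    rw [show s + 1 + 1 = s + 2 by ring]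
    have : 0 < r ^ (s + 2) := by positivity
    have e : ((2 : ℕ) : ℝ) * (volume.real (Metric.ball (0 : Plane) 1) * (-r ^ (s + 2) / (s + 2)))
      = 2 * volume.real (Metric.ball (0 : Plane) 1) / (-(s + 2)) * r ^ (s + 2) := by
      push_cast; rw [div_neg, neg_div]; ring
    rw [e]
    gcongr
    linarith

/-! ### Decay of the autocorrelation of a free evolution. -/

/-- The symbol `e^{-it⟨ξ⟩}` of the free evolution. -/
noncomputable def phase (t : ℝ) (ξ : Plane) : ℂ := Complex.exp ((-(t * jap ξ) : ℝ) * Complex.I)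

theorem norm_phase (t : ℝ) (ξ : Plane) : ‖phase t ξ‖ = 1 := Complex.norm_exp_ofReal_mul_I _

theorem continuous_phase (t : ℝ) : Continuous (phase t) := by
  have := continuous_jap (E := Plane)
  unfold phase; fun_prop

theorem phase_mul_conj (t : ℝ) (σ η : Plane) : phase t (σ + η) * (starRingEnd ℂ) (phase t σ) =
    Complex.exp ((t * (jap σ - jap (σ + η)) : ℝ) * Complex.I) := by
  rw [phase, phase, ← Complex.exp_conj, ← Complex.exp_add]
  congr 1
  simp only [map_mul, Complex.conj_ofReal, Complex.conj_I]
  push_cast; ring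

theorem hasLineDerivAt_shift {E : Type*} [NormedAddCommGroup E] [NormedSpace ℝ E] {f : Plane → E}
    {f' : E} {ξ v : Plane} (η : Plane) (h : HasLineDerivAt ℝ f f' (ξ + η) v) :
    HasLineDerivAt ℝ (fun ζ => f (ζ + η)) f' ξ v := by
  have : (fun s : ℝ => f (ξ + s • v + η)) = fun s => f (ξ + η + s • v) := by
    ext s; rw [add_right_comm]
  rw [HasLineDerivAt, this]; exact h

theorem hasLineDerivAt_conj {f : Plane → ℂ} {f' : ℂ} {ξ v : Plane} (h : HasLineDerivAt ℝ f f' ξ v) :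
    HasLineDerivAt ℝ (fun ζ => (starRingEnd ℂ) (f ζ)) ((starRingEnd ℂ) f') ξ v :=
  HasDerivAt.star h

/-- The integrand of the correlation oscillates with phase `t(⟨σ⟩ - ⟨σ+η⟩)`. Along `v = -η/|η|` its
derivative is positive, and at least `t|η|/L⁴` on the support by `le_djap_sub`, while its higher
derivatives are `O(t|η|)`. Hence `norm_integral_phase_le` applies with `δ = |η|` and `Λ = L⁴`. -/
theorem norm_corr_phase_le {t : ℝ} (ht : 0 < t) {G : Plane → ℂ} {G1 : Plane → Plane → ℂ}
    {G2 : Plane → Plane → Plane → ℂ} (h : IsC2c G G1 G2) {L : ℝ} (hL : 1 ≤ L)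
    (hsupp : ∀ ξ, L < jap ξ → G ξ = 0 ∧ (∀ v, G1 v ξ = 0) ∧ ∀ u v, G2 u v ξ = 0)
    {η : Plane} (hη : η ≠ 0) : ∃ v : Plane, ‖v‖ = 1 ∧
    ‖corr (fun ξ => phase t ξ * G ξ) (fun ξ => phase t ξ * G ξ) η‖ ≤
      93 * (L ^ 4) ^ 4 / (t * ‖η‖) ^ 2 * ∫ σ,
        (‖G (σ + η) * (starRingEnd ℂ) (G σ)‖
        + ‖G1 v (σ + η) * (starRingEnd ℂ) (G σ) + G (σ + η) * (starRingEnd ℂ) (G1 v σ)‖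
        + ‖(G2 v v (σ + η) * (starRingEnd ℂ) (G σ) + G1 v (σ + η) * (starRingEnd ℂ) (G1 v σ))
          + (G1 v (σ + η) * (starRingEnd ℂ) (G1 v σ) + G (σ + η) * (starRingEnd ℂ) (G2 v v σ))‖) := by
  have hη0 : 0 < ‖η‖ := norm_pos_iff.2 hη
  set v : Plane := -(‖η‖⁻¹ • η) with hv
  have hv1 : ‖v‖ = 1 := by
    rw [hv, norm_neg, norm_smul, norm_inv, norm_norm, inv_mul_cancel₀ hη0.ne']
  refine ⟨v, hv1, ?_⟩
  have hdv : ∀ ξ, djap v ξ = -djap (‖η‖⁻¹ • η) ξ := fun ξ => by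
    simp only [djap, hv, inner_neg_right]; ring
  have hlow : ∀ ξ, ‖η‖ / (jap (ξ + η) * jap ξ) ^ 2 ≤ djap v ξ - djap v (ξ + η) := fun ξ => by
    have := le_djap_sub hη ξ
    rw [hdv, hdv]; linarith
  have cs : Continuous fun σ : Plane => σ + η := continuous_add_const η
  have cj := continuous_jap (E := Plane)
  have cj1 := continuous_djap v
  have cj2 := continuous_ddjap v v
  have cj3 := continuous_dddjap v v v
  have cc := Complex.continuous_conj
  have c0 := h.cont
  have c1 := h.cont1 v
  have c2 := h.cont2 v v
  have sc : ∀ {g : Plane → ℂ}, HasCompactSupport g →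
      HasCompactSupport fun σ => (starRingEnd ℂ) (g σ) := fun hg => hg.comp_left (map_zero _)
  have e : corr (fun ξ => phase t ξ * G ξ) (fun ξ => phase t ξ * G ξ) η =
      ∫ σ, Complex.exp ((t * (jap σ - jap (σ + η)) : ℝ) * Complex.I) *
        (G (σ + η) * (starRingEnd ℂ) (G σ)) := by
    rw [corr]; congr 1; ext σ
    rw [← phase_mul_conj, map_mul]; ring
  rw [e]
  refine norm_integral_phase_le ht (v := v) (ψ := fun σ => jap σ - jap (σ + η))
    (ψ1 := fun σ => djap v σ - djap v (σ + η)) (ψ2 := fun σ => ddjap v v σ - ddjap v v (σ + η))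
    (ψ3 := fun σ => dddjap v v v σ - dddjap v v v (σ + η)) (by fun_prop) (by fun_prop)
    (by fun_prop) (by fun_prop)
    (fun ξ => hasLineDerivAt_sub (hasLineDerivAt_jap ξ v)
      (hasLineDerivAt_shift η (hasLineDerivAt_jap _ v)))
    (fun ξ => hasLineDerivAt_sub (hasLineDerivAt_djap ξ v v)
      (hasLineDerivAt_shift η (hasLineDerivAt_djap _ v v)))
    (fun ξ => hasLineDerivAt_sub (hasLineDerivAt_ddjap ξ v v v)
      (hasLineDerivAt_shift η (hasLineDerivAt_ddjap _ v v v)))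
    (fun ξ => lt_of_lt_of_le (by have := jap_pos ξ; have := jap_pos (ξ + η); positivity) (hlow ξ))
    (by fun_prop) (by fun_prop) (by fun_prop) (sc h.supp).mul_left
    ((sc h.supp).mul_left.add (sc (h.supp1 v)).mul_left)
    (((sc h.supp).mul_left.add (sc (h.supp1 v)).mul_left).add
      ((sc (h.supp1 v)).mul_left.add (sc (h.supp2 v v)).mul_left))
    (fun ξ => hasLineDerivAt_mul (hasLineDerivAt_shift η (h.deriv1 v _))
      (hasLineDerivAt_conj (h.deriv1 v ξ)))
    (fun ξ => hasLineDerivAt_add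
      (hasLineDerivAt_mul (hasLineDerivAt_shift η (h.deriv2 v v _))
        (hasLineDerivAt_conj (h.deriv1 v ξ)))
      (hasLineDerivAt_mul (hasLineDerivAt_shift η (h.deriv1 v _))
        (hasLineDerivAt_conj (h.deriv2 v v ξ)))) hη0 (one_le_pow₀ hL) fun ξ => ?_
  have hA := jap_pos (ξ + η)
  have hB := jap_pos ξ
  rcases lt_or_ge L (jap ξ) with h1 | h1
  · obtain ⟨z0, z1, z2⟩ := hsupp ξ h1
    left; simp [z0, z1, z2]
  rcases lt_or_ge L (jap (ξ + η)) with h2 | h2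
  · obtain ⟨z0, z1, z2⟩ := hsupp _ h2
    left; simp [z0, z1, z2]
  right
  refine ⟨?_, ?_, ?_⟩
  · rw [inv_le_comm₀ (lt_of_lt_of_le (by positivity) (hlow ξ)) (by positivity), inv_div]
    refine le_trans ?_ (hlow ξ)
    gcongr
    calc (jap (ξ + η) * jap ξ) ^ 2 ≤ (L * L) ^ 2 := by gcongr
      _ = L ^ 4 := by ring
  · rw [abs_sub_comm]; exact abs_ddjap_sub_le hv1 ξ η
  · rw [abs_sub_comm]; exact abs_dddjap_sub_le hv1 ξ η

theorem eLpNorm_two_comp_add (f : Plane → ℂ) (hf : AEStronglyMeasurable f) (η : Plane) :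
    eLpNorm (fun σ => f (σ + η)) 2 volume = eLpNorm f 2 volume :=
  eLpNorm_comp_measurePreserving hf (measurePreserving_add_right volume η)

set_option maxHeartbeats 1000000 in
/-- A truncation of the evolved profile whose autocorrelation decays in time. -/
theorem exists_trunc_corr {n k : ℝ} (hn : 1000 ≤ n) (hk : k = n / 100) : ∃ C : ℝ, 0 < C ∧
    ∀ (β : ℝ) (f : Plane → ℂ), 0 ≤ β → ProfileBound n β f → ∀ t : ℝ, 1 ≤ t →
    ∃ W : Plane → ℂ, Continuous W ∧ Integrable W ∧ (∀ ξ, ‖W ξ‖ ≤ C * β) ∧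
      Integrable (fun ξ => phase t ξ * ft f ξ - W ξ) ∧
      ∫ ξ, ‖phase t ξ * ft f ξ - W ξ‖ ≤ C * β * t ^ (-(3 / 2) : ℝ) ∧
      ∀ η ≠ 0, ‖corr W W η‖ ≤ C * β ^ 2 * t ^ (-(48 / 25) : ℝ) / ‖η‖ ^ 2 := by
  obtain ⟨K, hK, htr⟩ := exists_trunc hn hk
  obtain ⟨J, hJ, hJb⟩ := exists_eLpNorm_jap_rpow_le (s := -2) (by norm_num)
  have ij3 : Integrable fun ξ : Plane => jap ξ ^ (-3 : ℝ) := integrable_jap_rpow (by norm_num)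
  set I3 : ℝ := ∫ ξ : Plane, jap ξ ^ (-3 : ℝ) with hI3
  have hj := fun ξ : Plane => jap_pos ξ
  have hI30 : 0 ≤ I3 := integral_nonneg fun ξ => Real.rpow_nonneg (hj ξ).le _
  -- The exponent `19 = 16 + 3` comes from `Λ⁴ = L¹⁶` with `L = 2M`, and from `L³` spent to insert
  -- the integrable weight `⟨σ⟩⁻³`. Among the products of two derivatives of the truncation, seven
  -- are bounded by `γ²` and two involve `Q`.
  set D := 93 * (2 : ℝ) ^ 19 * K ^ 2 * (7 * I3 + 2 * J) with hD
  have hD0 : 0 < D := by positivity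
  refine ⟨K + D, by positivity, fun β f hβ hf t ht => ?_⟩
  obtain ⟨G, G1, G2, Q, hG, hsupp, bG, bG', bG1, cQ, bQ, bG2, hi, hr⟩ := htr β f hβ hf t ht
  have ht0 : 0 < t := by linarith
  have hk0 : 0 ≤ k := by rw [hk]; positivity
  have cp := continuous_phase t
  have cG := hG.cont
  have cft := continuous_ft (hf.integrable hβ)
  have hle : ∀ ξ, ‖phase t ξ * ft f ξ - phase t ξ * G ξ‖ ≤ jap ξ ^ k * ‖ft f ξ - G ξ‖ := fun ξ => by
    rw [← mul_sub, norm_mul, norm_phase]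
    gcongr
    exact Real.one_le_rpow (one_le_jap ξ) hk0
  have idiff : Integrable fun ξ => phase t ξ * ft f ξ - phase t ξ * G ξ :=
    hi.mono' (by fun_prop : Continuous fun ξ =>
      phase t ξ * ft f ξ - phase t ξ * G ξ).aestronglyMeasurable (Filter.Eventually.of_forall hle)
  refine ⟨fun ξ => phase t ξ * G ξ, by fun_prop, (by fun_prop : Continuous fun ξ =>
    phase t ξ * G ξ).integrable_of_hasCompactSupport hG.supp.mul_left, fun ξ => ?_, idiff,
    (integral_mono idiff.norm hi hle).trans (hr.trans ?_), fun η hη => ?_⟩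
  · rw [norm_mul, norm_phase, one_mul]
    refine (bG' ξ).trans ?_
    gcongr; linarith
  · gcongr; linarith
  set M := t ^ (2 / n) with hM
  have hM1 : 1 ≤ M := Real.one_le_rpow ht (by positivity)
  set L := 2 * M with hL
  have hL1 : 1 ≤ L := by linarith
  have hL0 : 0 < L := by linarith
  obtain ⟨v, hv, hb⟩ := norm_corr_phase_le ht0 hG hL1 hsupp hη
  refine hb.trans ?_
  have hη0 : 0 < ‖η‖ := norm_pos_iff.2 hη
  set γ := K * β * t ^ (1 / 50 : ℝ) with hγ
  have h50 : 1 ≤ t ^ (1 / 50 : ℝ) := Real.one_le_rpow ht (by norm_num)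
  have hγ0 : 0 ≤ γ := by positivity
  have hγ1 : K * β ≤ γ := le_mul_of_one_le_right (by positivity) h50
  have cj2 := continuous_jap_rpow (-2)
  have cQv := cQ v v
  obtain ⟨i1, l1⟩ := integral_norm_mul_le_of_eLpNorm_le (μ := volume) cj2.aestronglyMeasurable
    (cQv.aestronglyMeasurable) hJ.le (by positivity) hJb (bQ v v hv.le hv.le)
  obtain ⟨i2, l2⟩ := integral_norm_mul_le_of_eLpNorm_le (μ := volume) cj2.aestronglyMeasurable
    (cQv.comp (continuous_add_const η)).aestronglyMeasurable hJ.le (by positivity) hJb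
    ((eLpNorm_two_comp_add _ cQv.aestronglyMeasurable η).le.trans (bQ v v hv.le hv.le))
  set B : Plane → ℝ := fun σ => (7 * γ ^ 2 * L ^ 3) * jap σ ^ (-3 : ℝ)
    + (γ * L ^ 2) * (‖jap σ ^ (-2 : ℝ)‖ * ‖Q v v (σ + η)‖)
    + (γ * L ^ 2) * (‖jap σ ^ (-2 : ℝ)‖ * ‖Q v v σ‖) with hB
  have iB : Integrable B := ((ij3.const_mul _).add (i2.const_mul _)).add (i1.const_mul _)
  have hIB : ∫ σ, B σ ≤ γ ^ 2 * L ^ 3 * (7 * I3 + 2 * J) := by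
    have e1 := integral_add ((ij3.const_mul (7 * γ ^ 2 * L ^ 3)).add (i2.const_mul (γ * L ^ 2)))
      (i1.const_mul (γ * L ^ 2))
    have e2 := integral_add (ij3.const_mul (7 * γ ^ 2 * L ^ 3)) (i2.const_mul (γ * L ^ 2))
    simp only [Pi.add_apply, Function.comp_apply] at e1 e2
    rw [hB, e1, e2, integral_const_mul, integral_const_mul, integral_const_mul, ← hI3]
    calc _ ≤ 7 * γ ^ 2 * L ^ 3 * I3 + γ * L ^ 2 * (J * (K * β)) + γ * L ^ 2 * (J * (K * β)) := by
          gcongr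
          exact l2
      _ ≤ 7 * γ ^ 2 * L ^ 3 * I3 + γ * L ^ 3 * (J * γ) + γ * L ^ 3 * (J * γ) := by
          gcongr <;> first | exact hL1 | norm_num
      _ = _ := by ring
  have hpt : ∀ σ, ‖G (σ + η) * (starRingEnd ℂ) (G σ)‖
        + ‖G1 v (σ + η) * (starRingEnd ℂ) (G σ) + G (σ + η) * (starRingEnd ℂ) (G1 v σ)‖
        + ‖(G2 v v (σ + η) * (starRingEnd ℂ) (G σ) + G1 v (σ + η) * (starRingEnd ℂ) (G1 v σ))
          + (G1 v (σ + η) * (starRingEnd ℂ) (G1 v σ) + G (σ + η) * (starRingEnd ℂ) (G2 v v σ))‖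
        ≤ B σ := fun σ => by
    have hjσ := hj σ
    rcases lt_or_ge L (jap σ) with h1 | h1
    · obtain ⟨z0, z1, z2⟩ := hsupp σ h1
      simp only [z0, z1, z2, map_zero, mul_zero, add_zero, norm_zero, hB]
      positivity
    have w3 : (1 : ℝ) ≤ L ^ 3 * jap σ ^ (-3 : ℝ) := by
      rw [Real.rpow_neg hjσ.le, show jap σ ^ (3 : ℝ) = jap σ ^ 3 by norm_cast, ← div_eq_mul_inv,
        one_le_div (by positivity)]
      gcongr
    have w2 : (1 : ℝ) ≤ L ^ 2 * jap σ ^ (-2 : ℝ) := by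
      rw [Real.rpow_neg hjσ.le, show jap σ ^ (2 : ℝ) = jap σ ^ 2 by norm_cast, ← div_eq_mul_inv,
        one_le_div (by positivity)]
      gcongr
    have q0 : ∀ ξ, ‖G ξ‖ ≤ γ := fun ξ => (bG' ξ).trans hγ1
    have q1 : ∀ ξ, ‖G1 v ξ‖ ≤ γ := fun ξ => bG1 v ξ hv.le
    have q2 : ∀ ξ, ‖G2 v v ξ‖ ≤ ‖Q v v ξ‖ + γ := fun ξ => bG2 v v ξ hv.le hv.le
    have s1 : ‖G (σ + η) * (starRingEnd ℂ) (G σ)‖ ≤ γ * γ := by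
      rw [norm_mul, RCLike.norm_conj]; gcongr <;> apply q0
    have s2 : ‖G1 v (σ + η) * (starRingEnd ℂ) (G σ) + G (σ + η) * (starRingEnd ℂ) (G1 v σ)‖
        ≤ γ * γ + γ * γ := by
      refine (norm_add_le _ _).trans ?_
      rw [norm_mul, norm_mul, RCLike.norm_conj, RCLike.norm_conj]
      gcongr <;> first | apply q0 | apply q1
    have s3 : ‖(G2 v v (σ + η) * (starRingEnd ℂ) (G σ) + G1 v (σ + η) * (starRingEnd ℂ) (G1 v σ))
          + (G1 v (σ + η) * (starRingEnd ℂ) (G1 v σ) + G (σ + η) * (starRingEnd ℂ) (G2 v v σ))‖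
        ≤ ((‖Q v v (σ + η)‖ + γ) * γ + γ * γ) + (γ * γ + γ * (‖Q v v σ‖ + γ)) := by
      refine (norm_add_le _ _).trans ((add_le_add (norm_add_le _ _) (norm_add_le _ _)).trans ?_)
      simp only [norm_mul, RCLike.norm_conj]
      gcongr <;> first | apply q0 | apply q1 | apply q2
    have r1 : 7 * γ ^ 2 ≤ 7 * γ ^ 2 * (L ^ 3 * jap σ ^ (-3 : ℝ)) :=
      le_mul_of_one_le_right (by positivity) w3
    have r2 : γ * (‖Q v v (σ + η)‖ + ‖Q v v σ‖) ≤
        γ * (‖Q v v (σ + η)‖ + ‖Q v v σ‖) * (L ^ 2 * jap σ ^ (-2 : ℝ)) :=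
      le_mul_of_one_le_right (by positivity) w2
    simp only [hB]
    rw [Real.norm_of_nonneg (Real.rpow_nonneg hjσ.le _)]
    linarith
  have hint : ∫ σ, (‖G (σ + η) * (starRingEnd ℂ) (G σ)‖
        + ‖G1 v (σ + η) * (starRingEnd ℂ) (G σ) + G (σ + η) * (starRingEnd ℂ) (G1 v σ)‖
        + ‖(G2 v v (σ + η) * (starRingEnd ℂ) (G σ) + G1 v (σ + η) * (starRingEnd ℂ) (G1 v σ))
          + (G1 v (σ + η) * (starRingEnd ℂ) (G1 v σ) + G (σ + η) * (starRingEnd ℂ) (G2 v v σ))‖)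
        ≤ γ ^ 2 * L ^ 3 * (7 * I3 + 2 * J) :=
    (integral_mono_of_nonneg (Filter.Eventually.of_forall fun σ => by positivity) iB
      (Filter.Eventually.of_forall hpt)).trans hIB
  -- The losses are `t^{1/25}` from `γ²` and `M¹⁹ = t^{38/n} ≤ t^{38/1000}`, together less than the
  -- allowed `t^{2/25}`.
  have hpow : t ^ (1 / 25 : ℝ) * M ^ 19 / t ^ 2 ≤ t ^ (-(48 / 25) : ℝ) := by
    rw [hM, ← Real.rpow_natCast, ← Real.rpow_mul ht0.le, ← Real.rpow_natCast t, ← Real.rpow_add ht0,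
      ← Real.rpow_sub ht0]
    apply Real.rpow_le_rpow_of_exponent_le ht
    push_cast
    have h1 : 2 / n ≤ 2 / 1000 := by gcongr
    linarith
  calc _ ≤ 93 * (L ^ 4) ^ 4 / (t * ‖η‖) ^ 2 * (γ ^ 2 * L ^ 3 * (7 * I3 + 2 * J)) := by gcongr
    _ = D * β ^ 2 * (t ^ (1 / 25 : ℝ) * M ^ 19 / t ^ 2) / ‖η‖ ^ 2 := by
        have : t ^ (1 / 25 : ℝ) = (t ^ (1 / 50 : ℝ)) ^ 2 := by
          rw [← Real.rpow_natCast, ← Real.rpow_mul ht0.le]; norm_num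
        rw [this, hγ, hL, hD]; field_simp
    _ ≤ (K + D) * β ^ 2 * t ^ (-(48 / 25) : ℝ) / ‖η‖ ^ 2 := by
        gcongr
        linarith

/-- The Fourier transform `e^{-it⟨ξ⟩} f̂(ξ)` of the solution with profile `f`. -/
noncomputable def evol (t : ℝ) (f : Plane → ℂ) (ξ : Plane) : ℂ := phase t ξ * ft f ξ

theorem norm_evol (t : ℝ) (f : Plane → ℂ) (ξ : Plane) : ‖evol t f ξ‖ = ‖ft f ξ‖ := by
  rw [evol, norm_mul, norm_phase, one_mul]

theorem ProfileBound.continuous_evol {n β : ℝ} {f : Plane → ℂ} (hβ : 0 ≤ β)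
    (hf : ProfileBound n β f) (t : ℝ) : Continuous (evol t f) :=
  (continuous_phase t).mul (continuous_ft (hf.integrable hβ))

theorem exists_evol_bounds {n : ℝ} (hn : 1000 ≤ n) : ∃ C : ℝ, 0 < C ∧
    ∀ (β : ℝ) (f : Plane → ℂ), 0 ≤ β → ProfileBound n β f → ∀ t : ℝ,
      Integrable (evol t f) ∧ ∫ ξ, ‖evol t f ξ‖ ≤ C * β ∧ ∀ ξ, ‖evol t f ξ‖ ≤ C * β := by
  obtain ⟨C0, hC0, h0⟩ := exists_ft_holder
  obtain ⟨C1, hC1, h1⟩ := exists_integral_ft_le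
  refine ⟨C0 + C1, by positivity, fun β f hβ hf t => ?_⟩
  obtain ⟨i, l⟩ := h1 n β f hβ hf
  have hle : ∀ ξ, ‖evol t f ξ‖ ≤ jap ξ ^ (n - 2) * ‖ft f ξ‖ := fun ξ => by
    rw [norm_evol]
    exact le_mul_of_one_le_left (norm_nonneg _) (Real.one_le_rpow (one_le_jap ξ) (by linarith))
  have ii : Integrable (evol t f) := i.mono' (hf.continuous_evol hβ t).aestronglyMeasurable
    (Filter.Eventually.of_forall hle)
  refine ⟨ii, (integral_mono ii.norm i hle).trans (l.trans ?_), fun ξ => ?_⟩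
  · gcongr; linarith
  · rw [norm_evol]
    refine ((h0 n β f hβ hf).1 ξ).trans ?_
    gcongr; linarith

/-- Weighted integrability of a bounded integrable function. -/
theorem exists_integral_inv_norm_mul_le : ∃ C : ℝ, 0 < C ∧ ∀ (H : Plane → ℂ) (a b : ℝ),
    Integrable H → (∀ η, ‖H η‖ ≤ a) → ∫ η, ‖H η‖ ≤ b →
    Integrable (fun η => ‖η‖⁻¹ * ‖H η‖) ∧ ∫ η, ‖η‖⁻¹ * ‖H η‖ ≤ C * a + b := by
  obtain ⟨C, hC, h⟩ := exists_integral_norm_rpow_lt (s := -1) (by norm_num)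
  refine ⟨C, hC, fun H a b iH ha hb => ?_⟩
  have ha0 : 0 ≤ a := (norm_nonneg _).trans (ha 0)
  obtain ⟨i1, l1⟩ := h 1 one_pos
  have hm : MeasurableSet {η : Plane | ‖η‖ < 1} := measurableSet_lt measurable_norm measurable_const
  simp only [Real.rpow_neg_one, Real.one_rpow, mul_one] at i1 l1
  rw [← integral_indicator hm] at l1
  rw [← integrable_indicator_iff hm] at i1
  set w : Plane → ℝ := {η : Plane | ‖η‖ < 1}.indicator fun η => ‖η‖⁻¹ with hw
  have hle : ∀ η, ‖η‖⁻¹ * ‖H η‖ ≤ a * w η + ‖H η‖ := fun η => by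
    by_cases hη : ‖η‖ < 1
    · rw [hw, indicator_of_mem (by exact hη)]
      have := mul_le_mul_of_nonneg_left (ha η) (inv_nonneg.2 (norm_nonneg η))
      linarith [norm_nonneg (H η)]
    · rw [hw, indicator_of_notMem (by exact hη), mul_zero, zero_add]
      exact mul_le_of_le_one_left (norm_nonneg _) (inv_le_one_of_one_le₀ (not_lt.1 hη))
  have iR := (i1.const_mul a).add iH.norm
  have iL : Integrable (fun η => ‖η‖⁻¹ * ‖H η‖) :=
    iR.mono' (measurable_norm.inv.aestronglyMeasurable.mul iH.1.norm)
      (Filter.Eventually.of_forall fun η => by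
        rw [Real.norm_of_nonneg (by positivity)]; exact hle η)
  refine ⟨iL, (integral_mono iL iR hle).trans ?_⟩
  have e := integral_add (i1.const_mul a) iH.norm
  rw [show (∫ η, ((fun η => a * w η) + fun η => ‖H η‖) η) = ∫ η, (a * w η + ‖H η‖) from rfl, e,
    integral_const_mul]
  nlinarith

theorem exists_corr_evol_bounds {n : ℝ} (hn : 1000 ≤ n) : ∃ C : ℝ, 0 < C ∧
    ∀ (β : ℝ) (f : Plane → ℂ), 0 ≤ β → ProfileBound n β f → ∀ t : ℝ,
      Integrable (corr (evol t f) (evol t f)) ∧ (∀ η, ‖corr (evol t f) (evol t f) η‖ ≤ C * β ^ 2) ∧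
      Integrable (fun η => ‖η‖⁻¹ * ‖corr (evol t f) (evol t f) η‖) ∧
      ∫ η, ‖η‖⁻¹ * ‖corr (evol t f) (evol t f) η‖ ≤ C * β ^ 2 := by
  obtain ⟨C0, hC0, h0⟩ := exists_evol_bounds hn
  obtain ⟨C1, hC1, h1⟩ := exists_integral_inv_norm_mul_le
  refine ⟨(C1 + 1) * C0 ^ 2, by positivity, fun β f hβ hf t => ?_⟩
  obtain ⟨i, l, s⟩ := h0 β f hβ hf t
  have iH := integrable_corr i i
  have e : ∀ η, ‖corr (evol t f) (evol t f) η‖ ≤ C0 ^ 2 * β ^ 2 := fun η =>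
    (norm_corr_le s i η).trans (by
      calc _ ≤ C0 * β * (C0 * β) := by gcongr
        _ = _ := by ring)
  have e' : ∫ η, ‖corr (evol t f) (evol t f) η‖ ≤ C0 ^ 2 * β ^ 2 :=
    (integral_norm_corr_le i i).trans (by
      calc _ ≤ C0 * β * (C0 * β) := by gcongr
        _ = _ := by ring)
  obtain ⟨i3, l3⟩ := h1 _ _ _ iH e e'
  refine ⟨iH, fun η => (e η).trans ?_, i3, l3.trans (le_of_eq (by ring))⟩
  have : 0 ≤ C1 * (C0 ^ 2 * β ^ 2) := by positivity
  linarith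

set_option maxHeartbeats 400000 in
/-- Decay in time of the high-frequency part of the Hartree potential. -/
theorem exists_integral_corr_high_le {n k : ℝ} (hn : 1000 ≤ n) (hk : k = n / 100) : ∃ C : ℝ, 0 < C ∧
    ∀ (β : ℝ) (f : Plane → ℂ), 0 ≤ β → ProfileBound n β f → ∀ t : ℝ, 1 ≤ t →
      ∫ η in {η : Plane | t ^ (-(4 / 5) : ℝ) ≤ ‖η‖}, ‖η‖⁻¹ * ‖corr (evol t f) (evol t f) η‖ ≤
        C * β ^ 2 * t ^ (-(28 / 25) : ℝ) := by
  obtain ⟨C0, hC0, h0⟩ := exists_evol_bounds hn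
  obtain ⟨C1, hC1, h1⟩ := exists_integral_inv_norm_mul_le
  obtain ⟨C2, hC2, h2⟩ := exists_trunc_corr hn hk
  obtain ⟨C3, hC3, h3⟩ := exists_integral_norm_rpow_ge (s := -3) (by norm_num)
  obtain ⟨C4, hC4, h4⟩ := exists_corr_evol_bounds hn
  refine ⟨C3 * C2 + (C1 + 1) * (2 * C0 + 2 * C2) * C2, by positivity, fun β f hβ hf t ht => ?_⟩
  obtain ⟨iU, lU, sU⟩ := h0 β f hβ hf t
  obtain ⟨W, cW, iW, sW, iD, lD, dW⟩ := h2 β f hβ hf t ht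
  obtain ⟨-, -, iH, -⟩ := h4 β f hβ hf t
  have ht0 : 0 < t := by linarith
  set U := evol t f with hU
  have cU : Continuous U := hf.continuous_evol hβ t
  change Integrable (fun ξ => U ξ - W ξ) at iD
  change ∫ ξ, ‖U ξ - W ξ‖ ≤ _ at lD
  -- Above this threshold `t^{-48/25}∫|η|⁻³` is of order `t^{-48/25}/r = t^{-28/25}`. Below it the
  -- linearized phase will leave errors `r^{3/2}` and `t r³`, both smaller still.
  set r := t ^ (-(4 / 5) : ℝ) with hr
  have hr0 : 0 < r := by positivity
  set ε := C2 * β * t ^ (-(3 / 2) : ℝ) with hε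
  have hε0 : 0 ≤ ε := by positivity
  have ht32 : t ^ (-(3 / 2) : ℝ) ≤ 1 := Real.rpow_le_one_of_one_le_of_nonpos ht (by norm_num)
  have hε1 : ε ≤ C2 * β := mul_le_of_le_one_right (by positivity) ht32
  -- The truncation error of the correlation. It is small both in sup norm and in `L¹`, which is
  -- what the singular weight `|η|⁻¹` requires.
  set E : Plane → ℂ := fun η =>
    corr (fun ξ => U ξ - W ξ) U η + corr W (fun ξ => U ξ - W ξ) η with hE
  have iE : Integrable E := (integrable_corr iD iU).add (integrable_corr iW iD)
  have lW : ∫ ξ, ‖W ξ‖ ≤ (C0 + C2) * β := by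
    calc ∫ ξ, ‖W ξ‖ ≤ ∫ ξ, (‖U ξ‖ + ‖U ξ - W ξ‖) := by
          refine integral_mono iW.norm (iU.norm.add iD.norm) fun ξ => ?_
          have := norm_sub_norm_le (W ξ) (U ξ)
          rw [norm_sub_rev] at this
          dsimp only [Pi.add_apply]; linarith
      _ = (∫ ξ, ‖U ξ‖) + ∫ ξ, ‖U ξ - W ξ‖ := integral_add iU.norm iD.norm
      _ ≤ _ := by linarith
  have bE : ∀ η, ‖E η‖ ≤ (2 * C0 + 2 * C2) * β * ε := fun η => by
    refine (norm_add_le _ _).trans ?_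
    have a1 := norm_corr_le' iD sU η
    have a2 := norm_corr_le sW iD η
    have a3 : (C0 * β + C2 * β) * ∫ ξ, ‖U ξ - W ξ‖ ≤ (C0 * β + C2 * β) * ε := by gcongr
    have : 0 ≤ (C0 + C2) * β * ε := by positivity
    linarith
  have lE : ∫ η, ‖E η‖ ≤ (2 * C0 + 2 * C2) * β * ε := by
    have i1 := integrable_corr iD iU
    have i2 := integrable_corr iW iD
    calc ∫ η, ‖E η‖ ≤ ∫ η, (‖corr (fun ξ => U ξ - W ξ) U η‖ + ‖corr W (fun ξ => U ξ - W ξ) η‖) :=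
          integral_mono iE.norm (i1.norm.add i2.norm) fun η => norm_add_le _ _
      _ = _ := integral_add i1.norm i2.norm
      _ ≤ ε * (C0 * β) + ((C0 + C2) * β) * ε := by
          refine add_le_add ((integral_norm_corr_le iD iU).trans ?_)
            ((integral_norm_corr_le iW iD).trans ?_) <;> gcongr
      _ ≤ _ := by
          have : 0 ≤ C2 * β * ε := by positivity
          linarith
  obtain ⟨iE', lE'⟩ := h1 E _ _ iE bE lE
  obtain ⟨i3, l3⟩ := h3 r hr0
  set κ := C2 * β ^ 2 * t ^ (-(48 / 25) : ℝ) with hκ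
  have hm : MeasurableSet {η : Plane | r ≤ ‖η‖} := measurableSet_le measurable_const measurable_norm
  have hpt : ∀ η ∈ {η : Plane | r ≤ ‖η‖}, ‖η‖⁻¹ * ‖corr U U η‖ ≤
      κ * ‖η‖ ^ (-3 : ℝ) + ‖η‖⁻¹ * ‖E η‖ := fun η hη => by
    have hη0 : 0 < ‖η‖ := hr0.trans_le hη
    have e1 : corr U U η = corr W W η + E η := by
      rw [hE, ← sub_eq_iff_eq_add']; exact corr_sub_corr cU cW sU sW iU iW η
    have e2 : ‖η‖ ^ (-3 : ℝ) = ‖η‖⁻¹ * (‖η‖ ^ 2)⁻¹ := by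
      rw [Real.rpow_neg hη0.le, show ‖η‖ ^ (3 : ℝ) = ‖η‖ ^ 3 by norm_cast, ← mul_inv]; congr 1; ring
    rw [e1, e2]
    calc _ ≤ ‖η‖⁻¹ * (κ / ‖η‖ ^ 2 + ‖E η‖) := by
          gcongr
          exact (norm_add_le _ _).trans (by gcongr; exact dW η (norm_pos_iff.1 hη0))
      _ = _ := by ring
  have e3 := integral_add (i3.integrable.const_mul κ) iE'.integrableOn.integrable
    (μ := volume.restrict {η : Plane | r ≤ ‖η‖})
  calc _ ≤ ∫ η in {η : Plane | r ≤ ‖η‖}, (κ * ‖η‖ ^ (-3 : ℝ) + ‖η‖⁻¹ * ‖E η‖) :=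
        setIntegral_mono_on iH.integrableOn ((i3.integrable.const_mul κ).add iE'.integrableOn) hm hpt
    _ ≤ κ * (C3 * r ^ (-3 + 2 : ℝ)) + (C1 * ((2 * C0 + 2 * C2) * β * ε) + (2 * C0 + 2 * C2) * β * ε) := by
        rw [e3, integral_const_mul]
        gcongr
        exact (setIntegral_le_integral iE' (Filter.Eventually.of_forall fun η => by positivity)).trans lE'
    _ = C3 * C2 * β ^ 2 * (t ^ (-(48 / 25) : ℝ) * r ^ (-3 + 2 : ℝ))
        + (C1 + 1) * (2 * C0 + 2 * C2) * C2 * β ^ 2 * t ^ (-(3 / 2) : ℝ) := by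
        rw [hκ, hε]; ring
    _ ≤ C3 * C2 * β ^ 2 * t ^ (-(28 / 25) : ℝ)
        + (C1 + 1) * (2 * C0 + 2 * C2) * C2 * β ^ 2 * t ^ (-(28 / 25) : ℝ) := by
        gcongr ?_ + ?_
        · rw [hr, ← Real.rpow_mul ht0.le, ← Real.rpow_add ht0]
          norm_num
        · exact mul_le_mul_of_nonneg_left (Real.rpow_le_rpow_of_exponent_le ht (by norm_num))
            (by positivity)
    _ = _ := by ring

/-! ### Cancellation in the Hartree term on the Fourier side. -/

/-- An exact algebraic form of the Taylor remainder replaces a bound on the Hessian. It justifies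
linearizing the phase `t(⟨ξ⟩ - ⟨ξ-η⟩)` at the cost `t|η|²`. -/
theorem abs_jap_taylor_le (ξ η : Plane) : |jap ξ - jap (ξ - η) - djap η ξ| ≤ ‖η‖ ^ 2 := by
  have hA := jap_pos ξ
  have hB := jap_pos (ξ - η)
  have hA1 := one_le_jap ξ
  have hB1 := one_le_jap (ξ - η)
  have h := abs_jap_sub_le ξ (ξ - η)
  rw [sub_sub_cancel] at h
  have hin : |inner ℝ ξ η| ≤ jap ξ * ‖η‖ :=
    (abs_real_inner_le_norm ξ η).trans (by gcongr; exact norm_le_jap ξ)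
  have e : jap ξ - jap (ξ - η) - djap η ξ =
      ((jap ξ - jap (ξ - η)) * inner ℝ ξ η - jap ξ * ‖η‖ ^ 2) /
        (jap ξ * (jap ξ + jap (ξ - η))) := by
    have h1 := jap_sq ξ
    have h2 := jap_sq (ξ - η)
    rw [norm_sub_sq_real] at h2
    rw [djap, eq_div_iff (by positivity)]
    field_simp
    linear_combination jap ξ * h1 - jap ξ * h2
  rw [e, abs_div, abs_of_pos (mul_pos hA (add_pos hA hB)), div_le_iff₀ (by positivity)]
  calc _ ≤ |jap ξ - jap (ξ - η)| * |inner ℝ ξ η| + |jap ξ * ‖η‖ ^ 2| := by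
        rw [← abs_mul]; exact abs_sub _ _
    _ ≤ ‖η‖ * (jap ξ * ‖η‖) + jap ξ * ‖η‖ ^ 2 := by
        rw [abs_of_nonneg (by positivity : 0 ≤ jap ξ * ‖η‖ ^ 2)]; gcongr
    _ = ‖η‖ ^ 2 * (jap ξ * 2) := by ring
    _ ≤ _ := by gcongr; linarith

/-- The Fourier transform of the Hartree nonlinearity, up to a constant. -/
noncomputable def hartreeHat (U : Plane → ℂ) (ξ : Plane) : ℂ :=
  ∫ η, ((‖η‖⁻¹ : ℝ) : ℂ) * corr U U η * U (ξ - η)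

/-- The substitution `η ↦ -η` conjugates the integrand: the autocorrelation is Hermitian and `djap η
ξ` is odd in `η`. To leading order the potential is thus real and only turns the phase of `û`. -/
theorem im_integral_eq_zero (U : Plane → ℂ) (s r : ℝ) (ξ : Plane) :
    (∫ η, {η : Plane | ‖η‖ < r}.indicator
      (fun η => ((‖η‖⁻¹ : ℝ) : ℂ) * corr U U η * Complex.exp ((s * djap η ξ : ℝ) * Complex.I)) η).im
      = 0 := by
  rw [← Complex.conj_eq_iff_im, ← integral_conj, ← integral_neg_eq_self]
  congr 1; ext η
  by_cases h : ‖η‖ < r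
  · rw [indicator_of_mem (by simpa using h), indicator_of_mem (by exact h), corr_neg, map_mul, map_mul,
      Complex.conj_conj, Complex.conj_ofReal, norm_neg, ← Complex.exp_conj, map_mul,
      Complex.conj_ofReal, Complex.conj_I]
    congr 2
    rw [djap, djap, inner_neg_right]
    push_cast; ring
  · rw [indicator_of_notMem (by simpa using h), indicator_of_notMem (by exact h), map_zero]

/-- The nonlinearity does not change the modulus of the Fourier transform at leading order: only
an integrable in time contribution remains. -/
theorem exists_abs_im_hartreeHat_le {n k : ℝ} (hn : 1000 ≤ n) (hk : k = n / 100) : ∃ C : ℝ, 0 < C ∧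
    ∀ (β : ℝ) (f : Plane → ℂ), 0 ≤ β → ProfileBound n β f →
      (∀ (t : ℝ) (ξ : Plane), ‖hartreeHat (evol t f) ξ‖ ≤ C * β ^ 3) ∧
      ∀ t : ℝ, 1 ≤ t → ∀ ξ : Plane,
        |((starRingEnd ℂ) (evol t f ξ) * hartreeHat (evol t f) ξ).im| ≤
          C * β ^ 3 * ‖ft f ξ‖ * t ^ (-(28 / 25) : ℝ) := by
  obtain ⟨C0, hC0, h0⟩ := exists_evol_bounds hn
  obtain ⟨C1, hC1, h1⟩ := exists_ft_holder
  obtain ⟨C2, hC2, h2⟩ := exists_integral_corr_high_le hn hk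
  obtain ⟨C3, hC3, h3⟩ := exists_integral_norm_rpow_lt (s := -(1 / 2)) (by norm_num)
  obtain ⟨C5, hC5, h5⟩ := exists_integral_norm_rpow_lt (s := 1) (by norm_num)
  obtain ⟨C4, hC4, h4⟩ := exists_corr_evol_bounds hn
  refine ⟨C4 * C0 + C4 * C1 * C3 + C4 * C1 * C5 + C0 * C2, by positivity,
    fun β f hβ hf => ⟨fun t ξ => ?_, fun t ht ξ => ?_⟩⟩
  · obtain ⟨-, -, sU⟩ := h0 β f hβ hf t
    obtain ⟨-, -, iH, lH⟩ := h4 β f hβ hf t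
    calc ‖hartreeHat (evol t f) ξ‖
        ≤ ∫ η, C0 * β * (‖η‖⁻¹ * ‖corr (evol t f) (evol t f) η‖) := by
          refine norm_integral_le_of_norm_le (iH.const_mul _) (Filter.Eventually.of_forall fun η => ?_)
          rw [norm_mul, norm_mul, Complex.norm_real, norm_inv, norm_norm, mul_comm]
          gcongr
          exact sU _
      _ ≤ C0 * β * (C4 * β ^ 2) := by rw [integral_const_mul]; gcongr
      _ = C4 * C0 * β ^ 3 := by ring
      _ ≤ _ := by
          have : 0 ≤ C4 * C1 * C3 + C4 * C1 * C5 + C0 * C2 := by positivity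
          gcongr; linarith
  obtain ⟨iU, lU, sU⟩ := h0 β f hβ hf t
  obtain ⟨iH0, sH, iH, lH⟩ := h4 β f hβ hf t
  obtain ⟨sF, hF⟩ := h1 n β f hβ hf
  have hhigh := h2 β f hβ hf t ht
  set U := evol t f with hU
  have cU : Continuous U := hf.continuous_evol hβ t
  have ht0 : 0 < t := by linarith
  set r := t ^ (-(4 / 5) : ℝ) with hr
  have hr0 : 0 < r := by positivity
  obtain ⟨i3, l3⟩ := h3 r hr0
  obtain ⟨i5, l5⟩ := h5 r hr0
  have hmS : MeasurableSet {η : Plane | ‖η‖ < r} := measurableSet_lt measurable_norm measurable_const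
  have hmT : MeasurableSet {η : Plane | r ≤ ‖η‖} := measurableSet_le measurable_const measurable_norm
  set S : Set Plane := {η : Plane | ‖η‖ < r} with hS
  set T : Set Plane := {η : Plane | r ≤ ‖η‖} with hT
  rw [← integral_indicator hmS] at l3 l5
  rw [← integrable_indicator_iff hmS] at i3 i5
  rw [← integral_indicator hmT] at hhigh
  have iT := iH.indicator hmT
  set F := ‖ft f ξ‖ with hFdef
  set g : Plane → ℂ := fun η => ((‖η‖⁻¹ : ℝ) : ℂ) * corr U U η * ((starRingEnd ℂ) (U ξ) * U (ξ - η)) with hg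
  -- The model for `g` at low frequency, without its factor `F²`. Its integral is real, so
  -- subtracting `F² m` does not alter the imaginary part.
  set m : Plane → ℂ := S.indicator
      (fun η => ((‖η‖⁻¹ : ℝ) : ℂ) * corr U U η * Complex.exp ((t * djap η ξ : ℝ) * Complex.I)) with hm
  have nH : ∀ η, ‖((‖η‖⁻¹ : ℝ) : ℂ) * corr U U η‖ = ‖η‖⁻¹ * ‖corr U U η‖ := fun η => by
    rw [norm_mul, Complex.norm_real, norm_inv, norm_norm]
  have hH1 : AEStronglyMeasurable (fun η : Plane => ((‖η‖⁻¹ : ℝ) : ℂ) * corr U U η) volume :=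
    (Complex.measurable_ofReal.comp measurable_norm.inv).aestronglyMeasurable.mul iH0.1
  have cm1 : Continuous fun η => (starRingEnd ℂ) (U ξ) * U (ξ - η) := by fun_prop
  have cm2 : Continuous fun η : Plane => Complex.exp ((t * djap η ξ : ℝ) * Complex.I) := by
    unfold djap; fun_prop
  have ig : Integrable g := by
    refine (iH.mul_const (F * (C0 * β))).mono' (hH1.mul cm1.aestronglyMeasurable)
      (Filter.Eventually.of_forall fun η => ?_)
    rw [hg, norm_mul, nH, norm_mul, RCLike.norm_conj, norm_evol]
    gcongr
    exact sU _
  have im : Integrable m := by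
    refine Integrable.indicator (iH.mono' (hH1.mul cm2.aestronglyMeasurable)
      (Filter.Eventually.of_forall fun η => ?_)) hmS
    rw [norm_mul, nH, Complex.norm_exp_ofReal_mul_I, mul_one]
  have hgi : (starRingEnd ℂ) (U ξ) * hartreeHat U ξ = ∫ η, g η := by
    rw [hartreeHat, ← integral_const_mul]; congr 1; ext η; rw [hg]; ring
  have hmi : (((F ^ 2 : ℝ) : ℂ) * ∫ η, m η).im = 0 := by
    rw [Complex.im_ofReal_mul, im_integral_eq_zero, mul_zero]
  have hsplit : ((starRingEnd ℂ) (U ξ) * hartreeHat U ξ).im =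
      (∫ η, (g η - ((F ^ 2 : ℝ) : ℂ) * m η)).im := by
    rw [hgi, integral_sub ig (im.const_mul _), integral_const_mul, Complex.sub_im, hmi, sub_zero]
  have hphase : ∀ η, (starRingEnd ℂ) (U ξ) * U (ξ - η) =
      Complex.exp ((t * (jap ξ - jap (ξ - η)) : ℝ) * Complex.I) *
        ((starRingEnd ℂ) (ft f ξ) * ft f (ξ - η)) := fun η => by
    have := phase_mul_conj t ξ (-η)
    have e2 : phase t (ξ - η) * (starRingEnd ℂ) (phase t ξ) =
        Complex.exp ((t * (jap ξ - jap (ξ - η)) : ℝ) * Complex.I) := by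
      simpa [sub_eq_add_neg] using this
    rw [← e2, hU, evol, evol, map_mul]; ring
  -- Two errors: freezing `f̂(ξ-η)` at `ξ` costs `√|η|` by Hölder continuity, and linearizing the
  -- phase costs `t|η|²`. A factor `|f̂(ξ)|` is kept for the later weight in `ξ`.
  have hdiff : ∀ η, ‖(starRingEnd ℂ) (U ξ) * U (ξ - η) -
      ((F ^ 2 : ℝ) : ℂ) * Complex.exp ((t * djap η ξ : ℝ) * Complex.I)‖ ≤
      F * (C1 * β) * (Real.sqrt ‖η‖ + t * ‖η‖ ^ 2) := fun η => by
    have e1 : ((F ^ 2 : ℝ) : ℂ) = (starRingEnd ℂ) (ft f ξ) * ft f ξ := by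
      rw [← Complex.normSq_eq_conj_mul_self, Complex.normSq_eq_norm_sq]
    rw [hphase, e1]
    set p := Complex.exp ((t * (jap ξ - jap (ξ - η)) : ℝ) * Complex.I) with hp
    set q := Complex.exp ((t * djap η ξ : ℝ) * Complex.I) with hq
    have hp1 : ‖p‖ = 1 := Complex.norm_exp_ofReal_mul_I _
    have hpq : ‖p - q‖ ≤ t * ‖η‖ ^ 2 := by
      refine (norm_exp_ofReal_mul_I_sub_le _ _).trans ?_
      rw [← mul_sub, abs_mul, abs_of_pos ht0]
      gcongr
      exact abs_jap_taylor_le ξ η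
    have hh : ‖ft f (ξ - η) - ft f ξ‖ ≤ C1 * β * Real.sqrt ‖η‖ := by
      simpa [sub_eq_add_neg] using hF ξ (-η)
    have e2 : p * ((starRingEnd ℂ) (ft f ξ) * ft f (ξ - η)) - (starRingEnd ℂ) (ft f ξ) * ft f ξ * q =
        (starRingEnd ℂ) (ft f ξ) * (p * (ft f (ξ - η) - ft f ξ) + (p - q) * ft f ξ) := by ring
    rw [e2, norm_mul, RCLike.norm_conj, ← hFdef]
    calc _ ≤ F * (1 * (C1 * β * Real.sqrt ‖η‖) + t * ‖η‖ ^ 2 * (C1 * β)) := by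
          gcongr
          refine (norm_add_le _ _).trans ?_
          rw [norm_mul, norm_mul, hp1]
          gcongr
          exact sF ξ
      _ = _ := by ring
  have hpt : ∀ η, ‖g η - ((F ^ 2 : ℝ) : ℂ) * m η‖ ≤
      C4 * β ^ 2 * (F * (C1 * β)) * (S.indicator (fun η => ‖η‖ ^ (-(1 / 2) : ℝ)) η)
      + C4 * β ^ 2 * (F * (C1 * β)) * t * (S.indicator (fun η => ‖η‖ ^ (1 : ℝ)) η)
      + F * (C0 * β) * (T.indicator (fun η => ‖η‖⁻¹ * ‖corr U U η‖) η) := fun η => by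
    by_cases h : ‖η‖ < r
    · have h' : η ∉ T := not_le.2 h
      rw [hm, indicator_of_mem (show η ∈ S from h), indicator_of_mem (show η ∈ S from h),
        indicator_of_mem (show η ∈ S from h), indicator_of_notMem h', mul_zero, add_zero, hg]
      have e1 : ((‖η‖⁻¹ : ℝ) : ℂ) * corr U U η * ((starRingEnd ℂ) (U ξ) * U (ξ - η)) -
          ((F ^ 2 : ℝ) : ℂ) * (((‖η‖⁻¹ : ℝ) : ℂ) * corr U U η *
            Complex.exp ((t * djap η ξ : ℝ) * Complex.I)) =
          (((‖η‖⁻¹ : ℝ) : ℂ) * corr U U η) * ((starRingEnd ℂ) (U ξ) * U (ξ - η) -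
            ((F ^ 2 : ℝ) : ℂ) * Complex.exp ((t * djap η ξ : ℝ) * Complex.I)) := by ring
      dsimp only
      rw [e1, norm_mul, nH]
      calc _ ≤ ‖η‖⁻¹ * (C4 * β ^ 2) * (F * (C1 * β) * (Real.sqrt ‖η‖ + t * ‖η‖ ^ 2)) := by
            gcongr
            · exact sH η
            · exact hdiff η
        _ = C4 * β ^ 2 * (F * (C1 * β)) * (‖η‖⁻¹ * Real.sqrt ‖η‖)
            + C4 * β ^ 2 * (F * (C1 * β)) * t * (‖η‖⁻¹ * ‖η‖ ^ 2) := by ring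
        _ = _ := by
            rcases eq_or_ne η 0 with rfl | hη
            · simp
            · have hη0 : 0 < ‖η‖ := norm_pos_iff.2 hη
              have e3 : ‖η‖⁻¹ * Real.sqrt ‖η‖ = ‖η‖ ^ (-(1 / 2) : ℝ) := by
                rw [Real.sqrt_eq_rpow, ← Real.rpow_neg_one, ← Real.rpow_add hη0]; norm_num
              have e4 : ‖η‖⁻¹ * ‖η‖ ^ 2 = ‖η‖ ^ (1 : ℝ) := by
                rw [Real.rpow_one]; field_simp
              rw [e3, e4]
    · have h' : η ∈ T := not_lt.1 h
      rw [hm, indicator_of_notMem (show η ∉ S from h), indicator_of_notMem (show η ∉ S from h),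
        indicator_of_notMem (show η ∉ S from h), indicator_of_mem h', mul_zero, mul_zero, mul_zero, sub_zero, zero_add,
        zero_add, hg]
      dsimp only
      rw [norm_mul, nH, norm_mul, RCLike.norm_conj, norm_evol, mul_comm]
      gcongr
      exact sU _
  have i3' := i3.const_mul (C4 * β ^ 2 * (F * (C1 * β)))
  have i5' := i5.const_mul (C4 * β ^ 2 * (F * (C1 * β)) * t)
  have iT' := iT.const_mul (F * (C0 * β))
  rw [hsplit]
  refine (Complex.abs_im_le_norm _).trans
    ((norm_integral_le_of_norm_le ((i3'.add i5').add iT') (Filter.Eventually.of_forall hpt)).trans ?_)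
  have e1 := integral_add (i3'.add i5') iT'
  have e2 := integral_add i3' i5'
  simp only [Pi.add_apply] at e1 e2 ⊢
  rw [e1, e2, integral_const_mul, integral_const_mul, integral_const_mul]
  have hF0 : 0 ≤ F := norm_nonneg _
  -- With `r = t^{-4/5}` the low frequency errors are `r^{3/2} = t^{-6/5}` and `t r³ = t^{-7/5}`.
  have p1 : r ^ (-(1 / 2) + 2 : ℝ) ≤ t ^ (-(28 / 25) : ℝ) := by
    rw [hr, ← Real.rpow_mul ht0.le]
    exact Real.rpow_le_rpow_of_exponent_le ht (by norm_num)
  have p2 : t * r ^ (1 + 2 : ℝ) ≤ t ^ (-(28 / 25) : ℝ) := by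
    rw [hr, ← Real.rpow_mul ht0.le]
    nth_rewrite 1 [← Real.rpow_one t]
    rw [← Real.rpow_add ht0]
    exact Real.rpow_le_rpow_of_exponent_le ht (by norm_num)
  calc _ ≤ C4 * β ^ 2 * (F * (C1 * β)) * (C3 * r ^ (-(1 / 2) + 2 : ℝ))
        + C4 * β ^ 2 * (F * (C1 * β)) * t * (C5 * r ^ (1 + 2 : ℝ))
        + F * (C0 * β) * (C2 * β ^ 2 * t ^ (-(28 / 25) : ℝ)) := by gcongr
    _ = (C4 * C1 * C3) * β ^ 3 * F * r ^ (-(1 / 2) + 2 : ℝ)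
        + (C4 * C1 * C5) * β ^ 3 * F * (t * r ^ (1 + 2 : ℝ))
        + (C0 * C2) * β ^ 3 * F * t ^ (-(28 / 25) : ℝ) := by ring
    _ ≤ (C4 * C1 * C3) * β ^ 3 * F * t ^ (-(28 / 25) : ℝ)
        + (C4 * C1 * C5) * β ^ 3 * F * t ^ (-(28 / 25) : ℝ)
        + (C0 * C2) * β ^ 3 * F * t ^ (-(28 / 25) : ℝ) := by gcongr
    _ ≤ _ := by
        have : 0 ≤ C4 * C0 * (β ^ 3 * F * t ^ (-(28 / 25) : ℝ)) := by positivity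
        linarith

/-! ### The Hartree potential and nonlinearity in Fourier variables. -/

/-- Integration of a one-parameter family of kernels whose superposition is a multiple of `|y|⁻¹`. -/
theorem integral_superposition {G : Plane → ℝ → ℝ} {κ : ℝ} (hG : Measurable (Function.uncurry G))
    (hpos : ∀ y s, 0 ≤ G y s) (hint : ∀ y ≠ 0, IntegrableOn (G y) (Ioi 0))
    (hval : ∀ y ≠ 0, ∫ s in Ioi (0 : ℝ), G y s = κ * ‖y‖⁻¹) {φ : Plane → ℂ}
    (hφ : AEStronglyMeasurable φ volume) (hi : Integrable fun y => ‖y‖⁻¹ * ‖φ y‖) :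
    ∫ s in Ioi (0 : ℝ), ∫ y, (G y s : ℂ) * φ y = κ * ∫ y, ((‖y‖⁻¹ : ℝ) : ℂ) * φ y := by
  have h0 : ∀ᵐ y : Plane, y ≠ 0 := by
    rw [ae_iff]; simp
  have hm : AEStronglyMeasurable (fun z : Plane × ℝ => (G z.1 z.2 : ℂ) * φ z.1)
      ((volume : Measure Plane).prod (volume.restrict (Ioi (0 : ℝ)))) :=
    (Complex.measurable_ofReal.comp hG).aestronglyMeasurable.mul hφ.comp_fst
  have hprod : Integrable (fun z : Plane × ℝ => (G z.1 z.2 : ℂ) * φ z.1)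
      ((volume : Measure Plane).prod (volume.restrict (Ioi (0 : ℝ)))) := by
    rw [integrable_prod_iff hm]
    constructor
    · filter_upwards [h0] with y hy
      exact (hint y hy).ofReal.mul_const _
    · refine (hi.const_mul κ).congr ?_
      filter_upwards [h0] with y hy
      simp only [norm_mul, Complex.norm_real, Real.norm_of_nonneg (hpos _ _)]
      rw [integral_mul_const, hval y hy]; ring
  rw [← integral_integral_swap (f := fun y s => (G y s : ℂ) * φ y) hprod, ← integral_const_mul]
  refine integral_congr_ae ?_
  filter_upwards [h0] with y hy
  have e : ∫ s in Ioi (0 : ℝ), (G y s : ℂ) = ((∫ s in Ioi (0 : ℝ), G y s : ℝ) : ℂ) := integral_ofReal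
  rw [integral_mul_const, e, hval y hy]
  push_cast; ring

/-- The substitution `s ↦ 1/s` turns this into a half-line Gaussian integral. -/
theorem integrableOn_inv_sq_gaussian {b : ℝ} (hb : 0 < b) :
    IntegrableOn (fun s : ℝ => (s ^ 2)⁻¹ * Real.exp (-b * (s ^ 2)⁻¹)) (Ioi 0) ∧
    ∫ s in Ioi (0 : ℝ), (s ^ 2)⁻¹ * Real.exp (-b * (s ^ 2)⁻¹) = Real.sqrt (Real.pi / b) / 2 := by
  have e : EqOn (fun s : ℝ => (|(-1 : ℝ)| * s ^ ((-1 : ℝ) - 1)) • Real.exp (-b * (s ^ (-1 : ℝ)) ^ 2))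
      (fun s : ℝ => (s ^ 2)⁻¹ * Real.exp (-b * (s ^ 2)⁻¹)) (Ioi 0) := by
    intro s hs
    have hs0 : 0 < s := hs
    simp only [abs_neg, abs_one, one_mul, smul_eq_mul, Real.rpow_neg_one, inv_pow]
    rw [show (-1 - 1 : ℝ) = -2 by norm_num, Real.rpow_neg hs0.le,
      show s ^ (2 : ℝ) = s ^ 2 by norm_cast]
  constructor
  · rw [← integrableOn_congr_fun e measurableSet_Ioi,
      integrableOn_Ioi_comp_rpow_iff (fun y => Real.exp (-b * y ^ 2)) (by norm_num : (-1 : ℝ) ≠ 0)]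
    exact (integrable_exp_neg_mul_sq hb).integrableOn
  · rw [← setIntegral_congr_fun measurableSet_Ioi e,
      integral_comp_rpow_Ioi (fun y => Real.exp (-b * y ^ 2)) (by norm_num : (-1 : ℝ) ≠ 0),
      integral_gaussian_Ioi]

/-- The squared modulus of an inverse Fourier transform. -/
theorem norm_ift_sq_eq {U : Plane → ℂ} (iU : Integrable U) (y : Plane) :
    ((‖ift U y‖ ^ 2 : ℝ) : ℂ) = (((2 * Real.pi) ^ 4 : ℝ)⁻¹ : ℝ) *
      ∫ η, Complex.exp ((inner ℝ y η : ℝ) * Complex.I) * corr U U η := by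
  set E : Plane → ℂ := fun ξ => Complex.exp ((inner ℝ y ξ : ℝ) * Complex.I) with hE
  have cE : Continuous E := by fun_prop
  have nE : ∀ ξ, ‖E ξ‖ = 1 := fun ξ => Complex.norm_exp_ofReal_mul_I _
  have hmul : ∀ σ η, E η * U (σ + η) = E (σ + η) * U (σ + η) * (starRingEnd ℂ) (E σ) := fun σ η => by
    have : E η = E (σ + η) * (starRingEnd ℂ) (E σ) := by
      simp only [hE]
      rw [← Complex.exp_conj, ← Complex.exp_add]
      congr 1
      simp only [map_mul, Complex.conj_ofReal, Complex.conj_I, inner_add_right]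
      push_cast; ring
    rw [this]; ring
  have key : ∫ η, E η * corr U U η = (∫ ξ, E ξ * U ξ) * (starRingEnd ℂ) (∫ ξ, E ξ * U ξ) := by
    have hp := integrable_corr_prod iU iU
    have hp' : Integrable (fun z : Plane × Plane => E z.1 * (U (z.2 + z.1) * (starRingEnd ℂ) (U z.2)))
        (volume.prod volume) :=
      hp.bdd_mul (c := 1) (cE.comp continuous_fst).aestronglyMeasurable
        (Filter.Eventually.of_forall fun z => (nE _).le)
    calc ∫ η, E η * corr U U η = ∫ η, ∫ σ, E η * (U (σ + η) * (starRingEnd ℂ) (U σ)) := by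
          congr 1; ext η; rw [corr, integral_const_mul]
      _ = ∫ σ, ∫ η, E η * (U (σ + η) * (starRingEnd ℂ) (U σ)) := integral_integral_swap hp'
      _ = ∫ σ, (∫ ξ, E ξ * U ξ) * (starRingEnd ℂ) (E σ * U σ) := by
          congr 1; ext σ
          rw [← integral_mul_const,
            ← integral_add_left_eq_self (fun ξ => E ξ * U ξ * (starRingEnd ℂ) (E σ * U σ)) σ]
          congr 1; ext η
          rw [← mul_assoc, hmul, map_mul]; ring
      _ = _ := by rw [integral_const_mul, integral_conj]
  have hift : ift U y = ((2 * Real.pi) ^ 2 : ℝ)⁻¹ * ∫ ξ, E ξ * U ξ := rfl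
  rw [key, Complex.mul_conj, Complex.normSq_eq_norm_sq, hift, norm_mul, mul_pow]
  generalize ∫ ξ, E ξ * U ξ = I
  rw [Complex.norm_real, Real.norm_of_nonneg (by positivity)]
  push_cast
  field_simp

theorem integral_gaussian_fourier {s : ℝ} (hs : 0 < s) (η : Plane) :
    Integrable (fun z : Plane => ((Real.exp (-(s ^ 2) * ‖z‖ ^ 2) : ℝ) : ℂ) *
      Complex.exp ((-inner ℝ z η : ℝ) * Complex.I)) ∧
    ∫ z : Plane, ((Real.exp (-(s ^ 2) * ‖z‖ ^ 2) : ℝ) : ℂ) *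
      Complex.exp ((-inner ℝ z η : ℝ) * Complex.I) =
      ((Real.pi * ((s ^ 2)⁻¹ * Real.exp (-(‖η‖ ^ 2 / 4) * (s ^ 2)⁻¹)) : ℝ) : ℂ) := by
  have hb : 0 < ((s ^ 2 : ℝ) : ℂ).re := by rw [Complex.ofReal_re]; positivity
  have e : (fun z : Plane => ((Real.exp (-(s ^ 2) * ‖z‖ ^ 2) : ℝ) : ℂ) *
      Complex.exp ((-inner ℝ z η : ℝ) * Complex.I)) = fun z : Plane =>
      Complex.exp (-((s ^ 2 : ℝ) : ℂ) * (‖z‖ : ℂ) ^ 2 + -Complex.I * (inner ℝ η z : ℝ)) := by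
    ext z
    rw [Complex.ofReal_exp, ← Complex.exp_add, real_inner_comm]
    congr 1; push_cast; ring
  rw [e]
  refine ⟨GaussianFourier.integrable_cexp_neg_mul_sq_norm_add hb _ _, ?_⟩
  rw [GaussianFourier.integral_cexp_neg_mul_sq_norm_add hb, finrank_plane]
  have : (((2 : ℕ) : ℂ) / 2) = 1 := by norm_num
  rw [this, Complex.cpow_one, neg_sq, Complex.I_sq, Complex.ofReal_mul, Complex.ofReal_mul,
    Complex.ofReal_exp, ← mul_assoc]
  congr 1
  · push_cast; rw [div_eq_mul_inv]
  · congr 1; push_cast; field_simp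

/-- The Fourier representation of the Hartree potential. -/
theorem hartreePotential_ift {U : Plane → ℂ} (iU : Integrable U) {a : ℝ} (hb : ∀ ξ, ‖U ξ‖ ≤ a)
    (hρ : Integrable fun y => ‖ift U y‖ ^ 2) (cI : Continuous (ift U)) {b : ℝ}
    (hbI : ∀ y, ‖ift U y‖ ≤ b) (x : Plane) :
    (hartreePotential (ift U) x : ℂ) = (((2 * Real.pi) ^ 3 : ℝ)⁻¹ : ℝ) *
      ∫ η, ((‖η‖⁻¹ : ℝ) : ℂ) * corr U U η * Complex.exp ((inner ℝ x η : ℝ) * Complex.I) := by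
  obtain ⟨C, -, hC⟩ := exists_integral_inv_norm_mul_le
  have iH := integrable_corr iU iU
  set φ1 : Plane → ℂ := fun z => ((‖ift U (x - z)‖ ^ 2 : ℝ) : ℂ) with hφ1
  set φ2 : Plane → ℂ := fun η => Complex.exp ((inner ℝ x η : ℝ) * Complex.I) * corr U U η with hφ2
  have cφ1 : Continuous φ1 := by fun_prop
  have iφ1 : Integrable φ1 := (hρ.comp_sub_left x).ofReal
  have cE : Continuous fun η : Plane => Complex.exp ((inner ℝ x η : ℝ) * Complex.I) := by fun_prop
  have nE : ∀ (x η : Plane), ‖Complex.exp ((inner ℝ x η : ℝ) * Complex.I)‖ = 1 :=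
    fun x η => Complex.norm_exp_ofReal_mul_I _
  have iφ2 : Integrable φ2 :=
    iH.bdd_mul (c := 1) cE.aestronglyMeasurable (Filter.Eventually.of_forall fun z => (nE _ _).le)
  have jφ1 := (hC φ1 (b ^ 2) _ iφ1 (fun z => by
    rw [hφ1, Complex.norm_real, norm_pow, norm_norm]; gcongr; exact hbI _) le_rfl).1
  have jφ2 := (hC φ2 (a * ∫ ξ, ‖U ξ‖) _ iφ2 (fun z => by
    rw [hφ2, norm_mul, nE, one_mul]; exact norm_corr_le hb iU z) le_rfl).1
  -- The kernel is a superposition of Gaussians, `|z|⁻¹ = (2/√π)∫₀^∞ e^{-s²|z|²} ds`. Each has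
  -- transform `π s⁻² e^{-|η|²/(4s²)}`, and integrating over `s` gives `π√π/|η|`. Only absolutely
  -- convergent integrals occur, and the constants combine to `(2/√π)(2π)⁻⁴ π√π = (2π)⁻³`.
  have s1 := integral_superposition (G := fun y s => Real.exp (-(s ^ 2) * ‖y‖ ^ 2))
    (κ := Real.sqrt Real.pi / 2) (by unfold Function.uncurry; fun_prop) (fun y s => (Real.exp_pos _).le)
    (fun y hy => by
      have hy0 : 0 < ‖y‖ := norm_pos_iff.2 hy
      have := (integrable_exp_neg_mul_sq (b := ‖y‖ ^ 2) (by positivity)).integrableOn (s := Ioi 0)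
      refine this.congr_fun (fun s _ => ?_) measurableSet_Ioi
      ring_nf)
    (fun y hy => by
      have hy0 : 0 < ‖y‖ := norm_pos_iff.2 hy
      have := integral_gaussian_Ioi (‖y‖ ^ 2)
      rw [Real.sqrt_div Real.pi_pos.le, Real.sqrt_sq hy0.le] at this
      calc _ = ∫ s in Ioi (0 : ℝ), Real.exp (-‖y‖ ^ 2 * s ^ 2) := by congr 1; ext s; ring_nf
        _ = _ := by rw [this]; ring) cφ1.aestronglyMeasurable jφ1
  have s2 := integral_superposition
    (G := fun y s => (s ^ 2)⁻¹ * Real.exp (-(‖y‖ ^ 2 / 4) * (s ^ 2)⁻¹))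
    (κ := Real.sqrt Real.pi) (by unfold Function.uncurry; fun_prop) (fun y s => by positivity)
    (fun y hy => by
      have hy0 : 0 < ‖y‖ := norm_pos_iff.2 hy
      exact (integrableOn_inv_sq_gaussian (by positivity)).1)
    (fun y hy => by
      have hy0 : 0 < ‖y‖ := norm_pos_iff.2 hy
      rw [(integrableOn_inv_sq_gaussian (by positivity)).2, Real.sqrt_div Real.pi_pos.le,
        show ‖y‖ ^ 2 / 4 = (‖y‖ / 2) ^ 2 by ring, Real.sqrt_sq (by positivity)]
      field_simp) iφ2.1 jφ2
  have step : ∀ s ∈ Ioi (0 : ℝ), ∫ z, ((Real.exp (-(s ^ 2) * ‖z‖ ^ 2) : ℝ) : ℂ) * φ1 z =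
      ((((2 * Real.pi) ^ 4 : ℝ)⁻¹ * Real.pi : ℝ) : ℂ) *
      ∫ η, (((s ^ 2)⁻¹ * Real.exp (-(‖η‖ ^ 2 / 4) * (s ^ 2)⁻¹) : ℝ) : ℂ) * φ2 η := by
    intro s hs
    have hs0 : 0 < s := hs
    have iK : Integrable fun z : Plane => ((Real.exp (-(s ^ 2) * ‖z‖ ^ 2) : ℝ) : ℂ) := by
      have := (integral_gaussian_fourier hs0 0).1
      simpa using this
    have hp : Integrable (fun p : Plane × Plane => ((Real.exp (-(s ^ 2) * ‖p.1‖ ^ 2) : ℝ) : ℂ) *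
        (Complex.exp ((inner ℝ (x - p.1) p.2 : ℝ) * Complex.I) * corr U U p.2)) (volume.prod volume) := by
      have h1 := iK.mul_prod iH
      have h2 : Continuous fun p : Plane × Plane =>
          Complex.exp ((inner ℝ (x - p.1) p.2 : ℝ) * Complex.I) := by fun_prop
      refine (h1.bdd_mul (c := 1) h2.aestronglyMeasurable
        (Filter.Eventually.of_forall fun p => (nE _ _).le)).congr (Filter.Eventually.of_forall fun p => ?_)
      dsimp only; ring
    calc _ = ∫ z, (((2 * Real.pi) ^ 4 : ℝ)⁻¹ : ℝ) * ∫ η, ((Real.exp (-(s ^ 2) * ‖z‖ ^ 2) : ℝ) : ℂ) *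
          (Complex.exp ((inner ℝ (x - z) η : ℝ) * Complex.I) * corr U U η) := by
          congr 1; ext z
          simp only [hφ1]
          rw [norm_ift_sq_eq iU, integral_const_mul]; ring
      _ = (((2 * Real.pi) ^ 4 : ℝ)⁻¹ : ℝ) * ∫ η, ∫ z, ((Real.exp (-(s ^ 2) * ‖z‖ ^ 2) : ℝ) : ℂ) *
          (Complex.exp ((inner ℝ (x - z) η : ℝ) * Complex.I) * corr U U η) := by
          rw [integral_const_mul, integral_integral_swap hp]
      _ = (((2 * Real.pi) ^ 4 : ℝ)⁻¹ : ℝ) * ∫ η,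
          ((Real.pi * ((s ^ 2)⁻¹ * Real.exp (-(‖η‖ ^ 2 / 4) * (s ^ 2)⁻¹)) : ℝ) : ℂ) * φ2 η := by
          congr 2; ext η
          rw [← (integral_gaussian_fourier hs0 η).2, ← integral_mul_const]
          congr 1; ext z
          have : Complex.exp ((inner ℝ (x - z) η : ℝ) * Complex.I) =
              Complex.exp ((-inner ℝ z η : ℝ) * Complex.I) *
                Complex.exp ((inner ℝ x η : ℝ) * Complex.I) := by
            rw [← Complex.exp_add, inner_sub_left]; congr 1; push_cast; ring
          rw [this, hφ2]; ring
      _ = _ := by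
          push_cast
          rw [mul_assoc, ← integral_const_mul (Real.pi : ℂ)]
          congr 2; ext η; ring
  rw [setIntegral_congr_fun measurableSet_Ioi step, integral_const_mul, s2] at s1
  have hV : (hartreePotential (ift U) x : ℂ) = ∫ y, ((‖y‖⁻¹ : ℝ) : ℂ) * φ1 y := by
    rw [hartreePotential, ← integral_sub_left_eq_self _ _ x]
    simp only [sub_sub_cancel]
    refine integral_ofReal.symm.trans ?_
    congr 1; ext z
    exact Complex.ofReal_mul _ _
  have hR : ∫ η, ((‖η‖⁻¹ : ℝ) : ℂ) * corr U U η * Complex.exp ((inner ℝ x η : ℝ) * Complex.I)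
      = ∫ η, ((‖η‖⁻¹ : ℝ) : ℂ) * φ2 η := by
    congr 1; ext η; rw [hφ2]; ring
  rw [hV, hR]
  have hπ : (Real.sqrt Real.pi : ℂ) ≠ 0 := by
    exact_mod_cast (Real.sqrt_pos.2 Real.pi_pos).ne'
  have hπ' : (Real.pi : ℂ) ≠ 0 := by exact_mod_cast Real.pi_pos.ne'
  have s3 := congrArg (fun z => z * (2 / (Real.sqrt Real.pi : ℂ))) s1
  push_cast at s3 ⊢
  field_simp at s3 ⊢
  linear_combination -s3

theorem ift_eq_ft_neg (U : Plane → ℂ) (x : Plane) :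
    ift U x = ((2 * Real.pi) ^ 2 : ℝ)⁻¹ * ft U (-x) := by
  rw [ift, ft]
  congr 2; ext ξ
  rw [inner_neg_right, real_inner_comm]
  push_cast; rw [neg_mul, neg_neg]

theorem continuous_ift {U : Plane → ℂ} (iU : Integrable U) : Continuous (ift U) := by
  have h := continuous_ft iU
  have e : ift U = fun x => (((2 * Real.pi) ^ 2 : ℝ)⁻¹ : ℝ) * ft U (-x) := by
    ext x; rw [ift_eq_ft_neg]
  rw [e]; fun_prop

theorem norm_ift_le (U : Plane → ℂ) (x : Plane) :
    ‖ift U x‖ ≤ ((2 * Real.pi) ^ 2)⁻¹ * ∫ ξ, ‖U ξ‖ := by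
  rw [ift_eq_ft_neg, norm_mul, Complex.norm_real, Real.norm_of_nonneg (by positivity)]
  gcongr
  exact norm_ft_le U _

theorem ift_congr {U V : Plane → ℂ} (h : U =ᵐ[volume] V) : ift U = ift V := by
  ext x
  rw [ift, ift]
  congr 1
  refine integral_congr_ae ?_
  filter_upwards [h] with ξ hξ
  rw [hξ]

/-- The Fourier transform of the Hartree nonlinearity. -/
theorem hat_hartree {g N : L2} {U : Plane → ℂ} (iU : Integrable U) {a : ℝ}
    (hb : ∀ ξ, ‖U ξ‖ ≤ a) (hg : hat g =ᵐ[volume] U)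
    (hN : (N : Plane → ℂ) =ᵐ[volume] fun x => (hartreePotential g x : ℂ) * g x) :
    hat N =ᵐ[volume] fun ξ => (((2 * Real.pi) ^ 3 : ℝ)⁻¹ : ℝ) * hartreeHat U ξ := by
  obtain ⟨C, -, hC⟩ := exists_integral_inv_norm_mul_le
  have iH := integrable_corr iU iU
  have jH := (hC _ (a * ∫ ξ, ‖U ξ‖) _ iH (fun z => norm_corr_le hb iU z) le_rfl).1
  set k : Plane → ℂ := fun η => ((‖η‖⁻¹ : ℝ) : ℂ) * corr U U η with hk
  have ik : Integrable k := jH.congr'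
    ((Complex.measurable_ofReal.comp measurable_norm.inv).aestronglyMeasurable.mul iH.1)
    (Filter.Eventually.of_forall fun η => by
      rw [hk, norm_mul, norm_mul, Complex.norm_real, norm_norm, norm_inv, norm_norm])
  have hgI : (g : Plane → ℂ) =ᵐ[volume] ift U := by
    rw [← ift_congr hg]
    exact ae_eq_ift_hat (iU.congr hg.symm)
  have hV : hartreePotential (g : Plane → ℂ) = hartreePotential (ift U) := by
    ext x
    refine integral_congr_ae ?_
    filter_upwards [hgI] with y hy
    rw [hy]
  have hρ : Integrable fun y => ‖ift U y‖ ^ 2 :=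
    (memLp_two_iff_integrable_sq_norm (continuous_ift iU).aestronglyMeasurable).1
      ((memLp_congr_ae hgI).1 (Lp.memLp g))
  set c : ℂ := ((((2 * Real.pi) ^ 3 : ℝ)⁻¹ : ℝ) : ℂ) with hc
  have hpot := hartreePotential_ift iU hb hρ (continuous_ift iU) (norm_ift_le U)
  have hprod : Integrable (fun p : Plane × Plane => k p.2 * U (p.1 - p.2)) (volume.prod volume) := by
    simpa using ik.convolution_integrand (ContinuousLinearMap.mul ℂ ℂ) iU
  set W : Plane → ℂ := fun ξ => c * hartreeHat U ξ with hW
  have iW : Integrable W := hprod.integral_prod_left.const_mul c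
  have bW : ∀ ξ, ‖W ξ‖ ≤ ‖c‖ * (a * ∫ η, ‖k η‖) := fun ξ => by
    rw [hW, norm_mul]
    gcongr
    rw [hartreeHat, ← integral_const_mul]
    refine norm_integral_le_of_norm_le (ik.norm.const_mul a) (Filter.Eventually.of_forall fun η => ?_)
    rw [norm_mul, mul_comm]
    gcongr
    exact hb _
  have mW : MemLp W 2 volume := by
    rw [memLp_two_iff_integrable_sq_norm iW.1]
    refine (iW.norm.const_mul (‖c‖ * (a * ∫ η, ‖k η‖))).mono' (iW.1.norm.pow 2)
      (Filter.Eventually.of_forall fun ξ => ?_)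
    rw [Real.norm_of_nonneg (by positivity), pow_two]
    gcongr
    exact bW ξ
  -- The transform of the product is not computed directly. The expected answer `W`, bounded and
  -- integrable, defines some `h` in `L²`; Fubini turns its inverse transform into potential times
  -- `u`, so `h` is the nonlinearity.
  obtain ⟨h, hh⟩ := exists_hat_ae_eq mW
  have hhI : (h : Plane → ℂ) =ᵐ[volume] ift W := by
    rw [← ift_congr hh]
    exact ae_eq_ift_hat (iW.congr hh.symm)
  have hiftW : ∀ x, ift W x = (hartreePotential (ift U) x : ℂ) * ift U x := fun x => by
    set E : Plane → ℂ := fun ξ => Complex.exp ((inner ℝ x ξ : ℝ) * Complex.I) with hE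
    have cE : Continuous E := by fun_prop
    have nE : ∀ ξ, ‖E ξ‖ = 1 := fun ξ => Complex.norm_exp_ofReal_mul_I _
    have hEm : ∀ ξ η, E ξ = E (ξ - η) * E η := fun ξ η => by
      simp only [hE]
      rw [← Complex.exp_add, inner_sub_right]; congr 1; push_cast; ring
    have hp' : Integrable (fun p : Plane × Plane => E p.1 * (k p.2 * U (p.1 - p.2)))
        (volume.prod volume) :=
      hprod.bdd_mul (c := 1) (cE.comp continuous_fst).aestronglyMeasurable
        (Filter.Eventually.of_forall fun z => (nE _).le)
    have e1 : ∫ ξ, E ξ * hartreeHat U ξ = (∫ η, k η * E η) * ∫ ξ, E ξ * U ξ := by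
      calc ∫ ξ, E ξ * hartreeHat U ξ = ∫ ξ, ∫ η, E ξ * (k η * U (ξ - η)) := by
            congr 1; ext ξ; rw [hartreeHat, integral_const_mul]
        _ = ∫ η, ∫ ξ, E ξ * (k η * U (ξ - η)) := integral_integral_swap hp'
        _ = ∫ η, k η * E η * ∫ ξ, E ξ * U ξ := by
            congr 1; ext η
            rw [← integral_const_mul,
              ← integral_sub_right_eq_self (fun ξ => k η * E η * (E ξ * U ξ)) η]
            congr 1; ext ξ
            rw [hEm ξ η]; ring
        _ = _ := integral_mul_const _ _
    have e2 : ∫ ξ, E ξ * W ξ = c * ∫ ξ, E ξ * hartreeHat U ξ := by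
      rw [← integral_const_mul]; congr 1; ext ξ; rw [hW]; ring
    rw [hpot x]
    change _ * ∫ ξ, E ξ * W ξ = c * (∫ η, k η * E η) * (_ * ∫ ξ, E ξ * U ξ)
    rw [e2, e1]; ring
  have hNh : N = h := by
    apply Lp.ext
    filter_upwards [hN, hhI, hgI] with x h1 h2 h3
    rw [h1, h2, hiftW, hV, h3]
  rw [hNh]
  exact hh

/-! ### From the a priori norm to bounds on the profile. -/

theorem eLpNorm_le_sobolevNorm {s : ℝ} (hs : 0 ≤ s) (g : L2) : eLpNorm g 2 volume ≤ sobolevNorm s g := by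
  have h1 : eLpNorm g 2 volume = ENNReal.ofReal (2 * Real.pi)⁻¹ * eLpNorm (hat g) 2 volume := by
    rw [eLpNorm_hat, ← mul_assoc, ← ENNReal.ofReal_mul (by positivity),
      inv_mul_cancel₀ (by positivity), ENNReal.ofReal_one, one_mul]
  rw [h1, sobolevNorm]
  gcongr
  refine eLpNorm_mono fun ξ => ?_
  rw [norm_mul, Complex.norm_real, Real.norm_of_nonneg (Real.rpow_nonneg (jap_pos ξ).le _)]
  exact le_mul_of_one_le_left (norm_nonneg _) (Real.one_le_rpow (one_le_jap ξ) hs)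

theorem eLpNorm_le_weightedSobolevNorm {s : ℝ} (hs : 0 ≤ s) (w : Plane → ℝ) (g : L2) :
    eLpNorm (fun x => (w x : ℂ) * g x) 2 volume ≤ weightedSobolevNorm w s g := by
  refine le_iInf₂ fun h hh => ?_
  rw [← eLpNorm_congr_ae hh]
  exact eLpNorm_le_sobolevNorm hs h

theorem le_ofReal_of_mul_le {c a b : ℝ} (hc : 0 < c) {x : ℝ≥0∞}
    (h : ENNReal.ofReal (c ^ (-b)) * x ≤ ENNReal.ofReal a) : x ≤ ENNReal.ofReal (a * c ^ b) := by
  have e : ENNReal.ofReal (c ^ b) * ENNReal.ofReal (c ^ (-b)) = 1 := by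
    rw [← ENNReal.ofReal_mul (by positivity), ← Real.rpow_add hc]; simp
  calc x = ENNReal.ofReal (c ^ b) * (ENNReal.ofReal (c ^ (-b)) * x) := by
        rw [← mul_assoc, e, one_mul]
    _ ≤ ENNReal.ofReal (c ^ b) * ENNReal.ofReal a := by gcongr
    _ = _ := by rw [← ENNReal.ofReal_mul (by positivity), mul_comm]

/-- The a priori norm controls the profile `e^{it⟨D⟩}u(t)`. -/
theorem profileBound_of_normSigma_le {n k T a : ℝ} (hn : 0 ≤ n) (ha : 0 ≤ a) {u : ℝ → L2}
    (h : normSigma n k (1 / 100) T u ≤ ENNReal.ofReal a) {t : ℝ} (ht : t ∈ Icc 0 T) :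
    ProfileBound n (7 * a * jap t ^ (1 / 50 : ℝ)) (expItD t (u t)) ∧
      hat (u t) =ᵐ[volume] evol t (expItD t (u t)) := by
  have hj : 0 < jap t := by unfold jap; positivity
  have hj1 : 1 ≤ jap t := by
    unfold jap
    rw [Real.one_le_sqrt]; nlinarith [norm_nonneg t]
  set g := expItD t (u t) with hg
  have hsum := (le_iSup₂ (f := fun t (_ : t ∈ Icc (0 : ℝ) T) =>
    (ENNReal.ofReal (jap t ^ (-(1 / 100 : ℝ))) * normE1 n t (u t)
      + ENNReal.ofReal (jap t ^ (-(2 * (1 / 100 : ℝ)))) * normE2 t (u t)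
      + normS k (u t))) t ht).trans h
  have h1 := le_ofReal_of_mul_le hj ((le_self_add.trans le_self_add).trans hsum)
  have h2 := le_ofReal_of_mul_le hj ((le_add_self.trans le_self_add).trans hsum)
  rw [show (2 * (1 / 100) : ℝ) = 1 / 50 by norm_num] at h2
  have hp : jap t ^ (1 / 100 : ℝ) ≤ jap t ^ (1 / 50 : ℝ) :=
    Real.rpow_le_rpow_of_exponent_le hj1 (by norm_num)
  set b := a * jap t ^ (1 / 50 : ℝ) with hb
  have hb0 : 0 ≤ b := by positivity
  have h1' : normE1 n t (u t) ≤ ENNReal.ofReal b :=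
    h1.trans (ENNReal.ofReal_le_ofReal (by rw [hb]; gcongr))
  have hS : sobolevNorm n (u t) ≤ ENNReal.ofReal b := le_self_add.trans h1'
  have hhat := hat_expItD t (u t)
  -- the weight
  have hg2 : eLpNorm g 2 volume ≤ ENNReal.ofReal b := by
    have e1 : ENNReal.ofReal (2 * Real.pi) * eLpNorm g 2 volume =
        ENNReal.ofReal (2 * Real.pi) * eLpNorm (u t) 2 volume := by
      rw [← eLpNorm_hat, ← eLpNorm_hat, eLpNorm_congr_ae hhat]
      refine eLpNorm_congr_norm_ae (Filter.Eventually.of_forall fun ξ => ?_)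
      rw [norm_mul, Complex.norm_exp_ofReal_mul_I, one_mul]
    have e2 := (ENNReal.mul_right_inj (by simp [Real.pi_pos]) ENNReal.ofReal_ne_top).1 e1
    rw [e2]
    exact (eLpNorm_le_sobolevNorm hn _).trans hS
  have hxx : ∀ j : Fin 2, eLpNorm (fun x : Plane => ((x j * x j : ℝ) : ℂ) * g x) 2 volume ≤
      ENNReal.ofReal b := fun j => by
    refine (eLpNorm_le_weightedSobolevNorm (s := 2) (by norm_num) (fun x => x j * x j) g).trans
      (le_trans ?_ h2)
    rw [normE2]
    exact (Finset.single_le_sum (f := fun i => weightedSobolevNorm (fun x => x j * x i) 2 g)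
      (fun _ _ => zero_le) (Finset.mem_univ j)).trans
      (Finset.single_le_sum (f := fun i => ∑ l : Fin 2, weightedSobolevNorm (fun x => x i * x l) 2 g)
      (fun _ _ => zero_le) (Finset.mem_univ j))
  have hw : eLpNorm (fun x => ((jap x ^ 2 : ℝ) : ℂ) * g x) 2 volume ≤ ENNReal.ofReal (3 * b) := by
    have e : (fun x => ((jap x ^ 2 : ℝ) : ℂ) * g x) = (fun x => g x) +
        ((fun x : Plane => ((x 0 * x 0 : ℝ) : ℂ) * g x)
          + fun x : Plane => ((x 1 * x 1 : ℝ) : ℂ) * g x) := by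
      ext x
      rw [jap_sq, EuclideanSpace.norm_sq_eq, Fin.sum_univ_two]
      simp only [Pi.add_apply, Real.norm_eq_abs, sq_abs]
      push_cast; ring
    have m : ∀ j : Fin 2, AEStronglyMeasurable (fun x : Plane => ((x j * x j : ℝ) : ℂ) * g x) volume :=
      fun j => (by fun_prop : Continuous fun x : Plane => ((x j * x j : ℝ) : ℂ)).aestronglyMeasurable.mul
        (Lp.aestronglyMeasurable g)
    rw [e]
    refine (eLpNorm_add_le (Lp.aestronglyMeasurable g) ((m 0).add (m 1)) (by norm_num)).trans ?_
    refine (add_le_add hg2 ((eLpNorm_add_le (m 0) (m 1) (by norm_num)).trans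
      (add_le_add (hxx 0) (hxx 1)))).trans ?_
    rw [← ENNReal.ofReal_add hb0 hb0, ← ENNReal.ofReal_add hb0 (by positivity)]
    exact ENNReal.ofReal_le_ofReal (by linarith)
  -- Integrability allows the transform, defined up to null sets, to be replaced by the continuous
  -- function `ft g`.
  have ig : Integrable (g : Plane → ℂ) := by
    have m := Lp.aestronglyMeasurable g
    have hwm : MemLp (fun x : Plane => ((jap x ^ 2 : ℝ) : ℂ) * g x) 2 volume :=
      ⟨(by have := continuous_jap (E := Plane); fun_prop : Continuous fun x : Plane =>
        ((jap x ^ 2 : ℝ) : ℂ)).aestronglyMeasurable.mul m, hw.trans_lt ENNReal.ofReal_lt_top⟩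
    refine (memLp_one_iff_integrable.1 ((memLp_jap_rpow (s := -2) (by norm_num)).ofReal (K := ℂ)
      |>.mul (r := 1) hwm)).congr (Filter.Eventually.of_forall fun x => ?_)
    have hx := jap_pos x
    have : ((jap x ^ 2 : ℝ) : ℂ) * ((jap x ^ (-2 : ℝ) : ℝ) : ℂ) = 1 := by
      rw [← Complex.ofReal_mul, Real.rpow_neg hx.le, show jap x ^ (2 : ℝ) = jap x ^ 2 by norm_cast,
        mul_inv_cancel₀ (by positivity), Complex.ofReal_one]
    calc _ = (((jap x ^ 2 : ℝ) : ℂ) * ((jap x ^ (-2 : ℝ) : ℝ) : ℂ)) * g x :=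
          mul_right_comm _ _ _
      _ = g x := by rw [this, one_mul]
  have hft := hat_ae_eq_ft ig
  have hU : hat (u t) =ᵐ[volume] evol t g := by
    filter_upwards [hhat, hft] with ξ h1 h2
    rw [evol, ← h2, h1, phase, ← mul_assoc, ← Complex.exp_add, ← add_mul]
    simp
  -- The constant `7` covers both `3`, from `⟨x⟩² = 1 + x₀² + x₁²`, and `2π`, from the normalization
  -- of the Sobolev norm.
  refine ⟨⟨Lp.aestronglyMeasurable g, hw.trans (ENNReal.ofReal_le_ofReal (by linarith)), ?_⟩, hU⟩
  have hS' : eLpNorm (fun ξ : Plane => ((jap ξ ^ n : ℝ) : ℂ) * hat (u t) ξ) 2 volume ≤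
      ENNReal.ofReal (2 * Real.pi * b) := by
    rw [sobolevNorm] at hS
    calc _ = ENNReal.ofReal (2 * Real.pi) * (ENNReal.ofReal (2 * Real.pi)⁻¹ *
          eLpNorm (fun ξ : Plane => ((jap ξ ^ n : ℝ) : ℂ) * hat (u t) ξ) 2 volume) := by
          rw [← mul_assoc, ← ENNReal.ofReal_mul (by positivity),
            mul_inv_cancel₀ (by positivity), ENNReal.ofReal_one, one_mul]
      _ ≤ ENNReal.ofReal (2 * Real.pi) * ENNReal.ofReal b := by gcongr
      _ = _ := (ENNReal.ofReal_mul (by positivity)).symm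
  have e : eLpNorm (fun ξ => ((jap ξ ^ n : ℝ) : ℂ) * ft g ξ) 2 volume =
      eLpNorm (fun ξ : Plane => ((jap ξ ^ n : ℝ) : ℂ) * hat (u t) ξ) 2 volume := by
    refine eLpNorm_congr_norm_ae ?_
    filter_upwards [hU] with ξ hξ
    rw [norm_mul, norm_mul, hξ, norm_evol]
  rw [e]
  refine hS'.trans (ENNReal.ofReal_le_ofReal ?_)
  have := Real.pi_lt_d2
  nlinarith

/-! ### Growth of `|û|²` in time. -/

theorem jap_time_le {t : ℝ} (ht : 0 ≤ t) : jap t ≤ 1 + t := by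
  unfold jap
  rw [Real.sqrt_le_left (by linarith), Real.norm_of_nonneg ht]
  nlinarith

theorem one_le_jap_time (t : ℝ) : 1 ≤ jap t := by
  unfold jap
  rw [Real.one_le_sqrt]; nlinarith [norm_nonneg t]

/-- The growth rate of `|û(t, ξ)|²` is integrable in time. -/
theorem exists_abs_im_hartreeHat_weighted_le {n k : ℝ} (hn : 1000 ≤ n) (hk : k = n / 100) :
    ∃ C : ℝ, 0 < C ∧ ∀ (B : ℝ) (f : Plane → ℂ) (t : ℝ), 0 ≤ B → 0 ≤ t →
      ProfileBound n (B * jap t ^ (1 / 50 : ℝ)) f → ∀ ξ : Plane, jap ξ ^ (n / 3) *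
        |((starRingEnd ℂ) (evol t f ξ) * hartreeHat (evol t f) ξ).im| ≤
          C * B ^ 4 * (1 + t) ^ (-(26 / 25) : ℝ) := by
  obtain ⟨C0, hC0, h0⟩ := exists_ft_decay (n := n) (by linarith)
  obtain ⟨C1, hC1, h1⟩ := exists_abs_im_hartreeHat_le hn hk
  refine ⟨4 * C1 * C0, by positivity, fun B f t hB ht hf ξ => ?_⟩
  have hjt := one_le_jap_time t
  have hjt0 : 0 < jap t := by linarith
  set β := B * jap t ^ (1 / 50 : ℝ) with hβdef
  have hβ : 0 ≤ β := by positivity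
  have hj := jap_pos ξ
  obtain ⟨b1, b2⟩ := h1 β f hβ hf
  have hd := h0 β f hβ hf ξ
  set τ := 1 + t with hτ
  have hτ0 : 0 < τ := by linarith
  have hτ1 : 1 ≤ τ := by linarith
  have h4 : (2 : ℝ) ^ (28 / 25 : ℝ) ≤ 4 := by
    calc (2 : ℝ) ^ (28 / 25 : ℝ) ≤ 2 ^ (2 : ℝ) :=
          Real.rpow_le_rpow_of_exponent_le (by norm_num) (by norm_num)
      _ = 4 := by norm_num
  -- Three factors `β` come from the nonlinearity and one from `û`. Their growth `t^{4/50}` turns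
  -- the rate `-28/25` into `-26/25`, still below `-1`.
  have hβ4 : β ^ 4 ≤ B ^ 4 * τ ^ (2 / 25 : ℝ) := by
    calc β ^ 4 = B ^ 4 * jap t ^ (2 / 25 : ℝ) := by
          rw [hβdef, mul_pow, ← Real.rpow_natCast (jap t ^ _), ← Real.rpow_mul hjt0.le]; norm_num
      _ ≤ _ := by gcongr; exact jap_time_le ht
  -- the bound without time weights
  have key : jap ξ ^ (n / 3) * |((starRingEnd ℂ) (evol t f ξ) * hartreeHat (evol t f) ξ).im| ≤
      C1 * C0 * β ^ 4 * (4 * τ ^ (-(28 / 25) : ℝ)) := by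
    rcases le_or_gt 1 t with h | h
    · have e : t ^ (-(28 / 25) : ℝ) ≤ 4 * τ ^ (-(28 / 25) : ℝ) := by
        calc t ^ (-(28 / 25) : ℝ) ≤ (τ / 2) ^ (-(28 / 25) : ℝ) :=
              Real.rpow_le_rpow_of_nonpos (by positivity) (by linarith) (by norm_num)
          _ = 2 ^ (28 / 25 : ℝ) * τ ^ (-(28 / 25) : ℝ) := by
              rw [Real.div_rpow hτ0.le (by norm_num), Real.rpow_neg (by norm_num : (0 : ℝ) ≤ 2)]
              field_simp
          _ ≤ _ := by gcongr
      calc _ ≤ jap ξ ^ (n / 3) * (C1 * β ^ 3 * ‖ft f ξ‖ * t ^ (-(28 / 25) : ℝ)) := by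
            gcongr; exact b2 t h ξ
        _ = C1 * β ^ 3 * t ^ (-(28 / 25) : ℝ) * (jap ξ ^ (n / 3) * ‖ft f ξ‖) := by ring
        _ ≤ C1 * β ^ 3 * (4 * τ ^ (-(28 / 25) : ℝ)) * (C0 * β) := by gcongr
        _ = _ := by ring
    · have e : 1 ≤ 4 * τ ^ (-(28 / 25) : ℝ) := by
        have : τ ^ (28 / 25 : ℝ) ≤ 4 := (Real.rpow_le_rpow hτ0.le (by linarith) (by norm_num)).trans h4
        rw [Real.rpow_neg hτ0.le, ← div_eq_mul_inv, one_le_div (by positivity)]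
        exact this
      calc _ ≤ jap ξ ^ (n / 3) * (‖ft f ξ‖ * (C1 * β ^ 3)) := by
            gcongr
            refine (Complex.abs_im_le_norm _).trans ?_
            rw [norm_mul, RCLike.norm_conj, norm_evol]
            gcongr
            exact b1 t ξ
        _ = C1 * β ^ 3 * 1 * (jap ξ ^ (n / 3) * ‖ft f ξ‖) := by ring
        _ ≤ C1 * β ^ 3 * (4 * τ ^ (-(28 / 25) : ℝ)) * (C0 * β) := by gcongr
        _ = _ := by ring
  refine key.trans ?_
  calc _ ≤ C1 * C0 * (B ^ 4 * τ ^ (2 / 25 : ℝ)) * (4 * τ ^ (-(28 / 25) : ℝ)) := by gcongr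
    _ = 4 * C1 * C0 * B ^ 4 * (τ ^ (2 / 25 : ℝ) * τ ^ (-(28 / 25) : ℝ)) := by ring
    _ = _ := by rw [← Real.rpow_add hτ0]; norm_num

theorem fourier_ae_eq {g : L2} {U : Plane → ℂ} (h : hat g =ᵐ[volume] U) :
    ((𝓕 g : L2) : Plane → ℂ) =ᵐ[volume] fun η => U ((2 * Real.pi) • η) := by
  rw [fourier_ae_eq_hat_comp]
  exact ae_comp_smul (by positivity) h

/-- The left side is `Re(conj û ∂ₜû)`, half the growth rate of `|û|²`. The linear term contributes
`-i⟨ξ⟩|û|²`, which is purely imaginary, and `λ` is real, so only the imaginary part of the nonlinear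
term survives. -/
theorem fourier_solution_eq {lam : ℝ} {g ut Du Nu : L2} {U : Plane → ℂ}
    (iU : Integrable U) {a : ℝ} (hb : ∀ ξ, ‖U ξ‖ ≤ a) (hg : hat g =ᵐ[volume] U)
    (hD : IsMultiplier (fun ξ => (jap ξ : ℂ)) g Du)
    (hN : (Nu : Plane → ℂ) =ᵐ[volume] fun x => (hartreePotential g x : ℂ) * g x)
    (heq : -(Complex.I • ut) + Du = (lam : ℂ) • Nu) :
    ∀ᵐ η : Plane, inner ℝ ((𝓕 g : L2) η) ((𝓕 ut : L2) η) =
      -(lam * ((2 * Real.pi) ^ 3)⁻¹) * ((starRingEnd ℂ) (U ((2 * Real.pi) • η)) *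
        hartreeHat U ((2 * Real.pi) • η)).im := by
  have hut : ut = Complex.I • ((lam : ℂ) • Nu - Du) := by
    rw [← heq, add_sub_cancel_right, smul_neg, smul_smul, Complex.I_mul_I]; simp
  have hF : (𝓕 ut : L2) = Complex.I • ((lam : ℂ) • (𝓕 Nu : L2) - (𝓕 Du : L2)) := by
    change Lp.fourierTransformₗᵢ Plane ℂ ut = Complex.I • ((lam : ℂ) • Lp.fourierTransformₗᵢ Plane ℂ Nu
      - Lp.fourierTransformₗᵢ Plane ℂ Du)
    rw [hut, map_smul, map_sub, map_smul]
  have h1 := fourier_ae_eq hg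
  have h2 := fourier_ae_eq (hat_hartree iU hb hg hN)
  have h3 : hat Du =ᵐ[volume] fun ξ => (jap ξ : ℂ) * U ξ := by
    filter_upwards [hD, hg] with ξ a1 a2
    rw [a1, a2]
  have h4 := fourier_ae_eq h3
  rw [hF]
  filter_upwards [h1, h2, h4, Lp.coeFn_smul Complex.I ((lam : ℂ) • (𝓕 Nu : L2) - (𝓕 Du : L2)),
    Lp.coeFn_sub ((lam : ℂ) • (𝓕 Nu : L2)) (𝓕 Du : L2), Lp.coeFn_smul (lam : ℂ) (𝓕 Nu : L2)]
    with η a1 a2 a3 a4 a5 a6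
  rw [a4, Pi.smul_apply, a5, Pi.sub_apply, a6, Pi.smul_apply, a1, a2, a3, Complex.inner]
  generalize U ((2 * Real.pi) • η) = z
  generalize hartreeHat U ((2 * Real.pi) • η) = w
  simp only [smul_eq_mul, Complex.mul_re, Complex.mul_im, Complex.I_re, Complex.I_im, Complex.conj_re,
    Complex.conj_im, Complex.sub_re, Complex.sub_im, Complex.ofReal_re, Complex.ofReal_im]
  ring

/-- The restriction of the Fourier transform to a set. -/
noncomputable def fourierRestrict (s : Set Plane) : L2 →L[ℝ] Lp ℂ 2 (volume.restrict s) :=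
  ((LpToLpRestrictCLM Plane ℂ ℂ (volume : Measure Plane) 2 s).comp
    (Lp.fourierTransformₗᵢ Plane ℂ).toContinuousLinearEquiv.toContinuousLinearMap).restrictScalars ℝ

theorem fourierRestrict_ae (s : Set Plane) (g : L2) :
    (fourierRestrict s g : Plane → ℂ) =ᵐ[volume.restrict s] ((𝓕 g : L2) : Plane → ℂ) :=
  LpToLpRestrictCLM_coeFn ℂ s _

theorem inner_fourierRestrict (s : Set Plane) (g h : L2) :
    inner ℝ (fourierRestrict s g) (fourierRestrict s h) =
      ∫ η in s, inner ℝ ((𝓕 g : L2) η) ((𝓕 h : L2) η) := by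
  rw [L2.inner_def]
  refine integral_congr_ae ?_
  filter_upwards [fourierRestrict_ae s g, fourierRestrict_ae s h] with η h1 h2
  rw [h1, h2]

theorem norm_fourierRestrict_sq (s : Set Plane) (g : L2) :
    ‖fourierRestrict s g‖ ^ 2 = ∫ η in s, ‖(𝓕 g : L2) η‖ ^ 2 := by
  rw [← real_inner_self_eq_norm_sq, inner_fourierRestrict]
  simp only [real_inner_self_eq_norm_sq]

theorem hasDerivAt_neg_rpow_one_add {t : ℝ} (ht : 0 ≤ t) (c d : ℝ) :
    HasDerivAt (fun s : ℝ => c + d * (25 * (1 - (1 + s) ^ (-(1 / 25) : ℝ))))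
      (d * (1 + t) ^ (-(26 / 25) : ℝ)) t := by
  have h1 : HasDerivAt (fun s : ℝ => 1 + s) 1 t := (hasDerivAt_id t).const_add 1
  have h2 := h1.rpow_const (p := -(1 / 25)) (Or.inl (by linarith))
  have h3 := (((h2.const_sub 1).const_mul 25).const_mul d).const_add c
  have e : (-(1 / 25) - 1 : ℝ) = -(26 / 25) := by norm_num
  rw [e] at h3
  exact h3.congr_deriv (by ring)

/-- Integration in time of the growth rate, tested on a set of frequencies. -/
theorem setIntegral_fourier_sq_le {lam T : ℝ} {u : ℝ → L2} (hu : IsSolution lam T u)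
    {U : ℝ → Plane → ℂ} {a : ℝ → ℝ} (iU : ∀ t ∈ Icc 0 T, Integrable (U t))
    (hb : ∀ t ∈ Icc 0 T, ∀ ξ, ‖U t ξ‖ ≤ a t)
    (hhat : ∀ t ∈ Icc 0 T, hat (u t) =ᵐ[volume] U t) {s : Set Plane} (hsm : MeasurableSet s)
    (hs : volume s < ⊤) {D D0 : ℝ} (hD0 : 0 ≤ D)
    (hinit : ∀ η ∈ s, ‖U 0 ((2 * Real.pi) • η)‖ ^ 2 ≤ D0)
    (hrate : ∀ t ∈ Icc 0 T, ∀ η ∈ s, |((starRingEnd ℂ) (U t ((2 * Real.pi) • η)) *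
        hartreeHat (U t) ((2 * Real.pi) • η)).im| ≤ D * (1 + t) ^ (-(26 / 25) : ℝ))
    {t : ℝ} (ht : t ∈ Icc 0 T) :
    ∫ η in s, ‖U t ((2 * Real.pi) • η)‖ ^ 2 ≤ (D0 + 50 * |lam| * D) * volume.real s := by
  have hT : 0 ≤ T := ht.1.trans ht.2
  have hv0 : 0 ≤ volume.real s := measureReal_nonneg
  have eU : ∀ t ∈ Icc 0 T, ∫ η in s, ‖U t ((2 * Real.pi) • η)‖ ^ 2 = ‖fourierRestrict s (u t)‖ ^ 2 := by
    intro t ht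
    rw [norm_fourierRestrict_sq]
    refine setIntegral_congr_ae hsm ?_
    filter_upwards [fourier_ae_eq (hhat t ht)] with η h1 _
    rw [h1]
  choose! ut Du Nu hder hmul hN heq using hu
  -- The time derivative exists in `L²` and `û(t)` only almost everywhere, so no differential
  -- equation at a fixed frequency is available. The mass of `û` on `s` is the squared norm of a
  -- bounded linear image of `u`, hence differentiable.
  have hder' : ∀ t ∈ Icc 0 T, HasDerivWithinAt (fun t => ‖fourierRestrict s (u t)‖ ^ 2)
      (2 * inner ℝ (fourierRestrict s (u t)) (fourierRestrict s (ut t))) (Icc 0 T) t := fun t ht =>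
    (((fourierRestrict s).hasFDerivAt).comp_hasDerivWithinAt t (hder t ht)).norm_sq
  set E := 2 * |lam| * D * volume.real s with hE
  have hrate' : ∀ t ∈ Icc 0 T, 2 * inner ℝ (fourierRestrict s (u t)) (fourierRestrict s (ut t)) ≤
      E * (1 + t) ^ (-(26 / 25) : ℝ) := fun t ht => by
    have ht0 : 0 ≤ t := ht.1
    rw [inner_fourierRestrict]
    have hc : ((2 * Real.pi) ^ 3)⁻¹ ≤ 1 := by
      apply inv_le_one_of_one_le₀
      apply one_le_pow₀
      linarith [Real.pi_gt_three]
    have h := norm_setIntegral_le_of_norm_le_const_ae' (μ := volume)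
      (f := fun η => inner ℝ ((𝓕 (u t) : L2) η) ((𝓕 (ut t) : L2) η))
      (C := |lam| * D * (1 + t) ^ (-(26 / 25) : ℝ)) hs (by
        filter_upwards [fourier_solution_eq (iU t ht) (hb t ht) (hhat t ht) (hmul t ht) (hN t ht)
          (heq t ht)] with η h1 hη
        rw [h1, norm_mul, norm_neg, norm_mul, Real.norm_eq_abs, Real.norm_eq_abs, Real.norm_eq_abs,
          abs_of_pos (by positivity : 0 < ((2 * Real.pi) ^ 3)⁻¹)]
        calc _ ≤ |lam| * 1 * (D * (1 + t) ^ (-(26 / 25) : ℝ)) := by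
              gcongr; exact hrate t ht η hη
          _ = _ := by ring)
    have h' := (le_abs_self _).trans h
    calc _ ≤ 2 * (|lam| * D * (1 + t) ^ (-(26 / 25) : ℝ) * volume.real s) := by gcongr
      _ = _ := by rw [hE]; ring
  have h0T : (0 : ℝ) ∈ Icc 0 T := ⟨le_rfl, hT⟩
  have h0 : ‖fourierRestrict s (u 0)‖ ^ 2 ≤ D0 * volume.real s := by
    rw [← eU 0 h0T]
    have h := norm_setIntegral_le_of_norm_le_const_ae' (μ := volume)
      (f := fun η => ‖U 0 ((2 * Real.pi) • η)‖ ^ 2) (C := D0) hs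
      (Filter.Eventually.of_forall fun η hη => by
        rw [Real.norm_of_nonneg (by positivity)]; exact hinit η hη)
    exact (le_abs_self _).trans h
  have main := image_le_of_deriv_right_le_deriv_boundary (a := 0) (b := T)
    (f := fun t => ‖fourierRestrict s (u t)‖ ^ 2)
    (f' := fun t => 2 * inner ℝ (fourierRestrict s (u t)) (fourierRestrict s (ut t)))
    (B := fun t => D0 * volume.real s + E * (25 * (1 - (1 + t) ^ (-(1 / 25) : ℝ))))
    (B' := fun t => E * (1 + t) ^ (-(26 / 25) : ℝ))
    (fun t ht => (hder' t ht).continuousWithinAt)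
    (fun t ht => (hder' t (Ico_subset_Icc_self ht)).mono_of_mem_nhdsWithin (Icc_mem_nhdsGE_of_mem ht))
    (by simpa using h0)
    (fun t ht => (hasDerivAt_neg_rpow_one_add ht.1 _ _).continuousAt.continuousWithinAt)
    (fun t ht => (hasDerivAt_neg_rpow_one_add ht.1 _ _).hasDerivWithinAt)
    (fun t ht => hrate' t (Ico_subset_Icc_self ht)) ht
  rw [eU t ht]
  refine main.trans ?_
  have hE0 : 0 ≤ E := by positivity
  have : 0 ≤ (1 + t) ^ (-(1 / 25) : ℝ) := Real.rpow_nonneg (by linarith [ht.1]) _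
  -- The constant `50` is `2·25`, with `25 = ∫₀^∞ (1+s)^{-26/25} ds`.
  calc _ ≤ D0 * volume.real s + E * (25 * (1 - 0)) := by gcongr
    _ = _ := by rw [hE]; ring

/-- A continuous function whose averages are bounded is bounded. -/
theorem le_of_forall_setIntegral_le {g : Plane → ℝ} (cg : Continuous g) {O : Set Plane} (hO : IsOpen O)
    {b : ℝ} (h : ∀ s ⊆ O, MeasurableSet s → volume s < ⊤ → ∫ η in s, g η ≤ b * volume.real s)
    {η : Plane} (hη : η ∈ O) : g η ≤ b := by
  by_contra! hlt
  obtain ⟨c, hbc, hcg⟩ := exists_between hlt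
  have hnear : ∀ᶠ ζ in nhds η, ζ ∈ O ∧ c < g ζ :=
    (hO.eventually_mem hη).and (cg.continuousAt.eventually (lt_mem_nhds hcg))
  obtain ⟨r, hr, hball⟩ := Metric.eventually_nhds_iff_ball.1 hnear
  have hfin : volume (Metric.closedBall η (r / 2)) < ⊤ := measure_closedBall_lt_top
  have hsub : Metric.closedBall η (r / 2) ⊆ Metric.ball η r :=
    Metric.closedBall_subset_ball (by linarith)
  have h1 := h _ (fun ζ hζ => (hball ζ (hsub hζ)).1) measurableSet_closedBall hfin
  have hpos : 0 < volume.real (Metric.closedBall η (r / 2)) :=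
    ENNReal.toReal_pos (Metric.measure_closedBall_pos volume η (by positivity)).ne' hfin.ne
  have h2 : c * volume.real (Metric.closedBall η (r / 2)) ≤ ∫ ζ in Metric.closedBall η (r / 2), g ζ := by
    have := setIntegral_mono_on (μ := volume) (f := fun _ => c) (g := g)
      (s := Metric.closedBall η (r / 2)) (integrableOn_const hfin.ne)
      (cg.continuousOn.integrableOn_compact (isCompact_closedBall _ _)) measurableSet_closedBall
      fun ζ hζ => (hball ζ (hsub hζ)).2.le
    rw [setIntegral_const, smul_eq_mul, mul_comm] at this
    exact this
  nlinarith

/-- Uniform in time weighted bound for the Fourier transform of a small solution. -/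
theorem exists_uniform_bound {n k : ℝ} (hn : 1000 ≤ n) (hk : k = n / 100) (lam : ℝ) :
    ∃ C : ℝ, 0 < C ∧ ∀ (B T : ℝ) (u : ℝ → L2), 0 ≤ B → IsSolution lam T u →
      (∀ t ∈ Icc 0 T, ProfileBound n (B * jap t ^ (1 / 50 : ℝ)) (expItD t (u t)) ∧
        hat (u t) =ᵐ[volume] evol t (expItD t (u t))) →
      ∀ t ∈ Icc 0 T, ∀ ξ, jap ξ ^ (n / 3) * ‖ft (expItD t (u t)) ξ‖ ^ 2 ≤ C * (B ^ 2 + B ^ 4) := by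
  obtain ⟨C0, hC0, h0⟩ := exists_ft_decay (n := n) (by linarith)
  obtain ⟨C1, hC1, h1⟩ := exists_abs_im_hartreeHat_weighted_le hn hk
  obtain ⟨C2, hC2, h2⟩ := exists_evol_bounds hn
  refine ⟨2 ^ (n / 3) * (C0 ^ 2 + 50 * |lam| * C1), by positivity,
    fun B T u hB hu hprof t ht ξ => ?_⟩
  have hT : 0 ≤ T := ht.1.trans ht.2
  have hj := jap_pos ξ
  -- The mass estimate is applied inside the open set where the bracket exceeds `⟨ξ⟩/2`. There the
  -- weight is at least `P`, so it becomes a constant at the price `2^{n/3}`; continuity of `f̂`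
  -- then turns averages into the value at `ξ`.
  set R := jap ξ / 2 with hR
  have hR0 : 0 < R := by positivity
  set P := R ^ (n / 3) with hP
  have hP0 : 0 < P := by positivity
  have hjt : ∀ t : ℝ, 0 < jap t := fun t => lt_of_lt_of_le one_pos (one_le_jap_time t)
  have hβ : ∀ t : ℝ, 0 ≤ B * jap t ^ (1 / 50 : ℝ) := fun t => by have := hjt t; positivity
  set O : Set Plane := {η | R < jap ((2 * Real.pi) • η)} with hO
  have hOo : IsOpen O := isOpen_lt continuous_const (continuous_jap.comp (continuous_const_smul _))
  have hPle : ∀ η ∈ O, P ≤ jap ((2 * Real.pi) • η) ^ (n / 3) := fun η hη =>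
    Real.rpow_le_rpow hR0.le (le_of_lt hη) (by linarith)
  have hkey : ∀ η ∈ O, ‖ft (expItD t (u t)) ((2 * Real.pi) • η)‖ ^ 2 ≤
      (C0 * B) ^ 2 / P + 50 * |lam| * (C1 * B ^ 4 / P) := by
    intro η hη
    have cF := continuous_ft ((hprof t ht).1.integrable (hβ t))
    refine le_of_forall_setIntegral_le (g := fun η => ‖ft (expItD t (u t)) ((2 * Real.pi) • η)‖ ^ 2)
      (by fun_prop) hOo (fun s hsO hsm hsf => ?_) hη
    have := setIntegral_fourier_sq_le hu (U := fun t => evol t (expItD t (u t)))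
      (a := fun t => C2 * (B * jap t ^ (1 / 50 : ℝ)))
      (fun t ht => (h2 _ _ (hβ t) (hprof t ht).1 t).1)
      (fun t ht => (h2 _ _ (hβ t) (hprof t ht).1 t).2.2) (fun t ht => (hprof t ht).2) hsm hsf
      (D := C1 * B ^ 4 / P) (D0 := (C0 * B) ^ 2 / P) (by positivity)
      (fun ζ hζ => ?_) (fun t ht ζ hζ => ?_) ht
    · simpa only [norm_evol] using this
    · have hp := hPle ζ (hsO hζ)
      have hz1 := one_le_jap ((2 * Real.pi) • ζ)
      have hd := h0 _ _ (hβ 0) (hprof 0 ⟨le_rfl, hT⟩).1 ((2 * Real.pi) • ζ)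
      have hj0 : jap (0 : ℝ) = 1 := by simp [jap]
      rw [hj0, Real.one_rpow, mul_one] at hd
      have hq1 : 1 ≤ jap ((2 * Real.pi) • ζ) ^ (n / 3) := Real.one_le_rpow hz1 (by linarith)
      rw [norm_evol, le_div_iff₀ hP0]
      calc _ ≤ ‖ft (expItD 0 (u 0)) ((2 * Real.pi) • ζ)‖ ^ 2 *
            (jap ((2 * Real.pi) • ζ) ^ (n / 3) * jap ((2 * Real.pi) • ζ) ^ (n / 3)) := by
            gcongr
            exact hp.trans (le_mul_of_one_le_left (by linarith) hq1)
        _ = (jap ((2 * Real.pi) • ζ) ^ (n / 3) * ‖ft (expItD 0 (u 0)) ((2 * Real.pi) • ζ)‖) ^ 2 := by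
            ring
        _ ≤ _ := by
            have hz0 := jap_pos ((2 * Real.pi) • ζ)
            gcongr
    · have hp := hPle ζ (hsO hζ)
      have := h1 B _ t hB ht.1 (hprof t ht).1 ((2 * Real.pi) • ζ)
      rw [div_mul_eq_mul_div, le_div_iff₀ hP0]
      refine le_trans ?_ this
      rw [mul_comm]
      gcongr
  have hξ : (2 * Real.pi)⁻¹ • ξ ∈ O := by
    change R < jap ((2 * Real.pi) • (2 * Real.pi)⁻¹ • ξ)
    rw [two_pi_smul_inv, hR]; linarith
  have := hkey _ hξ
  rw [two_pi_smul_inv] at this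
  have e : jap ξ ^ (n / 3) = 2 ^ (n / 3) * P := by
    rw [hP, ← Real.mul_rpow (by norm_num) hR0.le, hR]; congr 1; ring
  rw [e]
  calc _ ≤ 2 ^ (n / 3) * P * ((C0 * B) ^ 2 / P + 50 * |lam| * (C1 * B ^ 4 / P)) := by gcongr
    _ = 2 ^ (n / 3) * (C0 ^ 2 * B ^ 2 + 50 * |lam| * C1 * B ^ 4) := by field_simp
    _ ≤ 2 ^ (n / 3) * ((C0 ^ 2 + 50 * |lam| * C1) * B ^ 2 + (C0 ^ 2 + 50 * |lam| * C1) * B ^ 4) := by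
        have : 0 ≤ 50 * |lam| * C1 := by positivity
        gcongr <;> nlinarith
    _ = _ := by ring

/-! ### Symbols of derivatives and of `⟨D⟩^ℓ`; weak derivatives as inverse transforms. -/

theorem IsSymbol.mono {k k' N N' : ℝ} {p p1 p2} (h : IsSymbol k N p p1 p2) (hk : k ≤ k')
    (hN0 : 0 ≤ N) (hN : N ≤ N') : IsSymbol k' N' p p1 p2 := by
  have hle : ∀ ξ : Plane, N * jap ξ ^ k ≤ N' * jap ξ ^ k' := fun ξ => by
    have := jap_pos ξ
    have := one_le_jap ξ
    have := hN0.trans hN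
    gcongr
  exact ⟨h.cont, h.cont1, h.cont2, h.deriv1, h.deriv2, fun ξ => (h.bound ξ).trans (hle ξ),
    fun v ξ hv => (h.bound1 v ξ hv).trans (hle ξ),
    fun u v ξ hu hv => (h.bound2 u v ξ hu hv).trans (hle ξ)⟩

theorem hasLineDerivAt_jap_rpow (l : ℝ) (ξ v : Plane) :
    HasLineDerivAt ℝ (fun ζ : Plane => jap ζ ^ l) (l * jap ξ ^ (l - 1) * djap v ξ) ξ v :=
  hasLineDerivAt_comp (Real.hasDerivAt_rpow_const (Or.inl (jap_pos ξ).ne')) (hasLineDerivAt_jap ξ v)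

/-- One constant covers three bounds: `1` for the value, `l` for first derivatives, `l(l+1) + 2l`
for second ones. -/
theorem isSymbol_jap_rpow {l : ℝ} (hl : 0 ≤ l) :
    IsSymbol l (1 + 3 * l + l * (l + 1)) (fun ξ => ((jap ξ ^ l : ℝ) : ℂ))
      (fun v ξ => ((l * jap ξ ^ (l - 1) * djap v ξ : ℝ) : ℂ))
      (fun u v ξ => ((l * ((l - 1) * jap ξ ^ (l - 1 - 1) * djap u ξ) * djap v ξ
        + l * jap ξ ^ (l - 1) * ddjap u v ξ : ℝ) : ℂ)) := by
  have c0 := continuous_jap_rpow l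
  have c1 := continuous_jap_rpow (l - 1)
  have c2 := continuous_jap_rpow (l - 1 - 1)
  have d1 := continuous_djap
  have d2 := continuous_ddjap
  have hp : ∀ ξ : Plane, 0 < jap ξ ^ l := fun ξ => Real.rpow_pos_of_pos (jap_pos ξ) _
  have hr : ∀ (ξ : Plane) (s : ℝ), s ≤ l → 0 ≤ jap ξ ^ s ∧ jap ξ ^ s ≤ jap ξ ^ l := fun ξ s hs =>
    ⟨Real.rpow_nonneg (jap_pos ξ).le _, Real.rpow_le_rpow_of_exponent_le (one_le_jap ξ) hs⟩
  refine ⟨by fun_prop, fun v => by fun_prop, fun u v => by fun_prop,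
    fun v ξ => hasLineDerivAt_ofReal (hasLineDerivAt_jap_rpow l ξ v), fun u v ξ => ?_,
    fun ξ => ?_, fun v ξ hv => ?_, fun u v ξ hu hv => ?_⟩
  · refine hasLineDerivAt_ofReal (hasLineDerivAt_congr_deriv
      (hasLineDerivAt_mul (hasLineDerivAt_mul (hasLineDerivAt_const l)
      (hasLineDerivAt_jap_rpow (l - 1) ξ u)) (hasLineDerivAt_djap ξ u v)) ?_)
    ring
  · rw [Complex.norm_real, Real.norm_of_nonneg (hp ξ).le]
    refine le_mul_of_one_le_left (hp ξ).le ?_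
    have : 0 ≤ l * (l + 1) := by positivity
    linarith
  · obtain ⟨r0, r1⟩ := hr ξ (l - 1) (by linarith)
    rw [Complex.norm_real, Real.norm_eq_abs, abs_mul, abs_mul, abs_of_nonneg hl, abs_of_nonneg r0]
    have hl' := hp ξ
    calc _ ≤ l * jap ξ ^ l * 1 := by gcongr; exact (abs_djap_le v ξ).trans hv
      _ ≤ (1 + 3 * l + l * (l + 1)) * jap ξ ^ l := by
        have : 0 ≤ l * (l + 1) := by positivity
        rw [mul_one]
        exact mul_le_mul_of_nonneg_right (by linarith) (hp ξ).le
  · obtain ⟨r0, r1⟩ := hr ξ (l - 1) (by linarith)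
    obtain ⟨s0, s1⟩ := hr ξ (l - 1 - 1) (by linarith)
    rw [Complex.norm_real, Real.norm_eq_abs]
    refine (abs_add_le _ _).trans ?_
    rw [abs_mul, abs_mul, abs_mul, abs_mul, abs_mul (l * _), abs_mul l, abs_of_nonneg hl,
      abs_of_nonneg r0, abs_of_nonneg s0]
    have hl1 : |l - 1| ≤ l + 1 := by rw [abs_le]; constructor <;> linarith
    have hl' := hp ξ
    have hj := jap_pos ξ
    calc _ ≤ l * ((l + 1) * jap ξ ^ l * 1) * 1 + l * jap ξ ^ l * (2 * 1 * 1) := by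
          gcongr
          · exact (abs_djap_le u ξ).trans hu
          · exact (abs_djap_le v ξ).trans hv
          · exact (abs_ddjap_le u v ξ).trans (by gcongr)
      _ ≤ _ := by nlinarith [hp ξ, mul_nonneg hl (hp ξ).le]

theorem isSymbol_one : IsSymbol 0 1 (fun _ => 1) (fun _ _ => 0) (fun _ _ _ => 0) :=
  ⟨continuous_const, fun _ => continuous_const, fun _ _ => continuous_const,
    fun _ _ => hasLineDerivAt_const _, fun _ _ _ => hasLineDerivAt_const _, fun ξ => by simp,
    fun v ξ _ => by simp, fun u v ξ _ _ => by simp⟩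

/-- The factor `3` counts the terms of the second derivative by the product rule; the coordinate
itself has none. -/
theorem IsSymbol.mul_coord {k N : ℝ} {p p1 p2} (h : IsSymbol k N p p1 p2) (hN : 0 ≤ N) (j : Fin 2) :
    ∃ q1 q2, IsSymbol (k + 1) (3 * N) (fun ξ => (Complex.I * (ξ j : ℂ)) * p ξ) q1 q2 := by
  have hd : ∀ v ξ : Plane, HasLineDerivAt ℝ (fun ζ : Plane => Complex.I * (ζ j : ℂ))
      (Complex.I * (v j : ℂ)) ξ v := fun v ξ => by
    have h0 := hasLineDerivAt_inner_left (ξ := ξ) (v := v) (e j)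
    have e1 : ∀ ζ : Plane, inner ℝ (e j) ζ = ζ j := fun ζ => by
      simp [e, EuclideanSpace.inner_single_left]
    simp only [e1] at h0
    exact hasLineDerivAt_congr_deriv (hasLineDerivAt_mul (hasLineDerivAt_const Complex.I)
      (hasLineDerivAt_ofReal h0)) (by ring)
  have c0 := h.cont
  have c1 := h.cont1
  have c2 := h.cont2
  have hco : ∀ ξ : Plane, ‖Complex.I * (ξ j : ℂ)‖ ≤ ‖ξ‖ := fun ξ => by
    rw [norm_mul, Complex.norm_I, one_mul, Complex.norm_real]
    exact PiLp.norm_apply_le ξ j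
  have hcj : ∀ ξ : Plane, ‖Complex.I * (ξ j : ℂ)‖ ≤ jap ξ := fun ξ => (hco ξ).trans (norm_le_jap ξ)
  have hk : ∀ ξ : Plane, jap ξ * jap ξ ^ k = jap ξ ^ (k + 1) := fun ξ => by
    rw [Real.rpow_add_one (jap_pos ξ).ne', mul_comm]
  have hk0 : ∀ ξ : Plane, 0 ≤ jap ξ ^ k := fun ξ => Real.rpow_nonneg (jap_pos ξ).le _
  have hk1 : ∀ ξ : Plane, jap ξ ^ k ≤ jap ξ ^ (k + 1) := fun ξ =>
    Real.rpow_le_rpow_of_exponent_le (one_le_jap ξ) (by linarith)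
  refine ⟨fun v ξ => Complex.I * (v j : ℂ) * p ξ + Complex.I * (ξ j : ℂ) * p1 v ξ,
    fun u v ξ => Complex.I * (v j : ℂ) * p1 u ξ
      + (Complex.I * (u j : ℂ) * p1 v ξ + Complex.I * (ξ j : ℂ) * p2 u v ξ),
    by fun_prop, fun v => by fun_prop, fun u v => by fun_prop,
    fun v ξ => hasLineDerivAt_mul (hd v ξ) (h.deriv1 v ξ),
    fun u v ξ => hasLineDerivAt_add (hasLineDerivAt_congr_deriv
      (hasLineDerivAt_mul (hasLineDerivAt_const _) (h.deriv1 u ξ)) (by ring))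
      (hasLineDerivAt_mul (hd u ξ) (h.deriv2 u v ξ)),
    fun ξ => ?_, fun v ξ hv => ?_, fun u v ξ hu hv => ?_⟩
  · rw [norm_mul]
    have hj := jap_pos ξ
    calc _ ≤ jap ξ * (N * jap ξ ^ k) := by gcongr; exacts [hcj ξ, h.bound ξ]
      _ = N * jap ξ ^ (k + 1) := by rw [← hk]; ring
      _ ≤ _ := by
        have := mul_nonneg hN ((hk0 ξ).trans (hk1 ξ))
        linarith
  · refine (norm_add_le _ _).trans ?_
    rw [norm_mul, norm_mul (_ * _) (p1 v ξ)]
    have hj := jap_pos ξ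
    calc _ ≤ 1 * (N * jap ξ ^ k) + jap ξ * (N * jap ξ ^ k) := by
          gcongr; exacts [(hco v).trans hv, h.bound ξ, hcj ξ, h.bound1 v ξ hv]
      _ = N * jap ξ ^ k + N * jap ξ ^ (k + 1) := by rw [← hk]; ring
      _ ≤ _ := by
        have := mul_le_mul_of_nonneg_left (hk1 ξ) hN
        have := mul_nonneg hN ((hk0 ξ).trans (hk1 ξ))
        linarith
  · refine (norm_add_le _ _).trans ((add_le_add_right (norm_add_le _ _) _).trans ?_)
    rw [norm_mul, norm_mul (_ * _) (p1 v ξ), norm_mul (_ * _) (p2 u v ξ)]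
    have hj := jap_pos ξ
    calc _ ≤ 1 * (N * jap ξ ^ k) + (1 * (N * jap ξ ^ k) + jap ξ * (N * jap ξ ^ k)) := by
          gcongr
          exacts [(hco v).trans hv, h.bound1 u ξ hu, (hco u).trans hu, h.bound1 v ξ hv, hcj ξ,
            h.bound2 u v ξ hu hv]
      _ = 2 * (N * jap ξ ^ k) + N * jap ξ ^ (k + 1) := by rw [← hk]; ring
      _ ≤ _ := by
        have := mul_le_mul_of_nonneg_left (hk1 ξ) hN
        linarith

/-- The symbol of an iterated partial derivative. -/
theorem exists_isSymbol_monomial : ∀ (m : ℕ) (I : Fin m → Fin 2), ∃ p1 p2,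
    IsSymbol m (3 ^ m) (fun ξ : Plane => ∏ i, (Complex.I * (ξ (I i) : ℂ))) p1 p2
  | 0, I => ⟨_, _, by simpa using isSymbol_one⟩
  | m + 1, I => by
    obtain ⟨p1, p2, h⟩ := exists_isSymbol_monomial m (fun i => I i.succ)
    obtain ⟨q1, q2, h'⟩ := h.mul_coord (by positivity) (I 0)
    refine ⟨q1, q2, ?_⟩
    simp only [Fin.prod_univ_succ, pow_succ']
    push_cast
    exact h'

theorem hasLineDerivAt_fderiv {E : Type*} [NormedAddCommGroup E] [NormedSpace ℝ E] {ψ : Plane → E}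
    (h : ContDiff ℝ ∞ ψ) (x v : Plane) : HasLineDerivAt ℝ ψ (fderiv ℝ ψ x v) x v :=
  ((h.differentiable (by simp)) x).hasFDerivAt.hasLineDerivAt v

/-- The Fourier transform of an iterated partial derivative of a test function. -/
theorem ft_iteratedFDeriv : ∀ (m : ℕ) (I : Fin m → Fin 2) (φ : Plane → ℝ), ContDiff ℝ ∞ φ →
    HasCompactSupport φ →
    ContDiff ℝ ∞ (fun x => iteratedFDeriv ℝ m φ x fun i => EuclideanSpace.single (I i) (1 : ℝ)) ∧
    HasCompactSupport (fun x => iteratedFDeriv ℝ m φ x fun i => EuclideanSpace.single (I i) (1 : ℝ)) ∧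
    ∀ ξ, ft (fun x => ((iteratedFDeriv ℝ m φ x fun i => EuclideanSpace.single (I i) (1 : ℝ) : ℝ) : ℂ)) ξ
      = (∏ i, (Complex.I * (ξ (I i) : ℂ))) * ft (fun x => (φ x : ℂ)) ξ
  | 0, I, φ, hφ, hs => by simpa using ⟨hφ, hs⟩
  | m + 1, I, φ, hφ, hs => by
    obtain ⟨h1, h2, h3⟩ := ft_iteratedFDeriv m (fun i => I i.succ) φ hφ hs
    set ψ : Plane → ℝ := fun x => iteratedFDeriv ℝ m φ x fun i =>
      EuclideanSpace.single (I i.succ) (1 : ℝ) with hψ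
    have e1 : (fun x => iteratedFDeriv ℝ (m + 1) φ x fun i => EuclideanSpace.single (I i) (1 : ℝ)) =
        fun x => fderiv ℝ ψ x (e (I 0)) := by
      ext x
      have hd : DifferentiableAt ℝ (iteratedFDeriv ℝ m φ) x :=
        (hφ.differentiable_iteratedFDeriv (m := m) (by exact_mod_cast WithTop.coe_lt_top _)) x
      rw [iteratedFDeriv_succ_apply_left, hψ]
      rw [fderiv_continuousMultilinear_apply_const_apply hd]
      rfl
    have hc : ContDiff ℝ ∞ fun x => fderiv ℝ ψ x (e (I 0)) :=
      (h1.fderiv_right (m := ∞) (by simp)).clm_apply contDiff_const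
    have hcs : HasCompactSupport fun x => fderiv ℝ ψ x (e (I 0)) :=
      (h2.fderiv ℝ).comp_left (g := fun L : Plane →L[ℝ] ℝ => L (e (I 0))) rfl
    simp only [funext_iff] at e1
    refine ⟨by simpa only [e1] using hc, by simpa only [e1] using hcs, fun ξ => ?_⟩
    simp only [e1]
    rw [Fin.prod_univ_succ, mul_assoc, ← h3, ft, ft]
    have hE : ∀ x : Plane, HasLineDerivAt ℝ (fun x : Plane =>
        Complex.exp (((-inner ℝ x ξ : ℝ) : ℂ) * Complex.I))
        (Complex.exp (((-inner ℝ x ξ : ℝ) : ℂ) * Complex.I) * ((-(ξ (I 0)) : ℝ) * Complex.I)) x (e (I 0)) :=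
      fun x => by
      refine hasLineDerivAt_cexp (hasLineDerivAt_congr_deriv (hasLineDerivAt_sub
        (hasLineDerivAt_const 0) (hasLineDerivAt_inner_right ξ)) ?_ |>.congr_of_eventuallyEq ?_)
      · simp [e, EuclideanSpace.inner_single_left]
      · exact Filter.Eventually.of_forall fun y => by simp
    have hib := integral_mul_lineDeriv (v := e (I 0)) (by fun_prop) (by fun_prop)
      (Complex.continuous_ofReal.comp h1.continuous) (Complex.continuous_ofReal.comp hc.continuous)
      (h2.comp_left (g := ((↑) : ℝ → ℂ)) rfl) (hcs.comp_left (g := ((↑) : ℝ → ℂ)) rfl) hE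
      (fun x => hasLineDerivAt_ofReal (hasLineDerivAt_fderiv h1 x (e (I 0))))
    calc _ = ∫ x, Complex.exp (((-inner ℝ x ξ : ℝ) : ℂ) * Complex.I) * ((fderiv ℝ ψ x (e (I 0)) : ℝ) : ℂ) := by
          congr 1; ext x; push_cast; rw [neg_mul]
      _ = _ := hib
      _ = _ := by
          rw [← integral_neg, ← integral_const_mul]
          congr 1; ext x
          simp only [Function.comp_apply]
          push_cast; rw [neg_mul]; ring

/-- Fubini's theorem for the inverse Fourier transform. -/
theorem integral_mul_ift {ψ V : Plane → ℂ} (iψ : Integrable ψ) (iV : Integrable V) :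
    ∫ x, ψ x * ift V x = ((2 * Real.pi) ^ 2 : ℝ)⁻¹ * ∫ ξ, ft ψ (-ξ) * V ξ := by
  have hp : Integrable (fun z : Plane × Plane =>
      ψ z.1 * (Complex.exp ((inner ℝ z.1 z.2 : ℝ) * Complex.I) * V z.2)) (volume.prod volume) := by
    have h2 : Continuous fun p : Plane × Plane =>
        Complex.exp ((inner ℝ p.1 p.2 : ℝ) * Complex.I) := by fun_prop
    refine ((iψ.mul_prod iV).bdd_mul (c := 1) h2.aestronglyMeasurable
      (Filter.Eventually.of_forall fun p => (Complex.norm_exp_ofReal_mul_I _).le)).congr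
      (Filter.Eventually.of_forall fun p => ?_)
    ring
  calc _ = (((2 * Real.pi) ^ 2 : ℝ)⁻¹ : ℝ) * ∫ x, ∫ ξ, ψ x *
        (Complex.exp ((inner ℝ x ξ : ℝ) * Complex.I) * V ξ) := by
        rw [← integral_const_mul]; congr 1; ext x; rw [ift, integral_const_mul]; ring
    _ = (((2 * Real.pi) ^ 2 : ℝ)⁻¹ : ℝ) * ∫ ξ, ∫ x, ψ x *
        (Complex.exp ((inner ℝ x ξ : ℝ) * Complex.I) * V ξ) := by rw [integral_integral_swap hp]
    _ = _ := by
        congr 2; ext ξ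
        rw [ft, ← integral_mul_const]
        congr 1; ext x
        rw [inner_neg_right]; push_cast; rw [neg_mul, neg_neg]; ring

/-- Both pairings are moved to the Fourier side by Fubini. The transform of the test function is
evaluated at `-ξ`, and the `m` factors `-iξ_j` produce the sign `(-1)^m`. -/
theorem isWeakDeriv_ift {m : ℕ} (I : Fin m → Fin 2) {g : Plane → ℂ} {U : Plane → ℂ}
    (iU : Integrable U) (hg : g =ᵐ[volume] ift U)
    (iV : Integrable fun ξ : Plane => (∏ i, (Complex.I * (ξ (I i) : ℂ))) * U ξ) :
    IsWeakDeriv I g (ift fun ξ => (∏ i, (Complex.I * (ξ (I i) : ℂ))) * U ξ) := by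
  refine ⟨(continuous_ift iV).locallyIntegrable, fun φ hφ hs => ?_⟩
  obtain ⟨h1, h2, h3⟩ := ft_iteratedFDeriv m I φ hφ hs
  have i1 : Integrable fun x => ((iteratedFDeriv ℝ m φ x fun i =>
      EuclideanSpace.single (I i) (1 : ℝ) : ℝ) : ℂ) :=
    (h1.continuous.integrable_of_hasCompactSupport h2).ofReal
  have i2 : Integrable fun x => (φ x : ℂ) := (hφ.continuous.integrable_of_hasCompactSupport hs).ofReal
  have e1 : ∫ x, (iteratedFDeriv ℝ m φ x fun i => EuclideanSpace.single (I i) (1 : ℝ)) • g x =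
      ∫ x, ((iteratedFDeriv ℝ m φ x fun i => EuclideanSpace.single (I i) (1 : ℝ) : ℝ) : ℂ) * ift U x := by
    refine integral_congr_ae ?_
    filter_upwards [hg] with x hx
    rw [hx, Complex.real_smul]
  rw [e1]
  simp only [Complex.real_smul]
  have e3 : ∀ ξ : Plane, ft (fun x => ((iteratedFDeriv ℝ m φ x fun i =>
      EuclideanSpace.single (I i) (1 : ℝ) : ℝ) : ℂ)) (-ξ) * U ξ = (-1) ^ m *
      (ft (fun x => (φ x : ℂ)) (-ξ) * ((∏ i, (Complex.I * (ξ (I i) : ℂ))) * U ξ)) := fun ξ => by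
    have e2 : ∀ i, Complex.I * (((-ξ : Plane) (I i) : ℝ) : ℂ) =
        (-1) * (Complex.I * (ξ (I i) : ℂ)) := fun i => by simp
    rw [h3]
    simp only [e2]
    rw [Finset.prod_mul_distrib, Finset.prod_const, Finset.card_univ, Fintype.card_fin]
    ring
  rw [integral_mul_ift i1 iU, integral_mul_ift i2 iV]
  simp only [e3]
  rw [integral_const_mul]
  push_cast
  ring

/-! ### Decay of the solution. -/

theorem cexp_mul_evol (t : ℝ) (f : Plane → ℂ) (p : ℂ) (x ξ : Plane) :
    Complex.exp ((inner ℝ x ξ : ℝ) * Complex.I) * (p * evol t f ξ) = osc t x ξ * (p * ft f ξ) := by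
  have : osc t x ξ = Complex.exp ((inner ℝ x ξ : ℝ) * Complex.I) * phase t ξ := by
    rw [osc, phase, ← Complex.exp_add]; congr 1; push_cast; ring
  rw [this, evol]; ring

theorem norm_ift_mul_evol_le (t : ℝ) (f : Plane → ℂ) (p : Plane → ℂ) (x : Plane) :
    ‖ift (fun ξ => p ξ * evol t f ξ) x‖ ≤ ‖∫ ξ, osc t x ξ * (p ξ * ft f ξ)‖ := by
  have hπ : (1 : ℝ) ≤ (2 * Real.pi) ^ 2 := by nlinarith [Real.pi_gt_three]
  simp only [ift, cexp_mul_evol]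
  rw [norm_mul, Complex.norm_real, Real.norm_of_nonneg (by positivity)]
  exact mul_le_of_le_one_left (norm_nonneg _) (inv_le_one_of_one_le₀ hπ)

/-- A symbol of moderate order acts on a bounded profile. -/
theorem IsSymbol.mul_evol {n k N β : ℝ} {p p1 p2} {f : Plane → ℂ} (hp : IsSymbol k N p p1 p2)
    (hN : 0 ≤ N) (hkn : k ≤ n - 2) (hβ : 0 ≤ β) (hf : ProfileBound n β f) (t : ℝ) :
    Integrable (fun ξ => p ξ * evol t f ξ) ∧ MemLp (fun ξ => p ξ * evol t f ξ) 2 volume := by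
  obtain ⟨C, hC, h⟩ := exists_integral_ft_le
  obtain ⟨i, -⟩ := h n β f hβ hf
  have hm : AEStronglyMeasurable (fun ξ => p ξ * evol t f ξ) volume :=
    (hp.cont.mul (hf.continuous_evol hβ t)).aestronglyMeasurable
  have hle : ∀ (s : ℝ) (ξ : Plane), k ≤ s → ‖p ξ * evol t f ξ‖ ≤ N * (jap ξ ^ s * ‖ft f ξ‖) :=
    fun s ξ hs => by
    rw [norm_mul, norm_evol, ← mul_assoc]
    refine mul_le_mul_of_nonneg_right ((hp.bound ξ).trans ?_) (norm_nonneg _)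
    exact mul_le_mul_of_nonneg_left (Real.rpow_le_rpow_of_exponent_le (one_le_jap ξ) hs) hN
  refine ⟨(i.const_mul N).mono' hm (Filter.Eventually.of_forall fun ξ => hle _ ξ hkn), ?_⟩
  have hL : MemLp (fun ξ => ((jap ξ ^ n : ℝ) : ℂ) * ft f ξ) 2 volume := by
    refine ⟨?_, hf.sobolev.trans_lt ENNReal.ofReal_lt_top⟩
    have := continuous_jap_rpow n
    have := continuous_ft (hf.integrable hβ)
    exact Continuous.aestronglyMeasurable (by fun_prop)
  refine hL.of_le_mul (c := N) hm (Filter.Eventually.of_forall fun ξ => ?_)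
  rw [norm_mul (Complex.ofReal _), Complex.norm_real,
    Real.norm_of_nonneg (Real.rpow_nonneg (jap_pos ξ).le _)]
  exact hle n ξ (by linarith)

/-- For `t ≥ 1` the factor `t^{-2/5}` of the linear estimate absorbs the growth `⟨t⟩^{1/50}` of the
profile. For `t ≤ 1` the oscillation is ignored and integrability of the weighted transform
suffices. -/
theorem exists_ift_decay {n k : ℝ} (hn : 1000 ≤ n) (hk : k = n / 100) : ∃ C : ℝ, 0 < C ∧
    ∀ (B N S : ℝ) (f : Plane → ℂ) (p p1 p2), 0 ≤ B → 0 ≤ N → 0 ≤ S → ∀ t : ℝ, 0 ≤ t →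
      ProfileBound n (B * jap t ^ (1 / 50 : ℝ)) f → IsSymbol k N p p1 p2 →
      (∀ ξ, jap ξ ^ (k + 4) * ‖ft f ξ‖ ≤ S) →
      ∀ x, ‖ift (fun ξ => p ξ * evol t f ξ) x‖ ≤ C * N * (S + B) * (jap t)⁻¹ := by
  obtain ⟨C0, hC0, h0⟩ := exists_linear_decay hn hk
  obtain ⟨C1, hC1, h1⟩ := exists_integral_ft_le
  refine ⟨4 * C0 + 4 * C1, by positivity, fun B N S f p p1 p2 hB hN hS t ht hf hp hF x => ?_⟩
  have hj := one_le_jap_time t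
  have hj1 := jap_time_le ht
  have hj0 : 0 < jap t := by linarith
  have hβ : 0 ≤ B * jap t ^ (1 / 50 : ℝ) := by positivity
  refine (norm_ift_mul_evol_le t f p x).trans ?_
  rcases le_total 1 t with h | h
  · refine (h0 _ N S f p p1 p2 hβ hN hS hf hp hF t h x).trans ?_
    have hs : jap t ^ (1 / 50 : ℝ) * t ^ (-(2 / 5) : ℝ) ≤ 2 := by
      calc _ ≤ (2 * t) ^ (1 / 50 : ℝ) * t ^ (-(2 / 5) : ℝ) := by gcongr; linarith
        _ = 2 ^ (1 / 50 : ℝ) * (t ^ (1 / 50 : ℝ) * t ^ (-(2 / 5) : ℝ)) := by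
          rw [Real.mul_rpow (by norm_num) ht, mul_assoc]
        _ ≤ 2 ^ (1 : ℝ) * 1 := by
          rw [← Real.rpow_add (by linarith)]
          refine mul_le_mul (Real.rpow_le_rpow_of_exponent_le (by norm_num) (by norm_num))
            (Real.rpow_le_one_of_one_le_of_nonpos h (by norm_num)) (by positivity) (by positivity)
        _ = 2 := by norm_num
    have ht2 : 1 / t ≤ 2 * (jap t)⁻¹ := by
      rw [← div_eq_mul_inv, div_le_div_iff₀ (by linarith) hj0]; linarith
    have hSB : S + B * jap t ^ (1 / 50 : ℝ) * t ^ (-(2 / 5) : ℝ) ≤ 2 * (S + B) := by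
      rw [mul_assoc]
      nlinarith [mul_le_mul_of_nonneg_left hs hB]
    calc _ = C0 * N * (S + B * jap t ^ (1 / 50 : ℝ) * t ^ (-(2 / 5) : ℝ)) * (1 / t) := by ring
      _ ≤ C0 * N * (2 * (S + B)) * (2 * (jap t)⁻¹) := by gcongr
      _ = 4 * C0 * (N * (S + B) * (jap t)⁻¹) := by ring
      _ ≤ (4 * C0 + 4 * C1) * (N * (S + B) * (jap t)⁻¹) := by gcongr; linarith
      _ = _ := by ring
  · obtain ⟨i, l⟩ := h1 n _ f hβ hf
    have hj2 : jap t ≤ 2 := by linarith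
    have hs : jap t ^ (1 / 50 : ℝ) ≤ 2 :=
      (Real.rpow_le_rpow_of_exponent_le hj (by norm_num : (1 / 50 : ℝ) ≤ 1)).trans
        (by rwa [Real.rpow_one])
    have ht2 : 1 ≤ 2 * (jap t)⁻¹ := by
      rw [← div_eq_mul_inv, le_div_iff₀ hj0]; linarith
    calc _ ≤ ∫ ξ, N * (jap ξ ^ (n - 2) * ‖ft f ξ‖) := by
          refine norm_integral_le_of_norm_le (i.const_mul N) (Filter.Eventually.of_forall fun ξ => ?_)
          rw [norm_mul, norm_osc, one_mul, norm_mul, ← mul_assoc]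
          refine mul_le_mul_of_nonneg_right ((hp.bound ξ).trans ?_) (norm_nonneg _)
          exact mul_le_mul_of_nonneg_left
            (Real.rpow_le_rpow_of_exponent_le (one_le_jap ξ) (by linarith)) hN
      _ ≤ N * (C1 * (B * jap t ^ (1 / 50 : ℝ))) := by
          rw [integral_const_mul]; gcongr
      _ ≤ N * (C1 * (B * 2)) * 1 := by rw [mul_one]; gcongr
      _ ≤ N * (C1 * ((S + B) * 2)) * (2 * (jap t)⁻¹) := by gcongr; linarith
      _ = 4 * C1 * (N * (S + B) * (jap t)⁻¹) := by ring
      _ ≤ (4 * C0 + 4 * C1) * (N * (S + B) * (jap t)⁻¹) := by gcongr; linarith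
      _ = _ := by ring

/-- Dispersive decay for small solutions, after application of a symbol of order `n / 100`. -/
theorem exists_solution_decay {n k lam A : ℝ} (hn : 1000 ≤ n) (hk : k = n / 100) (hA : 0 < A) :
    ∃ C : ℝ, 0 < C ∧ ∀ (ε T : ℝ) (u : ℝ → L2), 0 < ε → ε ≤ 1 → IsSolution lam T u →
      normSigma n k (1 / 100) T u ≤ ENNReal.ofReal (A * ε) → ∀ t ∈ Icc 0 T,
      ∃ U : Plane → ℂ, hat (u t) =ᵐ[volume] U ∧ ∀ (N : ℝ) (p p1 p2), 0 ≤ N → IsSymbol k N p p1 p2 →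
        Integrable (fun ξ => p ξ * U ξ) ∧ MemLp (fun ξ => p ξ * U ξ) 2 volume ∧
        ∀ x, ‖ift (fun ξ => p ξ * U ξ) x‖ ≤ C * N * (jap t)⁻¹ * ε := by
  obtain ⟨C0, hC0, h0⟩ := exists_ift_decay hn hk
  obtain ⟨C1, hC1, h1⟩ := exists_uniform_bound hn hk lam
  set M : ℝ := Real.sqrt (C1 * ((7 * A) ^ 2 + (7 * A) ^ 4)) with hM
  refine ⟨C0 * (M + 7 * A), by positivity, fun ε T u hε hε1 hu hsig t ht => ?_⟩
  have hB : 0 ≤ 7 * (A * ε) := by positivity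
  have hP := fun t ht => profileBound_of_normSigma_le (t := t) (by linarith) (by positivity) hsig ht
  obtain ⟨hf, hU⟩ := hP t ht
  have hj0 : 0 < jap t := by linarith [one_le_jap_time t]
  have hS : ∀ ξ, jap ξ ^ (k + 4) * ‖ft (expItD t (u t)) ξ‖ ≤ M * ε := fun ξ => by
    refine le_of_sq_le_sq ?_ (by positivity)
    calc _ = (jap ξ ^ (k + 4)) ^ 2 * ‖ft (expItD t (u t)) ξ‖ ^ 2 := mul_pow _ _ _
      -- The uniform bound is strong enough because `2(k + 4) = n/50 + 8 ≤ n/3`.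
      _ ≤ jap ξ ^ (n / 3) * ‖ft (expItD t (u t)) ξ‖ ^ 2 := by
        gcongr
        rw [← Real.rpow_natCast, ← Real.rpow_mul (jap_pos ξ).le]
        refine Real.rpow_le_rpow_of_exponent_le (one_le_jap ξ) ?_
        push_cast; linarith
      _ ≤ C1 * ((7 * (A * ε)) ^ 2 + (7 * (A * ε)) ^ 4) := h1 _ T u hB hu hP t ht ξ
      _ ≤ C1 * ((7 * A) ^ 2 + (7 * A) ^ 4) * ε ^ 2 := by
        -- Smallness enters here: `ε ≤ 1` reduces the quartic contribution to a quadratic one, so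
        -- the decay is linear in `ε`.
        have e4 : ε ^ 4 ≤ ε ^ 2 := pow_le_pow_of_le_one hε.le hε1 (by norm_num)
        have := mul_le_mul_of_nonneg_left e4 (by positivity : 0 ≤ C1 * (7 * A) ^ 4)
        nlinarith
      _ = _ := by rw [mul_pow M, hM, Real.sq_sqrt (by positivity)]
  refine ⟨_, hU, fun N p p1 p2 hN hp => ?_⟩
  obtain ⟨i, m⟩ := hp.mul_evol hN (by linarith) (by positivity) hf t
  refine ⟨i, m, fun x => (h0 _ N _ _ p p1 p2 hB hN (by positivity) t ht.1 hf hp hS x).trans_eq ?_⟩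
  ring

theorem eLpNorm_top_le_of_ae_eq {g h : Plane → ℂ} {a : ℝ} (hg : g =ᵐ[volume] h)
    (hb : ∀ x, ‖h x‖ ≤ a) : eLpNorm g ⊤ volume ≤ ENNReal.ofReal a := by
  rw [eLpNorm_congr_ae hg, eLpNorm_exponent_top]
  exact eLpNormEssSup_le_of_ae_bound (Filter.Eventually.of_forall hb)

end SemiRelHartree

open SemiRelHartree in
theorem proposition2p1 (n k δ₀ lam A : ℝ) (hn : 1000 ≤ n) (hk : k = n / 100)
    (hδ₀ : δ₀ = 1 / 100) (hA : 0 < A) :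
    ∃ εbar : ℝ, 0 < εbar ∧ ∃ C : ℝ, 0 < C ∧
      ∀ (ε₁ T : ℝ) (u : ℝ → SemiRelHartree.L2),
        0 < ε₁ → ε₁ ≤ εbar → 0 < T →
        SemiRelHartree.IsSolution lam T u →
        SemiRelHartree.normSigma n k δ₀ T u ≤ ENNReal.ofReal (A * ε₁) →
        ∀ t : ℝ, 0 ≤ t → t ≤ T →
          (∀ l : ℕ, (l : ℝ) ≤ k →
            SemiRelHartree.supSobolevNorm l (u t)
              ≤ ENNReal.ofReal (C * (SemiRelHartree.jap t)⁻¹ * ε₁)) ∧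
          (∀ l : ℝ, 0 ≤ l → l ≤ k →
            SemiRelHartree.supBesselNorm l (u t)
              ≤ ENNReal.ofReal (C * (SemiRelHartree.jap t)⁻¹ * ε₁)) := by
  subst hδ₀
  obtain ⟨C, hC, h⟩ := exists_solution_decay (lam := lam) hn hk hA
  have hk0 : 0 ≤ k := by linarith
  -- The threshold `1` is enough. The constant adds the symbol bounds of the two norms: `3^m ≤ 3^k`
  -- for monomials of degree `m ≤ k`, and the constant of `isSymbol_jap_rpow`, increasing in `l`,
  -- for `⟨ξ⟩^l`.
  refine ⟨1, one_pos, C * (3 ^ k + (1 + 3 * k + k * (k + 1))), by positivity,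
    fun ε T u hε hε1 _ hu hsig t ht htT => ?_⟩
  obtain ⟨U, hU, hp⟩ := h ε T u hε hε1 hu hsig t ⟨ht, htT⟩
  have hj0 : 0 < jap t := by linarith [one_le_jap_time t]
  have hmono : ∀ N N' : ℝ, N ≤ N' → C * N * (jap t)⁻¹ * ε ≤ C * N' * (jap t)⁻¹ * ε :=
    fun N N' h => by gcongr
  constructor
  · refine fun l hl => iSup₂_le fun m hm => iSup_le fun I => ?_
    obtain ⟨p1, p2, hI⟩ := exists_isSymbol_monomial m I
    have hmk : (m : ℝ) ≤ k := le_trans (by exact_mod_cast hm) hl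
    obtain ⟨iV, -, hV⟩ := hp _ _ _ _ (by positivity) (hI.mono hmk (by positivity) le_rfl)
    have iU : Integrable U := by
      obtain ⟨i1, -⟩ := hp _ _ _ _ zero_le_one (isSymbol_one.mono hk0 zero_le_one le_rfl)
      simpa using i1
    have hg : (u t : Plane → ℂ) =ᵐ[volume] ift U := by
      rw [← ift_congr hU]
      exact ae_eq_ift_hat (iU.congr hU.symm)
    refine iInf₂_le_of_le _ (isWeakDeriv_ift I iU hg iV) ?_
    refine eLpNorm_top_le_of_ae_eq Filter.EventuallyEq.rfl fun x => (hV x).trans (hmono _ _ ?_)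
    have : (3 : ℝ) ^ m ≤ 3 ^ k := by
      rw [← Real.rpow_natCast]
      exact Real.rpow_le_rpow_of_exponent_le (by norm_num) hmk
    nlinarith
  · intro l hl hlk
    obtain ⟨iV, mV, hV⟩ := hp _ _ _ _ (by positivity) ((isSymbol_jap_rpow hl).mono hlk
      (by positivity) le_rfl)
    obtain ⟨g, hg⟩ := exists_hat_ae_eq mV
    have hgm : IsMultiplier (fun ξ => ((jap ξ ^ l : ℝ) : ℂ)) (u t) g := by
      filter_upwards [hg, hU] with ξ h1 h2
      rw [h1, h2]
    refine iInf₂_le_of_le g hgm ?_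
    have hgI : (g : Plane → ℂ) =ᵐ[volume] ift fun ξ => ((jap ξ ^ l : ℝ) : ℂ) * U ξ := by
      rw [← ift_congr hg]
      exact ae_eq_ift_hat (iV.congr hg.symm)
    refine eLpNorm_top_le_of_ae_eq hgI fun x => (hV x).trans (hmono _ _ ?_)
    have : (0 : ℝ) ≤ 3 ^ k := by positivity
    nlinarith
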